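/- **Setting.** For each $n$, on a probability space that may depend on $n$, there are $n$ independent individuals with $m$ observations each ($m$ fixed): covariate matrices $X_i=(x_{i1},\dots,x_{im})^T\in\mathbb R^{m\times p_n}$ (random or fixed) and responses $Y_i=(y_{i1},\dots,y_{im})^T$, the pairs $(X_i,Y_i)$ being independent. Let $g$ be the mean function (inverse canonical link), $\mu_{ij}(\beta)=g(x_{ij}^T\beta)$, $A_i(\beta)=\mathrm{diag}(g'(x_{ij}^T\beta))_{j\le m}$ and $\varepsilon_i(\beta)=A_i(\beta)^{-1/2}(Y_i-\mu_i(\beta))$. For the true parameter $\beta_0=\beta_{0,n}\in\mathbb R^{p_n}$, $E(Y_i\mid X_i)=\mu_i(\beta_0)$ and $\mathrm{cov}(Y_i\mid X_i)=\phi A_i(\beta_0)^{1/2}R_0A_i(\beta_0)^{1/2}$ with a constant $\phi>0$ and a correlation matrix $R_0=R_{0,n}$. Let $\pi_1,\dots,\pi_n\in(0,1]$ be sampling probabilities (possibly depending on the data) with $\sum_i\pi_i=r=r_n$ nonrandom; given $(X_i,Y_i,\pi_i)_{i\le n}$, the indicators $\delta_i$ are independent Bernoulli$(\pi_i)$, so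 $r$ is the expected size of the Poisson subsample $\{i:\delta_i=1\}$. With an estimated $m\times m$ working correlation matrix $\tilde R$ (any random matrix), put $$S_r(\beta)=\frac1n\sum_{i=1}^n\frac{\delta_i}{\pi_i}X_i^TA_i^{1/2}(\beta)\tilde R^{-1}\varepsilon_i(\beta).$$ $Z_n=O_p(a_n)$ means: for every $\epsilon>0$ there is $M$ with $P(|Z_n|>Ma_n)\le\epsilon$ for all large $n$. Norms are Euclidean (Frobenius for matrices). **Assumptions** (bounds that involve the covariates or the $\pi_i$ hold almost surely, for all large $n$; constants do not depend on $n$). * (C1) $\sup_{i,j}\|x_{ij}\|=O(\sqrt{p_n})$. * (C2) $\beta_0$ lies in a compact set $\mathcal B_n\subset\mathbb R^{p_n}$, and for every $\Delta>0$ the closed ball of radius $\Delta\sqrt{p_n/r}$ about $\beta_0$ is contained in $\mathcal B_n$ for all large $n$. * (C3) There are positive constants with $b_1\le\lambda_{\min}(\frac1n\sum_iX_i^TX_i)\le\lambda_{\max}(\frac1n\sum_iX_i^TX_i)\le b_2$ and $b_3\le\lambda_{\min}(\frac rn\sum_i\frac1{n\pi_i}X_i^TX_i)\le\lambda_{\max}(\frac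 rn\sum_i\frac1{n\pi_i}X_i^TX_i)\le b_4$. * (C4) $R_0$ and a positive definite $\bar R=\bar R_n$ have eigenvalues bounded away from $0$ and $\infty$, and $\|\tilde R^{-1}-\bar R^{-1}\|=O_p(\sqrt{p_n/r})$. * (C5) For some $M_1,\delta>0$, $E\|\varepsilon_i(\beta_0)\|^{2+\delta}\le M_1$ for all $i$. * (C6) For all $\beta\in\mathcal B_n$ and all $i,j$, $g$ is three times continuously differentiable at $x_{ij}^T\beta$, $g'(x_{ij}^T\beta)$ is bounded away from $0$ and $\infty$, and $|g''(x_{ij}^T\beta)|,|g'''(x_{ij}^T\beta)|\le M_2$. * (C7) $\max_{i\le n}\frac1{n\pi_i}=O_p(1/r)$. **Theorem 1.** Assume (C1)–(C7) and $p_n^2/r\to0$. 1. There are random vectors $\tilde\beta=\tilde\beta_n$ which with probability tending to one lie in $\mathcal B_n$ and solve $S_r(\tilde\beta)=0$, and which satisfy $\|\tilde\beta-\beta_0\|=O_p(\sqrt{p_n/r})$. 2. The same rate holds for every local solution: if $\rho_n\sqrt{p_n}\to0$, the closed ball of radius $\rho_n$ about $\beta_0$ is contained in $\mathcal B_n$ for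 all large $n$, and $\tilde\beta$ is any sequence that with probability tending to one lies in this ball and satisfies $S_r(\tilde\beta)=0$, then $\|\tilde\beta-\beta_0\|=O_p(\sqrt{p_n/r})$. -/

import Mathlib

open MeasureTheory ProbabilityTheory Filter Topology Matrix

noncomputable section

namespace SubGEE

/-- `Z n = O_p (a n)`: for every `ε > 0` there is `M` such that, for all large `n`,
`P n (|Z n| > M * a n) ≤ ε`. The probability space may change with `n`. -/
def IsBigOP {Ω : ℕ → Type*} [∀ n, MeasurableSpace (Ω n)] (P : ∀ n, Measure (Ω n))
    (Z : ∀ n, Ω n → ℝ) (a : ℕ → ℝ) : Prop :=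
  ∀ ε : ℝ, 0 < ε → ∃ M : ℝ, 0 < M ∧
    ∀ᶠ n : ℕ in atTop, P n {ω | M * a n < |Z n ω|} ≤ ENNReal.ofReal ε

/-- `E n` holds with probability tending to one (the complement is asymptotically null). -/
def WithProbTendstoOne {Ω : ℕ → Type*} [∀ n, MeasurableSpace (Ω n)] (P : ∀ n, Measure (Ω n))
    (E : ∀ n, Ω n → Prop) : Prop :=
  Tendsto (fun n => P n {ω | ¬ E n ω}) atTop (𝓝 0)

/-- The real matrix `M` is symmetric and `a ≤ λ_min(M) ≤ λ_max(M) ≤ b`. -/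
def EigBounds {k : ℕ} (M : Matrix (Fin k) (Fin k) ℝ) (a b : ℝ) : Prop :=
  ∃ h : M.IsHermitian, ∀ i, a ≤ h.eigenvalues i ∧ h.eigenvalues i ≤ b

/-- Frobenius norm of a square matrix. -/
def frobNorm {k : ℕ} (M : Matrix (Fin k) (Fin k) ℝ) : ℝ :=
  √(∑ j, ∑ l, M j l ^ 2)

section Estimating

variable {m p : ℕ}

/-- Linear predictors `η_j = x_jᵀ β` of one individual; the rows of `X` are the `x_jᵀ`. -/
def eta (X : Matrix (Fin m) (Fin p) ℝ) (β : EuclideanSpace ℝ (Fin p)) : Fin m → ℝ :=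
  X *ᵥ β.ofLp

/-- Marginal means `μ_j(β) = g(x_jᵀ β)`. -/
def mu (g : ℝ → ℝ) (X : Matrix (Fin m) (Fin p) ℝ) (β : EuclideanSpace ℝ (Fin p)) : Fin m → ℝ :=
  fun j => g (eta X β j)

/-- `A(β)^{1/2}`, where `A(β) = diag(g'(x_jᵀ β))` is the (canonical) variance matrix. -/
def sqrtA (g : ℝ → ℝ) (X : Matrix (Fin m) (Fin p) ℝ) (β : EuclideanSpace ℝ (Fin p)) :
    Matrix (Fin m) (Fin m) ℝ :=
  diagonal fun j => √(deriv g (eta X β j))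

/-- `A(β)^{-1/2}`. -/
def invSqrtA (g : ℝ → ℝ) (X : Matrix (Fin m) (Fin p) ℝ) (β : EuclideanSpace ℝ (Fin p)) :
    Matrix (Fin m) (Fin m) ℝ :=
  diagonal fun j => (√(deriv g (eta X β j)))⁻¹

/-- Standardized residual `ε(β) = A(β)^{-1/2} (Y - μ(β))` of one individual. -/
def resid (g : ℝ → ℝ) (X : Matrix (Fin m) (Fin p) ℝ) (Y : Fin m → ℝ)
    (β : EuclideanSpace ℝ (Fin p)) : Fin m → ℝ :=
  invSqrtA g X β *ᵥ (Y - mu g X β)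

/-- The weighted estimating function of the subsample `{i | δ i = true}` of `n` individuals,
`S_r(β) = n⁻¹ ∑_{i sampled} π_i⁻¹ X_iᵀ A_i(β)^{1/2} R⁻¹ ε_i(β)`. -/
def score {n : ℕ} (g : ℝ → ℝ) (X : Fin n → Matrix (Fin m) (Fin p) ℝ) (Y : Fin n → Fin m → ℝ)
    (π : Fin n → ℝ) (δ : Fin n → Bool) (R : Matrix (Fin m) (Fin m) ℝ)
    (β : EuclideanSpace ℝ (Fin p)) : Fin p → ℝ :=
  (1 / (n : ℝ)) • ∑ i, (if δ i then 1 / π i else 0) •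
    ((X i)ᵀ *ᵥ (sqrtA g (X i) β *ᵥ (R⁻¹ *ᵥ resid g (X i) (Y i) β)))

end Estimating

/-- The data of the problem: for each `n`, a sample of `n` individuals with `m` observations
each, its Poisson subsample, and the associated parameters. Laws are imposed in `IsModel`. -/
structure Arr (m : ℕ) (Ω : ℕ → Type*) where
  /-- dimension of the regression parameter -/
  p : ℕ → ℕ
  /-- expected subsample size -/
  r : ℕ → ℝ
  /-- mean function -/
  g : ℝ → ℝ
  /-- dispersion parameter -/
  φ : ℝ
  /-- true parameter -/
  β₀ : ∀ n, EuclideanSpace ℝ (Fin (p n))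
  /-- parameter set -/
  B : ∀ n, Set (EuclideanSpace ℝ (Fin (p n)))
  /-- covariate matrices, one per individual -/
  X : ∀ n, Ω n → Fin n → Matrix (Fin m) (Fin (p n)) ℝ
  /-- responses -/
  Y : ∀ n, Ω n → Fin n → Fin m → ℝ
  /-- sampling probabilities -/
  π : ∀ n, Ω n → Fin n → ℝ
  /-- sampling indicators -/
  δ : ∀ n, Ω n → Fin n → Bool
  /-- true correlation matrix -/
  R₀ : ℕ → Matrix (Fin m) (Fin m) ℝ
  /-- limiting working correlation matrix -/
  Rbar : ℕ → Matrix (Fin m) (Fin m) ℝ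
  /-- estimated working correlation matrix -/
  Rtilde : ∀ n, Ω n → Matrix (Fin m) (Fin m) ℝ

namespace Arr

variable {m : ℕ} {Ω : ℕ → Type*}

/-- The random estimating function `S_r` of row `n`. -/
def S (D : Arr m Ω) (n : ℕ) (ω : Ω n) (β : EuclideanSpace ℝ (Fin (D.p n))) : Fin (D.p n) → ℝ :=
  score D.g (D.X n ω) (D.Y n ω) (D.π n ω) (D.δ n ω) (D.Rtilde n ω) β

/-- The rate `√(p_n / r_n)`. -/
def rate (D : Arr m Ω) (n : ℕ) : ℝ := √((D.p n : ℝ) / D.r n)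

/-- The sigma-algebra generated by the covariates of individual `i`. -/
@[reducible]
def sigmaX (D : Arr m Ω) (n : ℕ) (i : Fin n) : MeasurableSpace (Ω n) :=
  MeasurableSpace.comap (fun ω j k => D.X n ω i j k) (inferInstance :
    MeasurableSpace (Fin m → Fin (D.p n) → ℝ))

/-- The sigma-algebra generated by the full data `(X, Y)` and the sampling probabilities. -/
@[reducible]
def sigmaData (D : Arr m Ω) (n : ℕ) : MeasurableSpace (Ω n) :=
  MeasurableSpace.comap
    (fun ω => ((fun i j k => D.X n ω i j k), D.Y n ω, D.π n ω))
    (inferInstance : MeasurableSpace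
      ((Fin n → Fin m → Fin (D.p n) → ℝ) × (Fin n → Fin m → ℝ) × (Fin n → ℝ)))

variable [∀ n, MeasurableSpace (Ω n)]

/-- The longitudinal marginal model with Poisson subsampling. -/
structure IsModel (D : Arr m Ω) (P : ∀ n, Measure (Ω n)) : Prop where
  meas_g : Measurable D.g
  meas_X : ∀ n i j k, Measurable fun ω => D.X n ω i j k
  meas_Y : ∀ n i j, Measurable fun ω => D.Y n ω i j
  meas_π : ∀ n i, Measurable fun ω => D.π n ω i
  meas_δ : ∀ n i, Measurable fun ω => D.δ n ω i
  meas_Rtilde : ∀ n j k, Measurable fun ω => D.Rtilde n ω j k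
  φ_pos : 0 < D.φ
  /-- different individuals are independent -/
  indep : ∀ n, iIndepFun
    (fun (i : Fin n) ω => ((fun j k => D.X n ω i j k : Fin m → Fin (D.p n) → ℝ), D.Y n ω i)) (P n)
  int_Y : ∀ n i j, Integrable (fun ω => D.Y n ω i j) (P n)
  memLp_resid : ∀ n i j,
    MemLp (fun ω => D.Y n ω i j - mu D.g (D.X n ω i) (D.β₀ n) j) 2 (P n)
  /-- `E (Y_ij | X_i) = g (x_ijᵀ β₀)` -/
  mean : ∀ n i j, (P n)[fun ω => D.Y n ω i j | D.sigmaX n i] =ᵐ[P n]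
    fun ω => mu D.g (D.X n ω i) (D.β₀ n) j
  /-- `cov (Y_i | X_i) = φ A_i(β₀)^{1/2} R₀ A_i(β₀)^{1/2}` -/
  cov : ∀ n i j k,
    (P n)[fun ω => (D.Y n ω i j - mu D.g (D.X n ω i) (D.β₀ n) j) *
        (D.Y n ω i k - mu D.g (D.X n ω i) (D.β₀ n) k) | D.sigmaX n i] =ᵐ[P n]
      fun ω => (D.φ • (sqrtA D.g (D.X n ω i) (D.β₀ n) * D.R₀ n *
        sqrtA D.g (D.X n ω i) (D.β₀ n))) j k
  /-- `R₀` is a correlation matrix -/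
  R₀_symm : ∀ n, (D.R₀ n).IsSymm
  R₀_diag : ∀ n j, D.R₀ n j j = 1
  π_mem : ∀ n, ∀ᵐ ω ∂P n, ∀ i, 0 < D.π n ω i ∧ D.π n ω i ≤ 1
  /-- `r = ∑ π_i` -/
  π_sum : ∀ n, ∀ᵐ ω ∂P n, ∑ i, D.π n ω i = D.r n
  /-- Poisson sampling: given the data and the sampling probabilities, the indicators are
  independent and `δ_i` is Bernoulli with parameter `π_i`. -/
  poisson : ∀ n (e : Fin n → Bool),
    (P n)[Set.indicator {ω | D.δ n ω = e} (fun _ => (1 : ℝ)) | D.sigmaData n] =ᵐ[P n]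
      fun ω => ∏ i, if e i then D.π n ω i else 1 - D.π n ω i

/-- `sup_{i,j} ‖x_ij‖ = O(√p_n)`. -/
def C1 (D : Arr m Ω) (P : ∀ n, Measure (Ω n)) : Prop :=
  ∃ K : ℝ, ∀ᶠ n : ℕ in atTop, ∀ᵐ ω ∂P n, ∀ i j,
    ‖(WithLp.toLp 2 (D.X n ω i j) : EuclideanSpace ℝ (Fin (D.p n)))‖ ≤ K * √(D.p n)

/-- The parameter sets are compact and contain the true parameters, well inside: every ball of
radius of the order `√(p_n / r_n)` about the true parameter is eventually contained in them. -/
def C2 (D : Arr m Ω) : Prop :=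
  (∀ n, IsCompact (D.B n)) ∧ (∀ n, D.β₀ n ∈ D.B n) ∧
    ∀ Δ : ℝ, 0 < Δ → ∀ᶠ n : ℕ in atTop, Metric.closedBall (D.β₀ n) (Δ * D.rate n) ⊆ D.B n

/-- Eigenvalue bounds on the unweighted and on the weighted Gram matrix. -/
def C3 (D : Arr m Ω) (P : ∀ n, Measure (Ω n)) : Prop :=
  (∃ b₁ b₂ : ℝ, 0 < b₁ ∧ 0 < b₂ ∧ ∀ᶠ n : ℕ in atTop, ∀ᵐ ω ∂P n,
    EigBounds ((1 / (n : ℝ)) • ∑ i, (D.X n ω i)ᵀ * D.X n ω i) b₁ b₂) ∧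
  (∃ b₃ b₄ : ℝ, 0 < b₃ ∧ 0 < b₄ ∧ ∀ᶠ n : ℕ in atTop, ∀ᵐ ω ∂P n,
    EigBounds ((D.r n / (n : ℝ)) • ∑ i, (1 / ((n : ℝ) * D.π n ω i)) • ((D.X n ω i)ᵀ * D.X n ω i)) b₃ b₄)

/-- Eigenvalue bounds on the correlation matrices, and the rate of `R̃⁻¹`. -/
def C4 (D : Arr m Ω) (P : ∀ n, Measure (Ω n)) : Prop :=
  (∃ a b : ℝ, 0 < a ∧ ∀ᶠ n : ℕ in atTop, EigBounds (D.R₀ n) a b) ∧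
  (∃ a b : ℝ, 0 < a ∧ ∀ᶠ n : ℕ in atTop, EigBounds (D.Rbar n) a b) ∧
  IsBigOP P (fun n ω => frobNorm ((D.Rtilde n ω)⁻¹ - (D.Rbar n)⁻¹)) D.rate

/-- Uniformly bounded moments of order `2 + δ` of the standardized residuals at `β₀`. -/
def C5 (D : Arr m Ω) (P : ∀ n, Measure (Ω n)) : Prop :=
  ∃ M₁ δ : ℝ, 0 < M₁ ∧ 0 < δ ∧ ∀ᶠ n : ℕ in atTop, ∀ i,
    ∫⁻ ω, ENNReal.ofReal (‖(WithLp.toLp 2 (resid D.g (D.X n ω i) (D.Y n ω i) (D.β₀ n)) :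
      EuclideanSpace ℝ (Fin m))‖ ^ (2 + δ)) ∂P n ≤ ENNReal.ofReal M₁

/-- On the parameter set, the first derivative of the mean function is bounded away from `0` and
`∞`, and its second and third derivatives are bounded. -/
def C6 (D : Arr m Ω) (P : ∀ n, Measure (Ω n)) : Prop :=
  ∃ c C M₂ : ℝ, 0 < c ∧ 0 < M₂ ∧ ∀ᶠ n : ℕ in atTop, ∀ᵐ ω ∂P n, ∀ i j, ∀ β ∈ D.B n,
    ContDiffAt ℝ 3 D.g (eta (D.X n ω i) β j) ∧
    c ≤ deriv D.g (eta (D.X n ω i) β j) ∧ deriv D.g (eta (D.X n ω i) β j) ≤ C ∧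
    |iteratedDeriv 2 D.g (eta (D.X n ω i) β j)| ≤ M₂ ∧
    |iteratedDeriv 3 D.g (eta (D.X n ω i) β j)| ≤ M₂

/-- `max_i 1 / (n π_i) = O_p(1 / r)`. -/
def C7 (D : Arr m Ω) (P : ∀ n, Measure (Ω n)) : Prop :=
  IsBigOP P (fun n ω => ⨆ i, 1 / ((n : ℝ) * D.π n ω i)) (fun n => 1 / D.r n)

end Arr

end SubGEE

end

noncomputable section

namespace SubGEE

/-! The whole argument rests on one deterministic picture: with probability tending to one, `S_r` is
strongly monotone (decreasing) and Lipschitz, with constants not depending on `n`, on balls about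
`β₀` of any radius `ρ` with `√p ρ → 0`, while `‖S_r(β₀)‖ = O_p(√(p/r))`.

Given this, a zero `β` in such a ball satisfies `κ‖β - β₀‖² ≤ ⟨β - β₀, S_r(β₀)⟩`, so Cauchy–Schwarz
gives the rate (`norm_sub_le_of_field_eq_zero`). For existence, take balls of radius `(k_n +
1)√(p/r)` with `k_n → ∞` slowly. There `S_r(β₀)` is small compared with the radius, and `β ↦ β + t
S_r(β)` is a contraction of the ball (`exists_zero_of_strongly_monotone`). Its iterates from `β₀`
are measurable, hence so is their limit.

Monotonicity comes from linearizing the increments of `S_r` at `β₀` (`exists_linearization`,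
`exists_monotonicity_constants`). Minus the increment is a principal part `∑ w_i X_iᵀ A_i^{1/2} R̃⁻¹
A_i^{1/2} X_i`, coercive because the weighted Gram matrix and `R̃⁻¹` are, up to noise terms linear
in the residuals and a Taylor remainder. The noise consists of `p × p` matrices with squared
Frobenius norm `O_p(p²/r) → 0`. The remainder carries a factor `√p ρ → 0`, since the linear
predictors move by at most a multiple of `√p ρ`.

All stochastic bounds are second moment computations (`weighted_sum_isBigOP`). A weight splits into
its mean `1/n` given the data and a sampling fluctuation. The fluctuation has conditional variance
of order `1/r` by (C7), and the mean part has variance of order `1/n ≤ 1/r` by independence of the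
individuals. The matrix `R̃` may depend on all the data, so its entries are always pulled out of the
sums over individuals. -/

/-! ### Quadratic forms of matrices with bounded spectrum. -/

theorem quadForm_conj_diagonal_bounds {k : ℕ} {U : Matrix (Fin k) (Fin k) ℝ} (hU : U * Uᵀ = 1)
    {d : Fin k → ℝ} {a b : ℝ} (hd : ∀ i, a ≤ d i ∧ d i ≤ b) (v : Fin k → ℝ) :
    a * ∑ j, v j ^ 2 ≤ v ⬝ᵥ (U * diagonal d * Uᵀ) *ᵥ v ∧
      v ⬝ᵥ (U * diagonal d * Uᵀ) *ᵥ v ≤ b * ∑ j, v j ^ 2 := by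
  set w := Uᵀ *ᵥ v with hw
  have h1 : v ⬝ᵥ (U * diagonal d * Uᵀ) *ᵥ v = ∑ i, d i * w i ^ 2 := by
    rw [← mulVec_mulVec, ← mulVec_mulVec, ← hw, dotProduct_mulVec, ← mulVec_transpose, ← hw]
    simp only [dotProduct, mulVec_diagonal]
    exact Finset.sum_congr rfl fun i _ => by ring
  have h2 : ∑ j, v j ^ 2 = ∑ i, w i ^ 2 := by
    have : w ⬝ᵥ w = v ⬝ᵥ v := by
      conv_lhs => rw [hw]
      rw [mulVec_transpose, ← dotProduct_mulVec, ← mulVec_transpose, mulVec_mulVec, hU, one_mulVec]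
    simpa [dotProduct, sq] using this.symm
  rw [h1, h2, Finset.mul_sum, Finset.mul_sum]
  exact ⟨Finset.sum_le_sum fun i _ => mul_le_mul_of_nonneg_right (hd i).1 (sq_nonneg _),
    Finset.sum_le_sum fun i _ => mul_le_mul_of_nonneg_right (hd i).2 (sq_nonneg _)⟩

theorem EigBounds.exists_diagonalization {k : ℕ} {M : Matrix (Fin k) (Fin k) ℝ} {a b : ℝ}
    (h : EigBounds M a b) : ∃ (U : Matrix (Fin k) (Fin k) ℝ) (d : Fin k → ℝ),
      U * Uᵀ = 1 ∧ M = U * diagonal d * Uᵀ ∧ ∀ i, a ≤ d i ∧ d i ≤ b := by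
  obtain ⟨hM, hd⟩ := h
  refine ⟨hM.eigenvectorUnitary, hM.eigenvalues, ?_, ?_, hd⟩
  · have := Unitary.mul_star_self_of_mem hM.eigenvectorUnitary.2
    rwa [star_eq_conjTranspose, conjTranspose_eq_transpose_of_trivial] at this
  · have := hM.spectral_theorem
    rw [Unitary.conjStarAlgAut_apply] at this
    rw [← conjTranspose_eq_transpose_of_trivial]
    exact this

theorem EigBounds.quadForm {k : ℕ} {M : Matrix (Fin k) (Fin k) ℝ} {a b : ℝ}
    (h : EigBounds M a b) (v : Fin k → ℝ) :
    a * ∑ j, v j ^ 2 ≤ v ⬝ᵥ M *ᵥ v ∧ v ⬝ᵥ M *ᵥ v ≤ b * ∑ j, v j ^ 2 := by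
  obtain ⟨U, d, hU, rfl, hd⟩ := h.exists_diagonalization
  exact quadForm_conj_diagonal_bounds hU hd v

/-- The inverse is diagonalized by the same orthogonal matrix with reciprocal entries, so the
conjugated-diagonal bound applies again. -/
theorem EigBounds.inv_quadForm {k : ℕ} {M : Matrix (Fin k) (Fin k) ℝ} {a b : ℝ} (ha : 0 < a)
    (h : EigBounds M a b) (v : Fin k → ℝ) :
    b⁻¹ * ∑ j, v j ^ 2 ≤ v ⬝ᵥ M⁻¹ *ᵥ v ∧ v ⬝ᵥ M⁻¹ *ᵥ v ≤ a⁻¹ * ∑ j, v j ^ 2 := by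
  obtain ⟨U, d, hU, rfl, hd⟩ := h.exists_diagonalization
  have hU' : Uᵀ * U = 1 := mul_eq_one_comm.mp hU
  have hd0 : ∀ i, 0 < d i := fun i => ha.trans_le (hd i).1
  have : (U * diagonal d * Uᵀ)⁻¹ = U * diagonal (fun i => (d i)⁻¹) * Uᵀ := by
    apply Matrix.inv_eq_right_inv
    have h3 : diagonal d * diagonal (fun i => (d i)⁻¹) = 1 := by
      rw [diagonal_mul_diagonal, ← diagonal_one]
      congr 1; ext i; exact mul_inv_cancel₀ (hd0 i).ne'
    calc U * diagonal d * Uᵀ * (U * diagonal (fun i => (d i)⁻¹) * Uᵀ)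
        = U * diagonal d * (Uᵀ * U) * diagonal (fun i => (d i)⁻¹) * Uᵀ := by
          simp only [Matrix.mul_assoc]
      _ = U * (diagonal d * diagonal (fun i => (d i)⁻¹)) * Uᵀ := by
          rw [hU', Matrix.mul_one, Matrix.mul_assoc U]
      _ = 1 := by rw [h3, Matrix.mul_one, hU]
  rw [this]
  exact quadForm_conj_diagonal_bounds hU
    (fun i => ⟨inv_anti₀ (hd0 i) (hd i).2, inv_anti₀ ha (hd i).1⟩) v

/-- The entries of a symmetric matrix are controlled by its quadratic form. -/
theorem abs_entry_inv_le {k : ℕ} {M : Matrix (Fin k) (Fin k) ℝ} {a b : ℝ} (ha : 0 < a)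
    (h : EigBounds M a b) (j l : Fin k) : |M⁻¹ j l| ≤ a⁻¹ := by
  obtain ⟨U, d, hU, hM, hd⟩ := h.exists_diagonalization
  have hsymm : (M⁻¹)ᵀ = M⁻¹ := by
    have : Mᵀ = M := by have := h.1; rwa [IsHermitian, conjTranspose_eq_transpose_of_trivial] at this
    rw [transpose_nonsing_inv, this]
  have hb : 0 ≤ b⁻¹ := inv_nonneg.mpr (ha.le.trans ((hd j).1.trans (hd j).2))
  have key : ∀ v : Fin k → ℝ, 0 ≤ v ⬝ᵥ M⁻¹ *ᵥ v ∧ v ⬝ᵥ M⁻¹ *ᵥ v ≤ a⁻¹ * ∑ j, v j ^ 2 := fun v =>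
    ⟨(mul_nonneg hb (Finset.sum_nonneg fun i _ => sq_nonneg _)).trans (h.inv_quadForm ha v).1,
      (h.inv_quadForm ha v).2⟩
  have hjl : M⁻¹ l j = M⁻¹ j l := by exact congrFun (congrFun hsymm j) l
  have e1 : ∀ s : ℝ, (Pi.single j 1 + s • Pi.single l 1 : Fin k → ℝ) ⬝ᵥ
      M⁻¹ *ᵥ (Pi.single j 1 + s • Pi.single l 1) = M⁻¹ j j + 2 * s * M⁻¹ j l + s ^ 2 * M⁻¹ l l := by
    intro s
    simp only [mulVec_add, mulVec_smul, add_dotProduct, dotProduct_add, smul_dotProduct,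
      dotProduct_smul, mulVec_single_one, single_dotProduct, col_apply, smul_eq_mul, one_mul, hjl]
    ring
  have hdiag : ∀ i, 0 ≤ M⁻¹ i i ∧ M⁻¹ i i ≤ a⁻¹ := by
    intro i
    have := key (Pi.single i 1)
    simpa [mulVec_single_one, Pi.single_apply, ite_pow] using this
  -- Nonnegativity at `e_j ± e_l` bounds twice the modulus of the off-diagonal entry by the sum of
  -- the two diagonal entries, each at most `a⁻¹`.
  have hp := (key (Pi.single j 1 + (1 : ℝ) • Pi.single l 1)).1
  have hn := (key (Pi.single j 1 + (-1 : ℝ) • Pi.single l 1)).1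
  rw [e1] at hp hn
  have := hdiag j; have := hdiag l
  rw [abs_le]; constructor <;> linarith

/-! ### Zeros of strongly monotone fields by a fixed-step iteration. -/

/-- A strongly monotone Lipschitz field on a ball, small at the centre, has a zero in the ball which
is the limit of the fixed-step iteration started at the centre. -/
theorem exists_zero_of_strongly_monotone {E : Type*} [NormedAddCommGroup E] [InnerProductSpace ℝ E]
    [CompleteSpace E] (F : E → E) (x₀ : E) {ρ κ L : ℝ} (hκ : 0 < κ) (hκL : κ ≤ L) (hρ : 0 ≤ ρ)
    (hmono : ∀ x ∈ Metric.closedBall x₀ ρ, ∀ y ∈ Metric.closedBall x₀ ρ,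
      inner ℝ (x - y) (F x - F y) ≤ -κ * ‖x - y‖ ^ 2)
    (hlip : ∀ x ∈ Metric.closedBall x₀ ρ, ∀ y ∈ Metric.closedBall x₀ ρ,
      ‖F x - F y‖ ≤ L * ‖x - y‖)
    (h0 : 2 * ‖F x₀‖ ≤ κ * ρ) :
    ∃ y ∈ Metric.closedBall x₀ ρ, F y = 0 ∧
      Tendsto (fun k => (fun x => x + (κ / L ^ 2) • F x)^[k] x₀) atTop (𝓝 y) := by
  have hL : 0 < L := hκ.trans_le hκL
  -- This step minimizes `1 - 2tκ + t²L²`, the bound on the squared contraction factor of `x ↦ x + t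
  -- F x`; the minimum is `1 - tκ`.
  set t := κ / L ^ 2 with ht
  have ht0 : 0 < t := by positivity
  set T : E → E := fun x => x + t • F x with hT
  have htκ : t * κ ≤ 1 := by
    rw [ht, div_mul_eq_mul_div, div_le_one (by positivity)]; nlinarith
  -- `q² ≥ 1 - tκ`, which avoids a square root in the contraction factor.
  set q := 1 - t * κ / 2 with hq
  have hq0 : 0 ≤ q := by rw [hq]; linarith
  have hq1 : q < 1 := by rw [hq]; have : 0 < t * κ := by positivity
                         linarith
  have hcontr : ∀ x ∈ Metric.closedBall x₀ ρ, ∀ y ∈ Metric.closedBall x₀ ρ,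
      ‖T x - T y‖ ≤ q * ‖x - y‖ := by
    intro x hx y hy
    have h1 : T x - T y = (x - y) + t • (F x - F y) := by simp only [hT, smul_sub]; abel
    have h2 : ‖T x - T y‖ ^ 2 ≤ (q * ‖x - y‖) ^ 2 := by
      rw [h1, norm_add_sq_real, inner_smul_right, norm_smul, Real.norm_of_nonneg ht0.le]
      have hm := hmono x hx y hy
      have hl := hlip x hx y hy
      have hl2 : ‖F x - F y‖ ^ 2 ≤ L ^ 2 * ‖x - y‖ ^ 2 := by
        rw [← mul_pow]; exact pow_le_pow_left₀ (norm_nonneg _) hl 2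
      have htL : t ^ 2 * L ^ 2 = t * κ := by rw [ht]; field_simp
      have h3 : t * inner ℝ (x - y) (F x - F y) ≤ t * (-κ * ‖x - y‖ ^ 2) :=
        mul_le_mul_of_nonneg_left hm ht0.le
      have h4 : (t * ‖F x - F y‖) ^ 2 ≤ t * κ * ‖x - y‖ ^ 2 := by
        rw [mul_pow, ← htL, mul_assoc]; exact mul_le_mul_of_nonneg_left hl2 (by positivity)
      have h5 : (q * ‖x - y‖) ^ 2 = (1 - t * κ + (t * κ / 2) ^ 2) * ‖x - y‖ ^ 2 := by
        rw [hq]; ring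
      rw [h5]
      nlinarith [mul_nonneg (sq_nonneg (t * κ / 2)) (sq_nonneg ‖x - y‖)]
    exact le_of_sq_le_sq h2 (by positivity)
  have hx0 : x₀ ∈ Metric.closedBall x₀ ρ := Metric.mem_closedBall_self hρ
  -- The centre moves by `t‖F x₀‖ ≤ tκρ/2 = (1 - q)ρ`, exactly the room left by a contraction of
  -- factor `q`.
  have hmaps : Set.MapsTo T (Metric.closedBall x₀ ρ) (Metric.closedBall x₀ ρ) := by
    intro x hx
    have h1 := hcontr x hx x₀ hx0
    have h2 : ‖x - x₀‖ ≤ ρ := by simpa [dist_eq_norm] using hx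
    have h3 : ‖T x₀ - x₀‖ = t * ‖F x₀‖ := by
      simp [hT, norm_smul, abs_of_pos ht0]
    rw [Metric.mem_closedBall, dist_eq_norm]
    calc ‖T x - x₀‖ ≤ ‖T x - T x₀‖ + ‖T x₀ - x₀‖ := norm_sub_le_norm_sub_add_norm_sub _ _ _
      _ ≤ q * ρ + t * (κ * ρ / 2) := by
          rw [h3]
          gcongr
          · exact h1.trans (mul_le_mul_of_nonneg_left h2 hq0)
          · linarith
      _ = ρ := by rw [hq]; ring
  have hC : ContractingWith ⟨q, hq0⟩ (hmaps.restrict T _ _) := by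
    refine ⟨by exact_mod_cast hq1, LipschitzWith.of_dist_le_mul fun x y => ?_⟩
    have := hcontr x x.2 y y.2
    rw [Subtype.dist_eq, Subtype.dist_eq, dist_eq_norm, dist_eq_norm]
    exact this
  obtain ⟨y, hy, hfix, hlim, -⟩ := ContractingWith.exists_fixedPoint'
    (Metric.isClosed_closedBall.isComplete) hmaps hC hx0 (edist_ne_top _ _)
  refine ⟨y, hy, ?_, hlim⟩
  have : t • F y = 0 := by simpa [Function.IsFixedPt, hT] using hfix
  exact (smul_eq_zero.mp this).resolve_left ht0.ne'

/-! ### Linearization of one entry of the estimating function. -/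

/-- First order expansion of a function with bounded second derivative on a convex set. -/
theorem abs_sub_sub_deriv_mul_le {f f' f'' : ℝ → ℝ} {I : Set ℝ} (hI : Convex ℝ I)
    (hf : ∀ s ∈ I, HasDerivAt f (f' s) s) (hf' : ∀ s ∈ I, HasDerivAt f' (f'' s) s) {K ω : ℝ}
    (hK : ∀ s ∈ I, |f'' s| ≤ K) {s t s₀ : ℝ} (hs : s ∈ I) (ht : t ∈ I) (hs₀ : s₀ ∈ I)
    (hsω : |s - s₀| ≤ ω) (htω : |t - s₀| ≤ ω) :
    |f s - f t - f' s₀ * (s - t)| ≤ K * ω * |s - t| := by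
  -- On `J` the function minus its linear part at `s₀` has derivative at most `Kω`. The mean value
  -- inequality then gives an error proportional to `|s - t|`, as a monotonicity estimate between
  -- two arbitrary points requires.
  set J := I ∩ Metric.closedBall s₀ ω
  have hJ : Convex ℝ J := hI.inter (convex_closedBall _ _)
  have h1 : ∀ u ∈ J, HasDerivWithinAt (fun u => f u - f' s₀ * u) (f' u - f' s₀) J u := by
    intro u hu
    have := (hf u hu.1).sub ((hasDerivAt_id u).const_mul (f' s₀))
    rw [mul_one] at this
    exact this.hasDerivWithinAt
  have h2 : ∀ u ∈ J, ‖f' u - f' s₀‖ ≤ K * ω := by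
    intro u hu
    have h3 := hI.norm_image_sub_le_of_norm_hasDerivWithin_le
      (fun v hv => (hf' v hv).hasDerivWithinAt) (fun v hv => hK v hv) hs₀ hu.1
    have hK0 : 0 ≤ K := (abs_nonneg _).trans (hK _ hs)
    refine h3.trans (mul_le_mul_of_nonneg_left ?_ hK0)
    have := hu.2
    rwa [Metric.mem_closedBall, dist_eq_norm] at this
  have h3 := hJ.norm_image_sub_le_of_norm_hasDerivWithin_le h1 h2
    (⟨ht, by simpa [Real.dist_eq] using htω⟩ : t ∈ J) (⟨hs, by simpa [Real.dist_eq] using hsω⟩ : s ∈ J)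
  simp only [Real.norm_eq_abs] at h3
  convert h3 using 2
  ring

theorem abs_image_sub_le {f f' : ℝ → ℝ} {I : Set ℝ} (hI : Convex ℝ I)
    (hf : ∀ s ∈ I, HasDerivAt f (f' s) s) {K : ℝ} (hK : ∀ s ∈ I, |f' s| ≤ K) {s t : ℝ}
    (hs : s ∈ I) (ht : t ∈ I) : |f s - f t| ≤ K * |s - t| :=
  hI.norm_image_sub_le_of_norm_hasDerivWithin_le
      (fun v hv => (hf v hv).hasDerivWithinAt) (fun v hv => hK v hv) ht hs

/-- The derivative of `√g'`. -/
def dSqrt (g : ℝ → ℝ) (s : ℝ) : ℝ := iteratedDeriv 2 g s / (2 * √(deriv g s))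

/-- The derivative of `1 / √g'`. -/
def dInvSqrt (g : ℝ → ℝ) (s : ℝ) : ℝ := -dSqrt g s / √(deriv g s) ^ 2

/-- Regularity of the mean function at a point: smoothness, and bounds on the first three
derivatives. -/
def RegularAt (g : ℝ → ℝ) (c C M : ℝ) (s : ℝ) : Prop :=
  ContDiffAt ℝ 3 g s ∧ c ≤ deriv g s ∧ deriv g s ≤ C ∧
    |iteratedDeriv 2 g s| ≤ M ∧ |iteratedDeriv 3 g s| ≤ M

section

variable {g : ℝ → ℝ} {c C M s : ℝ}

theorem RegularAt.hasDerivAt (h : RegularAt g c C M s) : HasDerivAt g (deriv g s) s :=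
  (h.1.differentiableAt (by norm_num)).hasDerivAt

theorem RegularAt.hasDerivAt_iteratedDeriv (h : RegularAt g c C M s) {k : ℕ} (hk : k < 3) :
    HasDerivAt (iteratedDeriv k g) (iteratedDeriv (k + 1) g s) s := by
  rw [iteratedDeriv_succ]
  have : DifferentiableAt ℝ (iteratedDeriv k g) s := by
    have h1 := h.1.differentiableAt_iteratedFDeriv (m := k) (by exact_mod_cast hk)
    exact h1.continuousMultilinear_apply_const _
  exact this.hasDerivAt

theorem RegularAt.hasDerivAt_deriv (h : RegularAt g c C M s) :
    HasDerivAt (deriv g) (iteratedDeriv 2 g s) s := by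
  have := h.hasDerivAt_iteratedDeriv (k := 1) (by norm_num)
  rwa [iteratedDeriv_one] at this

theorem RegularAt.hasDerivAt_sqrt (hc : 0 < c) (h : RegularAt g c C M s) :
    HasDerivAt (fun s => √(deriv g s)) (dSqrt g s) s :=
  h.hasDerivAt_deriv.sqrt (hc.trans_le h.2.1).ne'

theorem RegularAt.sqrt_pos (hc : 0 < c) (h : RegularAt g c C M s) : 0 < √(deriv g s) :=
  Real.sqrt_pos.mpr (hc.trans_le h.2.1)

theorem RegularAt.hasDerivAt_invSqrt (hc : 0 < c) (h : RegularAt g c C M s) :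
    HasDerivAt (fun s => (√(deriv g s))⁻¹) (dInvSqrt g s) s :=
  (h.hasDerivAt_sqrt hc).fun_inv (h.sqrt_pos hc).ne'

theorem RegularAt.hasDerivAt_dSqrt (hc : 0 < c) (h : RegularAt g c C M s) :
    HasDerivAt (dSqrt g) ((iteratedDeriv 3 g s * (2 * √(deriv g s)) -
      iteratedDeriv 2 g s * (2 * dSqrt g s)) / (2 * √(deriv g s)) ^ 2) s :=
  (h.hasDerivAt_iteratedDeriv (k := 2) (by norm_num)).fun_div
    ((h.hasDerivAt_sqrt hc).const_mul 2) (by have := h.sqrt_pos hc; positivity)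

/-- A positive lower bound on `g'` makes `√g'` and `1/√g'` smooth with controlled derivatives. The
constant depends only on `c`, `C`, `M`, so it serves all individuals and all `n` at once. -/
theorem exists_derivBounds (hc : 0 < c) :
    ∃ k : ℝ, 1 ≤ k ∧ ∀ (g : ℝ → ℝ) (s : ℝ), RegularAt g c C M s →
      |deriv g s| ≤ k ∧ |√(deriv g s)| ≤ k ∧ |(√(deriv g s))⁻¹| ≤ k ∧ |dSqrt g s| ≤ k ∧
      |dInvSqrt g s| ≤ k ∧ |iteratedDeriv 2 g s| ≤ k ∧
      (∃ y, HasDerivAt (dSqrt g) y s ∧ |y| ≤ k) ∧ ∃ y, HasDerivAt (dInvSqrt g) y s ∧ |y| ≤ k := by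
  set β := (√c)⁻¹ with hβ
  have hβ0 : 0 < β := by positivity
  have hM0 : 0 ≤ |M| := abs_nonneg M
  set k1 := |M| * β with hk1
  set k2 := k1 * β ^ 2
  set k3 := (|M| * (2 * √C) + |M| * (2 * k1)) * β ^ 2 with hk3
  set k4 := (k3 * (√C) ^ 2 + k1 * (2 * (√C) * k1)) * (β ^ 2) ^ 2
  have : 0 ≤ k1 := by positivity
  have : 0 ≤ k2 := by positivity
  have : 0 ≤ k3 := by positivity
  have : 0 ≤ k4 := by positivity
  have : 0 ≤ √C := by positivity
  refine ⟨1 + |C| + √C + β + k1 + k2 + |M| + k3 + k4, by linarith [abs_nonneg C], ?_⟩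
  intro g s h
  have ha := h.sqrt_pos hc
  have hb1 : (√(deriv g s))⁻¹ ≤ β := inv_anti₀ (by positivity) (Real.sqrt_le_sqrt h.2.1)
  have hb0 : 0 < (√(deriv g s))⁻¹ := by positivity
  have haC : √(deriv g s) ≤ √C := Real.sqrt_le_sqrt h.2.2.1
  have h2 : |iteratedDeriv 2 g s| ≤ |M| := h.2.2.2.1.trans (le_abs_self _)
  have h3 : |iteratedDeriv 3 g s| ≤ |M| := h.2.2.2.2.trans (le_abs_self _)
  have hA1 : |dSqrt g s| ≤ k1 := by
    rw [dSqrt, div_eq_mul_inv, abs_mul, mul_inv, abs_mul, abs_of_pos hb0]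
    refine mul_le_mul h2 ?_ (by positivity) hM0
    rw [abs_of_pos (by norm_num)]; linarith
  have hB1 : |dInvSqrt g s| ≤ k2 := by
    rw [dInvSqrt, div_eq_mul_inv, abs_mul, abs_neg, ← inv_pow, abs_pow, abs_of_pos hb0]
    exact mul_le_mul hA1 (pow_le_pow_left₀ hb0.le hb1 2) (by positivity) (by positivity)
  have hA2 : |(iteratedDeriv 3 g s * (2 * √(deriv g s)) -
      iteratedDeriv 2 g s * (2 * dSqrt g s)) / (2 * √(deriv g s)) ^ 2| ≤ k3 := by
    rw [div_eq_mul_inv, abs_mul, ← inv_pow, abs_pow]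
    have e1 : |(2 * √(deriv g s))⁻¹| ≤ β := by
      rw [mul_inv, abs_mul, abs_of_pos hb0, abs_of_pos (by norm_num)]; linarith
    have e2 : |iteratedDeriv 3 g s * (2 * √(deriv g s)) - iteratedDeriv 2 g s * (2 * dSqrt g s)| ≤
        |M| * (2 * √C) + |M| * (2 * k1) := by
      refine (abs_sub _ _).trans ?_
      simp only [abs_mul, abs_of_pos ha, abs_two]
      gcongr
    exact mul_le_mul e2 (pow_le_pow_left₀ (abs_nonneg _) e1 2) (by positivity) (by positivity)
  have hdB := (h.hasDerivAt_dSqrt hc).fun_neg.fun_div ((h.hasDerivAt_sqrt hc).fun_pow 2)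
    (by positivity)
  have habsC : |deriv g s| ≤ |C| := by
    rw [abs_of_pos (hc.trans_le h.2.1)]; exact h.2.2.1.trans (le_abs_self _)
  have := abs_nonneg C
  refine ⟨by linarith, by rw [abs_of_pos ha]; linarith, by rw [abs_of_pos hb0]; linarith,
    by linarith, by linarith, by linarith, ⟨_, h.hasDerivAt_dSqrt hc, by linarith⟩, ⟨_, hdB, ?_⟩⟩
  refine le_trans ?_ (by linarith : k4 ≤ _)
  rw [div_eq_mul_inv, abs_mul, ← inv_pow, ← inv_pow, abs_pow, abs_pow, abs_of_pos hb0]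
  have e2 : ∀ z : ℝ, |z| ≤ k3 → |-z * √(deriv g s) ^ 2 - -dSqrt g s * ((2 : ℕ) *
      √(deriv g s) ^ (2 - 1) * dSqrt g s)| ≤ k3 * (√C) ^ 2 + k1 * (2 * (√C) * k1) := by
    intro z hz
    refine (abs_sub _ _).trans ?_
    simp only [abs_mul, abs_neg, abs_pow, abs_of_pos ha, Nat.cast_ofNat, abs_two, pow_one,
      Nat.add_one_sub_one]
    gcongr
  exact mul_le_mul (e2 _ hA2) (by gcongr) (by positivity) (by positivity)

end

theorem abs_mul_le {x y X Y : ℝ} (hx : |x| ≤ X) (hy : |y| ≤ Y) : |x * y| ≤ X * Y := by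
  rw [abs_mul]; exact mul_le_mul hx hy (abs_nonneg _) ((abs_nonneg _).trans hx)

/-- Linearization of `(β₁, β₂) ↦ a(s₁) b(t₁) (y - g(t₁)) - a(s₂) b(t₂) (y - g(t₂))`, in terms of the
remainders of the factors. -/
theorem abs_product_linearization_le {k ω e x y A B a0 b0 g1 γ σ1 σ2 σ3 ρ1 ρ2 ρ3 : ℝ}
    (hk : 1 ≤ k) (hω : 0 ≤ ω) (hω1 : ω ≤ 1) (hA : |A| ≤ k) (hB : |B| ≤ k) (ha : |a0| ≤ k)
    (hb : |b0| ≤ k) (hg1 : |g1| ≤ k) (hγ : |γ| ≤ k * ω) (hσ1 : |σ1| ≤ k * ω)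
    (hσ2 : |σ2| ≤ k * ω) (hσ3 : |σ3| ≤ k * ω) (hρ1 : |ρ1| ≤ k * ω * |x|) (hρ2 : |ρ2| ≤ k * ω * |y|)
    (hρ3 : |ρ3| ≤ k * ω * |y|) :
    |((A * x + ρ1) * (b0 + σ1) + (a0 + σ2) * (B * y + ρ2)) * (e - γ)
      - (a0 + σ2) * (b0 + σ3) * (g1 * y + ρ3)
      - ((A * b0 * x + a0 * B * y) * e - a0 * b0 * g1 * y)| ≤
      20 * k ^ 3 * ω * (1 + |e|) * (|x| + |y|) := by
  have hk0 : 0 ≤ k := by linarith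
  have hx := abs_nonneg x
  have hy := abs_nonneg y
  have he := abs_nonneg e
  have hωx : k * ω * |x| ≤ k * |x| := by
    have := mul_le_mul_of_nonneg_left hω1 hk0; rw [mul_one] at this; gcongr
  have hωy : k * ω * |y| ≤ k * |y| := by
    have := mul_le_mul_of_nonneg_left hω1 hk0; rw [mul_one] at this; gcongr
  have hkω : k * ω ≤ k := mul_le_of_le_one_right hk0 hω1
  have hAx : |A * x| ≤ k * |x| := abs_mul_le hA le_rfl
  have hBy : |B * y| ≤ k * |y| := abs_mul_le hB le_rfl
  have hbs : |b0 + σ1| ≤ 2 * k := (abs_add_le _ _).trans (by linarith)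
  have has : |a0 + σ2| ≤ 2 * k := (abs_add_le _ _).trans (by linarith)
  have hbs3 : |b0 + σ3| ≤ 2 * k := (abs_add_le _ _).trans (by linarith)
  have hBy2 : |B * y + ρ2| ≤ 2 * (k * |y|) := (abs_add_le _ _).trans (by linarith)
  have hAx2 : |A * x + ρ1| ≤ 2 * (k * |x|) := (abs_add_le _ _).trans (by linarith)
  -- Here `x`, `y` are the increments of the two predictors, the `σ` are deviations of the factors
  -- from their values at the base point, the `ρ` are first order remainders, and `γ` is the change
  -- of `g`. `R` is what remains of `Q` after its principal part `A b0 x + a0 B y`, and `T` does the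
  -- same for the term carrying the increment of `g`. Each of `R`, `Qγ`, `T` contains a factor `ω`.
  set R := A * x * σ1 + ρ1 * (b0 + σ1) + σ2 * (B * y + ρ2) + a0 * ρ2 with hR
  set Q := (A * x + ρ1) * (b0 + σ1) + (a0 + σ2) * (B * y + ρ2) with hQ
  set T := (a0 * σ3 + σ2 * (b0 + σ3)) * (g1 * y) + (a0 + σ2) * (b0 + σ3) * ρ3 with hT
  have hRb : |R| ≤ 3 * k ^ 2 * ω * (|x| + |y|) := by
    have r1 := abs_mul_le hAx hσ1
    have r2 := abs_mul_le hρ1 hbs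
    have r3 := abs_mul_le hσ2 hBy2
    have r4 := abs_mul_le ha hρ2
    calc |R| ≤ |A * x * σ1| + |ρ1 * (b0 + σ1)| + |σ2 * (B * y + ρ2)| + |a0 * ρ2| :=
          (abs_add_le _ _).trans (by gcongr; exact (abs_add_le _ _).trans (by gcongr; exact abs_add_le _ _))
      _ ≤ _ := by linarith
  have hQb : |Q| ≤ 4 * k ^ 2 * (|x| + |y|) := by
    have r1 := abs_mul_le hAx2 hbs
    have r2 := abs_mul_le has hBy2
    exact (abs_add_le _ _).trans (by linarith)
  have hTb : |T| ≤ 7 * k ^ 3 * ω * |y| := by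
    have r0 : |a0 * σ3 + σ2 * (b0 + σ3)| ≤ 3 * k ^ 2 * ω := by
      have r1 := abs_mul_le ha hσ3
      have r2 := abs_mul_le hσ2 hbs3
      exact (abs_add_le _ _).trans (by linarith)
    have r3 := abs_mul_le r0 (abs_mul_le hg1 (le_refl |y|))
    have r4 := abs_mul_le (abs_mul_le has hbs3) hρ3
    exact (abs_add_le _ _).trans (by linarith)
  have hQγ := abs_mul_le hQb hγ
  have hRe := abs_mul_le hRb (le_refl |e|)
  have hkey : Q * (e - γ) - (a0 + σ2) * (b0 + σ3) * (g1 * y + ρ3)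
      - ((A * b0 * x + a0 * B * y) * e - a0 * b0 * g1 * y) = R * e - Q * γ - T := by
    rw [hR, hQ, hT]; ring
  rw [hkey]
  have hk23 : k ^ 2 ≤ k ^ 3 := pow_le_pow_right₀ hk (by norm_num)
  have n1 : 3 * k ^ 2 * ω * (|x| + |y|) * |e| ≤ 3 * k ^ 3 * ω * (|x| + |y|) * |e| := by gcongr
  have n2 : 0 ≤ k ^ 3 * ω * |x| := by positivity
  have n3 : 0 ≤ k ^ 3 * ω * (|x| + |y|) * |e| := by positivity
  have n4 : 0 ≤ k ^ 3 * ω * |y| := by positivity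
  calc |R * e - Q * γ - T| ≤ |R * e| + |Q * γ| + |T| :=
        (abs_sub _ _).trans (by gcongr; exact abs_sub _ _)
    _ ≤ _ := by linarith

/-- Uniform linearization of the entries of the estimating function. -/
theorem exists_linearization {c : ℝ} (C M : ℝ) (hc : 0 < c) :
    ∃ K : ℝ, 1 ≤ K ∧ ∀ (g : ℝ → ℝ) (I : Set ℝ), Convex ℝ I → (∀ s ∈ I, RegularAt g c C M s) →
      ∀ ω : ℝ, 0 ≤ ω → ω ≤ 1 → ∀ s₀ ∈ I, ∀ J : Set ℝ, Convex ℝ J →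
      (∀ s ∈ J, RegularAt g c C M s) → ∀ t₀ ∈ J, ∀ s₁ ∈ I, ∀ s₂ ∈ I, ∀ t₁ ∈ J, ∀ t₂ ∈ J,
      |s₁ - s₀| ≤ ω → |s₂ - s₀| ≤ ω → |t₁ - t₀| ≤ ω → |t₂ - t₀| ≤ ω → ∀ y : ℝ,
      |√(deriv g s₁) * (√(deriv g t₁))⁻¹ * (y - g t₁) - √(deriv g s₂) * (√(deriv g t₂))⁻¹ * (y - g t₂)
        - ((dSqrt g s₀ * (√(deriv g t₀))⁻¹ * (s₁ - s₂) + √(deriv g s₀) * dInvSqrt g t₀ * (t₁ - t₂))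
            * (y - g t₀) - √(deriv g s₀) * √(deriv g t₀) * (t₁ - t₂))| ≤
        K * ω * (1 + |y - g t₀|) * (|s₁ - s₂| + |t₁ - t₂|) := by
  obtain ⟨k, hk, hb⟩ := exists_derivBounds (C := C) (M := M) hc
  refine ⟨20 * k ^ 3, by nlinarith [one_le_pow₀ hk (n := 3)], ?_⟩
  intro g I hI hgI ω hω hω1 s₀ hs₀ J hJ hgJ t₀ ht₀ s₁ hs₁ s₂ hs₂ t₁ ht₁ t₂ ht₂ d1 d2 d3 d4 y
  have hk0 : 0 ≤ k := by linarith
  have lipA : ∀ {u v}, u ∈ I → v ∈ I → |√(deriv g u) - √(deriv g v)| ≤ k * |u - v| :=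
    abs_image_sub_le hI (fun s hs => (hgI s hs).hasDerivAt_sqrt hc)
      (fun s hs => (hb g s (hgI s hs)).2.2.2.1)
  have lipB : ∀ {u v}, u ∈ J → v ∈ J → |(√(deriv g u))⁻¹ - (√(deriv g v))⁻¹| ≤ k * |u - v| :=
    abs_image_sub_le hJ (fun s hs => (hgJ s hs).hasDerivAt_invSqrt hc)
      (fun s hs => (hb g s (hgJ s hs)).2.2.2.2.1)
  have lipG : ∀ {u v}, u ∈ J → v ∈ J → |g u - g v| ≤ k * |u - v| :=
    abs_image_sub_le hJ (fun s hs => (hgJ s hs).hasDerivAt) (fun s hs => (hb g s (hgJ s hs)).1)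
  choose! dA hdA using fun s (hs : s ∈ I) => (hb g s (hgI s hs)).2.2.2.2.2.2.1
  choose! dB hdB using fun s (hs : s ∈ J) => (hb g s (hgJ s hs)).2.2.2.2.2.2.2
  have tA := abs_sub_sub_deriv_mul_le hI (fun s hs => (hgI s hs).hasDerivAt_sqrt hc)
    (fun s hs => (hdA s hs).1) (fun s hs => (hdA s hs).2) hs₁ hs₂ hs₀ d1 d2
  have tB := abs_sub_sub_deriv_mul_le hJ (fun s hs => (hgJ s hs).hasDerivAt_invSqrt hc)
    (fun s hs => (hdB s hs).1) (fun s hs => (hdB s hs).2) ht₁ ht₂ ht₀ d3 d4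
  have tG := abs_sub_sub_deriv_mul_le hJ (fun s hs => (hgJ s hs).hasDerivAt)
    (fun s hs => (hgJ s hs).hasDerivAt_deriv) (fun s hs => (hb g s (hgJ s hs)).2.2.2.2.2.1)
    ht₁ ht₂ ht₀ d3 d4
  obtain ⟨-, ha0, -, hA0, -, -⟩ := hb g s₀ (hgI s₀ hs₀)
  obtain ⟨hg0, -, hb0, -, hB0, -⟩ := hb g t₀ (hgJ t₀ ht₀)
  have main := abs_product_linearization_le (e := y - g t₀) (x := s₁ - s₂) (y := t₁ - t₂)
    hk hω hω1 hA0 hB0 ha0 hb0 hg0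
    ((lipG ht₁ ht₀).trans (by gcongr)) ((lipB ht₁ ht₀).trans (by gcongr))
    ((lipA hs₂ hs₀).trans (by gcongr)) ((lipB ht₂ ht₀).trans (by gcongr)) tA tB tG
  refine le_trans (le_of_eq ?_) main
  have hpos := (hgJ t₀ ht₀).sqrt_pos hc
  have hgs : deriv g t₀ = √(deriv g t₀) * √(deriv g t₀) :=
    (Real.mul_self_sqrt (hc.trans_le (hgJ t₀ ht₀).2.1).le).symm
  -- With the canonical variance, `(g')^{-1/2} g' = (g')^{1/2}`. This makes the principal part a
  -- quadratic form in `A^{1/2} X v`.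
  have hcancel : (√(deriv g t₀))⁻¹ * deriv g t₀ = √(deriv g t₀) := by
    nth_rewrite 2 [hgs]
    rw [← mul_assoc, inv_mul_cancel₀ hpos.ne', one_mul]
  congr 1
  have hrepl : √(deriv g s₀) * √(deriv g t₀) * (t₁ - t₂) =
      √(deriv g s₀) * (√(deriv g t₀))⁻¹ * deriv g t₀ * (t₁ - t₂) := by
    rw [mul_assoc (√(deriv g s₀)) (√(deriv g t₀))⁻¹, hcancel]
  rw [hrepl]
  ring

/-! ### Monotonicity of the estimating function from bounds on weighted sums. -/

section

variable {m p n : ℕ}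

/-- The weight `1 / (n π_i)` of a sampled individual, and `0` otherwise. -/
def weight (π : Fin n → ℝ) (δ : Fin n → Bool) (i : Fin n) : ℝ :=
  1 / (n : ℝ) * (if δ i then 1 / π i else 0)

theorem weight_nonneg {π : Fin n → ℝ} (hπ : ∀ i, 0 < π i) (δ : Fin n → Bool) (i : Fin n) :
    0 ≤ weight π δ i := by
  have := (hπ i).le
  unfold weight; split_ifs <;> positivity

/-- One entry of the estimating function: `√g'(s) / √g'(t) * (y - g(t))`. -/
def scoreEntry (g : ℝ → ℝ) (y s t : ℝ) : ℝ :=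
  √(deriv g s) * (√(deriv g t))⁻¹ * (y - g t)

/-- Pairing with `u` leaves `m²` scalar sums over individuals, with the entries of `R⁻¹` outside.
The estimated matrix may depend on the data, and this keeps it away from every moment computation.
-/
theorem dotProduct_score (g : ℝ → ℝ) (X : Fin n → Matrix (Fin m) (Fin p) ℝ)
    (Y : Fin n → Fin m → ℝ) (π : Fin n → ℝ) (δ : Fin n → Bool) (R : Matrix (Fin m) (Fin m) ℝ)
    (β u : EuclideanSpace ℝ (Fin p)) :
    u.ofLp ⬝ᵥ score g X Y π δ R β = ∑ j, ∑ k, R⁻¹ j k * ∑ i, weight π δ i *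
      (eta (X i) u j * scoreEntry g (Y i k) (eta (X i) β j) (eta (X i) β k)) := by
  have h1 : ∀ i, u.ofLp ⬝ᵥ ((X i)ᵀ *ᵥ (sqrtA g (X i) β *ᵥ (R⁻¹ *ᵥ resid g (X i) (Y i) β))) =
      ∑ j, ∑ k, R⁻¹ j k * (eta (X i) u j *
        scoreEntry g (Y i k) (eta (X i) β j) (eta (X i) β k)) := by
    intro i
    rw [dotProduct_mulVec, vecMul_transpose]
    have hA : ∀ v j, (sqrtA g (X i) β *ᵥ v) j = √(deriv g (eta (X i) β j)) * v j := fun v j =>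
      mulVec_diagonal _ _ _
    have hres : ∀ k, resid g (X i) (Y i) β k =
        (√(deriv g (eta (X i) β k)))⁻¹ * (Y i k - g (eta (X i) β k)) := fun k =>
      mulVec_diagonal _ _ _
    have hR : ∀ j, (R⁻¹ *ᵥ resid g (X i) (Y i) β) j = ∑ k, R⁻¹ j k * resid g (X i) (Y i) β k :=
      fun j => rfl
    change ∑ j, eta (X i) u j * _ = _
    simp only [hA, hR, hres, Finset.mul_sum, scoreEntry]
    exact Finset.sum_congr rfl fun j _ => Finset.sum_congr rfl fun k _ => by ring
  rw [score, dotProduct_smul, dotProduct_sum]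
  simp only [dotProduct_smul, h1, smul_eq_mul]
  rw [Finset.mul_sum]
  simp only [Finset.mul_sum, weight]
  rw [Finset.sum_comm]
  refine Finset.sum_congr rfl fun j _ => ?_
  rw [Finset.sum_comm]
  exact Finset.sum_congr rfl fun k _ => Finset.sum_congr rfl fun i _ => by ring

theorem eta_sub (X : Matrix (Fin m) (Fin p) ℝ) (β γ : EuclideanSpace ℝ (Fin p)) (j : Fin m) :
    eta X (β - γ) j = eta X β j - eta X γ j := by
  simp [eta, mulVec_sub]

theorem abs_eta_le (X : Matrix (Fin m) (Fin p) ℝ) (β : EuclideanSpace ℝ (Fin p)) (j : Fin m) :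
    |eta X β j| ≤ ‖(WithLp.toLp 2 (X j) : EuclideanSpace ℝ (Fin p))‖ * ‖β‖ := by
  have h := abs_real_inner_le_norm (WithLp.toLp 2 (X j) : EuclideanSpace ℝ (Fin p)) β
  have h2 : inner ℝ (WithLp.toLp 2 (X j) : EuclideanSpace ℝ (Fin p)) β = eta X β j := by
    simp [eta, mulVec, PiLp.inner_apply, dotProduct, mul_comm]
  rwa [h2] at h

/-- Cauchy–Schwarz in the `p²` coordinates: a bilinear form is bounded by the Frobenius norm of its
matrix. The Frobenius norm is convenient because its second moment is a sum over entries. -/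
theorem abs_bilin_le {T : Fin p × Fin p → ℝ} {η : ℝ} (hη : 0 ≤ η) (hT : ∑ a, T a ^ 2 ≤ η ^ 2)
    (u d : EuclideanSpace ℝ (Fin p)) :
    |∑ a : Fin p × Fin p, T a * (u a.1 * d a.2)| ≤ η * (‖u‖ * ‖d‖) := by
  refine abs_le_of_sq_le_sq ?_ (by positivity)
  have h1 := Finset.sum_mul_sq_le_sq_mul_sq Finset.univ T (fun a => u a.1 * d a.2)
  have h2 : ∑ a : Fin p × Fin p, (u a.1 * d a.2) ^ 2 = (‖u‖ * ‖d‖) ^ 2 := by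
    rw [mul_pow, EuclideanSpace.real_norm_sq_eq, EuclideanSpace.real_norm_sq_eq,
      Finset.sum_mul_sum, Fintype.sum_prod_type]
    simp only [mul_pow]
  rw [h2] at h1
  rw [mul_pow η]
  exact h1.trans (by gcongr)

theorem sum_mul_eta_mul_eta (X : Fin n → Matrix (Fin m) (Fin p) ℝ) (w : Fin n → ℝ) (j k : Fin m)
    (u d : EuclideanSpace ℝ (Fin p)) :
    ∑ i, w i * (eta (X i) u j * eta (X i) d k) =
      ∑ a : Fin p × Fin p, (∑ i, w i * (X i j a.1 * X i k a.2)) * (u a.1 * d a.2) := by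
  simp only [eta, mulVec, dotProduct, Finset.sum_mul_sum]
  simp only [Finset.mul_sum, Finset.sum_mul, Fintype.sum_prod_type]
  rw [Finset.sum_comm]
  refine Finset.sum_congr rfl fun a _ => ?_
  rw [Finset.sum_comm]
  exact Finset.sum_congr rfl fun b _ => Finset.sum_congr rfl fun i _ => by ring

theorem abs_sum_mul_eta_mul_eta_le {X : Fin n → Matrix (Fin m) (Fin p) ℝ} {w : Fin n → ℝ}
    {j k : Fin m} {η : ℝ} (hη : 0 ≤ η)
    (h : ∑ a : Fin p × Fin p, (∑ i, w i * (X i j a.1 * X i k a.2)) ^ 2 ≤ η ^ 2)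
    (u d : EuclideanSpace ℝ (Fin p)) :
    |∑ i, w i * (eta (X i) u j * eta (X i) d k)| ≤ η * (‖u‖ * ‖d‖) := by
  rw [sum_mul_eta_mul_eta]
  exact abs_bilin_le hη h u d

/-- Cauchy–Schwarz with nonnegative weights. -/
theorem sum_mul_abs_mul_abs_le {w x y : Fin n → ℝ} (hw : ∀ i, 0 ≤ w i) {C a b : ℝ} (hC : 0 ≤ C)
    (ha : 0 ≤ a) (hb : 0 ≤ b) (hx : ∑ i, w i * x i ^ 2 ≤ C * a ^ 2)
    (hy : ∑ i, w i * y i ^ 2 ≤ C * b ^ 2) :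
    ∑ i, w i * (|x i| * |y i|) ≤ C * (a * b) := by
  apply le_of_sq_le_sq _ (by positivity)
  have := Finset.sum_sq_le_sum_mul_sum_of_sq_le_mul Finset.univ
    (r := fun i => w i * (|x i| * |y i|)) (f := fun i => w i * x i ^ 2) (g := fun i => w i * y i ^ 2)
    (fun i _ => mul_nonneg (hw i) (sq_nonneg _)) (fun i _ => mul_nonneg (hw i) (sq_nonneg _))
    (fun i _ => by simp only [mul_pow, sq_abs]; exact le_of_eq (by ring))
  refine this.trans ?_
  calc _ ≤ (C * a ^ 2) * (C * b ^ 2) :=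
        mul_le_mul hx hy (Finset.sum_nonneg fun i _ => mul_nonneg (hw i) (sq_nonneg _))
          (by positivity)
    _ = _ := by ring

theorem abs_sum_sum_mul_le {T G : Fin m → Fin m → ℝ} {C E : ℝ} (hT : ∀ j k, |T j k| ≤ C)
    (hG : ∀ j k, |G j k| ≤ E) : |∑ j, ∑ k, T j k * G j k| ≤ (m : ℝ) ^ 2 * (C * E) := by
  calc |∑ j, ∑ k, T j k * G j k| ≤ ∑ j : Fin m, ∑ k : Fin m, C * E := by
        refine (Finset.abs_sum_le_sum_abs _ _).trans (Finset.sum_le_sum fun j _ => ?_)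
        refine (Finset.abs_sum_le_sum_abs _ _).trans (Finset.sum_le_sum fun k _ => ?_)
        exact abs_mul_le (hT j k) (hG j k)
    _ = _ := by simp; ring

/-- `L₁` and `L₂` stand for the noise terms, linear in the residuals, `M₀` for the principal part,
and `Q` for the Taylor remainder. Only `M₀` is kept; everything else goes into the error. -/
theorem abs_sum_linearization_le {W : Fin n → ℝ} (hW : ∀ i, 0 ≤ W i) {T : Fin m → Fin m → ℝ}
    {C₂ E E' : ℝ} (hT : ∀ j k, |T j k| ≤ C₂) {H L₁ L₂ M₀ Q : Fin n → Fin m → Fin m → ℝ}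
    {u : Fin n → Fin m → ℝ} (hrem : ∀ i j k, |H i j k - (L₁ i j k + L₂ i j k - M₀ i j k)| ≤ Q i j k)
    (h1 : ∀ j k, |∑ i, W i * (u i j * L₁ i j k)| ≤ E)
    (h2 : ∀ j k, |∑ i, W i * (u i j * L₂ i j k)| ≤ E)
    (h3 : ∀ j k, ∑ i, W i * (|u i j| * Q i j k) ≤ E') :
    |∑ j, ∑ k, T j k * ∑ i, W i * (u i j * H i j k) +
      ∑ j, ∑ k, T j k * ∑ i, W i * (u i j * M₀ i j k)| ≤ (m : ℝ) ^ 2 * (C₂ * (2 * E + E')) := by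
  simp only [← Finset.sum_add_distrib, ← mul_add]
  apply abs_sum_sum_mul_le hT
  intro j k
  have e : ∑ i, W i * (u i j * (H i j k + M₀ i j k)) =
      ∑ i, W i * (u i j * L₁ i j k) + ∑ i, W i * (u i j * L₂ i j k) +
        ∑ i, W i * (u i j * (H i j k - (L₁ i j k + L₂ i j k - M₀ i j k))) := by
    simp only [← Finset.sum_add_distrib]
    exact Finset.sum_congr rfl fun i _ => by ring
  have h4 : |∑ i, W i * (u i j * (H i j k - (L₁ i j k + L₂ i j k - M₀ i j k)))| ≤ E' := by
    refine (Finset.abs_sum_le_sum_abs _ _).trans (le_trans (Finset.sum_le_sum fun i _ => ?_) (h3 j k))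
    rw [abs_mul, abs_mul, abs_of_nonneg (hW i)]
    exact mul_le_mul_of_nonneg_left (mul_le_mul_of_nonneg_left (hrem i j k) (abs_nonneg _)) (hW i)
  rw [e]
  exact (abs_add_three _ _ _).trans (by linarith [h1 j k, h2 j k])

/-- Strong monotonicity and Lipschitz continuity of the estimating function on a ball, from
bounds on finitely many weighted sums over the subsample. -/
theorem exists_monotonicity_constants (m : ℕ) {c κ₁ κ₂ : ℝ} (C M C₁ C₂ C₃ : ℝ) (hc : 0 < c)
    (hκ₁ : 0 < κ₁) (hκ₂ : 0 < κ₂) (hC₁ : 0 ≤ C₁) (hC₂ : 0 ≤ C₂) (hC₃ : 0 ≤ C₃) :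
    ∃ η κ L : ℝ, 0 < η ∧ 0 < κ ∧ κ ≤ L ∧ ∀ (n p : ℕ) (g : ℝ → ℝ)
      (X : Fin n → Matrix (Fin m) (Fin p) ℝ) (Y : Fin n → Fin m → ℝ) (π : Fin n → ℝ)
      (δ : Fin n → Bool) (R : Matrix (Fin m) (Fin m) ℝ) (β₀ : EuclideanSpace ℝ (Fin p)) (ρ ω : ℝ),
      0 ≤ ω → ω ≤ η → 0 ≤ ρ → (∀ i, 0 < π i) →
      (∀ i j, ∀ β ∈ Metric.closedBall β₀ ρ, RegularAt g c C M (eta (X i) β j)) →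
      (∀ i j, ∀ β ∈ Metric.closedBall β₀ ρ, |eta (X i) β j - eta (X i) β₀ j| ≤ ω) →
      (∀ j k, |R⁻¹ j k| ≤ C₂) → (∀ z : Fin m → ℝ, κ₂ * ∑ j, z j ^ 2 ≤ z ⬝ᵥ R⁻¹ *ᵥ z) →
      (∀ v : EuclideanSpace ℝ (Fin p), κ₁ * ‖v‖ ^ 2 ≤ ∑ i, weight π δ i * ∑ j, eta (X i) v j ^ 2 ∧
        ∑ i, weight π δ i * ∑ j, eta (X i) v j ^ 2 ≤ C₁ * ‖v‖ ^ 2) →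
      (∀ (v : EuclideanSpace ℝ (Fin p)) (l k : Fin m), ∑ i, weight π δ i *
        (1 + |Y i k - g (eta (X i) β₀ k)|) * eta (X i) v l ^ 2 ≤ C₃ * ‖v‖ ^ 2) →
      (∀ (u d : EuclideanSpace ℝ (Fin p)) (j k : Fin m), |∑ i, weight π δ i *
        (eta (X i) u j * (dSqrt g (eta (X i) β₀ j) * (√(deriv g (eta (X i) β₀ k)))⁻¹ *
          eta (X i) d j * (Y i k - g (eta (X i) β₀ k))))| ≤ η * (‖u‖ * ‖d‖)) →
      (∀ (u d : EuclideanSpace ℝ (Fin p)) (j k : Fin m), |∑ i, weight π δ i *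
        (eta (X i) u j * (√(deriv g (eta (X i) β₀ j)) * dInvSqrt g (eta (X i) β₀ k) *
          eta (X i) d k * (Y i k - g (eta (X i) β₀ k))))| ≤ η * (‖u‖ * ‖d‖)) →
      ∀ β₁ ∈ Metric.closedBall β₀ ρ, ∀ β₂ ∈ Metric.closedBall β₀ ρ,
        (β₁ - β₂).ofLp ⬝ᵥ (score g X Y π δ R β₁ - score g X Y π δ R β₂) ≤ -κ * ‖β₁ - β₂‖ ^ 2 ∧
        ∀ u : EuclideanSpace ℝ (Fin p),
          |u.ofLp ⬝ᵥ (score g X Y π δ R β₁ - score g X Y π δ R β₂)| ≤ L * (‖u‖ * ‖β₁ - β₂‖) := by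
  obtain ⟨K, hK1, hK⟩ := exists_linearization C M hc
  have hK0 : 0 ≤ K := by linarith
  -- The principal part is coercive with constant `κ₂ c κ₁ = 2κ`; half of it is spent on noise and
  -- remainder.
  set κ := κ₂ * c * κ₁ / 2 with hκ
  have hκ0 : 0 < κ := by positivity
  set B := (m : ℝ) ^ 2 * (C₂ * (2 + 2 * K * C₃)) with hB
  have hB0 : 0 ≤ B := by positivity
  -- The total error is at most `Bη‖u‖‖d‖`: in `B`, the `2` counts the two noise terms and `2KC₃`
  -- the remainder. The cap at `1` is the range in which the linearization holds.
  set η := min 1 (κ / (B + 1)) with hη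
  have hη0 : 0 < η := by positivity
  have hηB : B * η ≤ κ := by
    have : η ≤ κ / (B + 1) := min_le_right _ _
    rw [le_div_iff₀ (by positivity)] at this
    nlinarith
  refine ⟨η, κ, κ + (m : ℝ) ^ 2 * (C₂ * (|C| * C₁)), hη0, hκ0,
    le_add_of_nonneg_right (by positivity), ?_⟩
  intro n p g X Y π δ R β₀ ρ ω hω0 hω hρ hπ hreg hdist hR hRq hgram hG3 hN1 hN2 β₁ hβ₁ β₂ hβ₂
  have hW := weight_nonneg hπ δ
  set W := weight π δ with hWdef
  have hβ₀ : β₀ ∈ Metric.closedBall β₀ ρ := Metric.mem_closedBall_self hρ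
  have hω1 : ω ≤ 1 := hω.trans (min_le_left _ _)
  set d := β₁ - β₂ with hd
  have hrem : ∀ i j k, |(scoreEntry g (Y i k) (eta (X i) β₁ j) (eta (X i) β₁ k) -
      scoreEntry g (Y i k) (eta (X i) β₂ j) (eta (X i) β₂ k)) -
      (dSqrt g (eta (X i) β₀ j) * (√(deriv g (eta (X i) β₀ k)))⁻¹ *
          eta (X i) d j * (Y i k - g (eta (X i) β₀ k)) +
        √(deriv g (eta (X i) β₀ j)) * dInvSqrt g (eta (X i) β₀ k) *
          eta (X i) d k * (Y i k - g (eta (X i) β₀ k)) -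
        √(deriv g (eta (X i) β₀ j)) * √(deriv g (eta (X i) β₀ k)) * eta (X i) d k)| ≤
      K * ω * (1 + |Y i k - g (eta (X i) β₀ k)|) * (|eta (X i) d j| + |eta (X i) d k|) := by
    intro i j k
    -- Predictors of different observations may range over disjoint intervals, so the linearization
    -- is applied with one convex set per observation, the image of the ball.
    have hconv : ∀ j, Convex ℝ ((fun β => eta (X i) β j) '' Metric.closedBall β₀ ρ) := by
      intro j
      refine (convex_closedBall β₀ ρ).is_linear_image ⟨fun x y => ?_, fun a x => ?_⟩
      · simp [eta, mulVec_add]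
      · simp [eta, mulVec_smul]
    have hreg' : ∀ j, ∀ s ∈ (fun β => eta (X i) β j) '' Metric.closedBall β₀ ρ,
        RegularAt g c C M s := by
      rintro j s ⟨β, hβ, rfl⟩; exact hreg i j β hβ
    have := hK g _ (hconv j) (hreg' j) ω hω0 hω1 _ ⟨β₀, hβ₀, rfl⟩ _ (hconv k) (hreg' k)
      _ ⟨β₀, hβ₀, rfl⟩ _ ⟨β₁, hβ₁, rfl⟩ _ ⟨β₂, hβ₂, rfl⟩ _ ⟨β₁, hβ₁, rfl⟩ _ ⟨β₂, hβ₂, rfl⟩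
      (hdist i j _ hβ₁) (hdist i j _ hβ₂) (hdist i k _ hβ₁) (hdist i k _ hβ₂) (Y i k)
    rw [hd, eta_sub, eta_sub]
    refine le_trans (le_of_eq ?_) this
    simp only [scoreEntry]
    congr 1
    ring
  have hasq : ∀ i j, √(deriv g (eta (X i) β₀ j)) ^ 2 = deriv g (eta (X i) β₀ j) := fun i j =>
    Real.sq_sqrt (hc.trans_le (hreg i j β₀ hβ₀).2.1).le
  have hac : ∀ i j, c ≤ √(deriv g (eta (X i) β₀ j)) ^ 2 := fun i j => by
    rw [hasq]; exact (hreg i j β₀ hβ₀).2.1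
  have haC : ∀ i j, √(deriv g (eta (X i) β₀ j)) ^ 2 ≤ |C| := fun i j => by
    rw [hasq]; exact (hreg i j β₀ hβ₀).2.2.1.trans (le_abs_self _)
  have hsum : ∀ u : EuclideanSpace ℝ (Fin p),
      u.ofLp ⬝ᵥ (score g X Y π δ R β₁ - score g X Y π δ R β₂) = ∑ j, ∑ k, R⁻¹ j k * ∑ i, W i *
        (eta (X i) u j * (scoreEntry g (Y i k) (eta (X i) β₁ j) (eta (X i) β₁ k) -
          scoreEntry g (Y i k) (eta (X i) β₂ j) (eta (X i) β₂ k))) := by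
    intro u
    rw [dotProduct_sub, dotProduct_score, dotProduct_score]
    simp only [hWdef, mul_sub, Finset.sum_sub_distrib]
  have hrest : ∀ u : EuclideanSpace ℝ (Fin p), ∀ j k, ∑ i, W i * (|eta (X i) u j| *
      (K * ω * (1 + |Y i k - g (eta (X i) β₀ k)|) * (|eta (X i) d j| + |eta (X i) d k|))) ≤
      2 * K * C₃ * η * (‖u‖ * ‖d‖) := by
    intro u j k
    have hWe : ∀ i, 0 ≤ W i * (1 + |Y i k - g (eta (X i) β₀ k)|) := fun i =>
      mul_nonneg (hW i) (by positivity)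
    have e1 := sum_mul_abs_mul_abs_le hWe hC₃ (norm_nonneg u) (norm_nonneg d) (hG3 u j k) (hG3 d j k)
    have e2 := sum_mul_abs_mul_abs_le hWe hC₃ (norm_nonneg u) (norm_nonneg d) (hG3 u j k) (hG3 d k k)
    calc _ = K * ω * (∑ i, W i * (1 + |Y i k - g (eta (X i) β₀ k)|) *
            (|eta (X i) u j| * |eta (X i) d j|) + ∑ i, W i * (1 + |Y i k - g (eta (X i) β₀ k)|) *
            (|eta (X i) u j| * |eta (X i) d k|)) := by
          rw [← Finset.sum_add_distrib, Finset.mul_sum]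
          exact Finset.sum_congr rfl fun i _ => by ring
      _ ≤ K * η * (C₃ * (‖u‖ * ‖d‖) + C₃ * (‖u‖ * ‖d‖)) :=
          mul_le_mul (by gcongr) (add_le_add e1 e2) (Finset.sum_nonneg (fun i _ => mul_nonneg (hWe i) (by positivity)) |>.trans (le_add_of_nonneg_right (Finset.sum_nonneg fun i _ => mul_nonneg (hWe i) (by positivity)))) (by positivity)
      _ = _ := by ring
  have happrox : ∀ u : EuclideanSpace ℝ (Fin p),
      |u.ofLp ⬝ᵥ (score g X Y π δ R β₁ - score g X Y π δ R β₂) +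
        ∑ j, ∑ k, R⁻¹ j k * ∑ i, W i * (eta (X i) u j * (√(deriv g (eta (X i) β₀ j)) *
          √(deriv g (eta (X i) β₀ k)) * eta (X i) d k))| ≤ κ * (‖u‖ * ‖d‖) := by
    intro u
    rw [hsum]
    refine (abs_sum_linearization_le hW hR (fun i j k => hrem i j k) (fun j k => hN1 u d j k)
      (fun j k => hN2 u d j k) (fun j k => hrest u j k)).trans ?_
    calc _ = (B * η) * (‖u‖ * ‖d‖) := by rw [hB]; ring
      _ ≤ _ := by gcongr
  constructor
  · have hmain : 2 * κ * ‖d‖ ^ 2 ≤ ∑ j, ∑ k, R⁻¹ j k * ∑ i, W i * (eta (X i) d j *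
        (√(deriv g (eta (X i) β₀ j)) * √(deriv g (eta (X i) β₀ k)) * eta (X i) d k)) := by
      calc 2 * κ * ‖d‖ ^ 2 = κ₂ * c * (κ₁ * ‖d‖ ^ 2) := by rw [hκ]; ring
        _ ≤ κ₂ * c * ∑ i, W i * ∑ j, eta (X i) d j ^ 2 := by
          gcongr; exact (hgram d).1
        _ = ∑ i, W i * (κ₂ * ∑ j, c * eta (X i) d j ^ 2) := by
          rw [Finset.mul_sum]
          refine Finset.sum_congr rfl fun i _ => ?_
          rw [← Finset.mul_sum]; ring
        _ ≤ ∑ i, W i * (κ₂ * ∑ j, (√(deriv g (eta (X i) β₀ j)) * eta (X i) d j) ^ 2) := by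
          gcongr with i _ j _
          · exact hW i
          · rw [mul_pow]; gcongr; exact hac i j
        _ ≤ ∑ i, W i * ((fun j => √(deriv g (eta (X i) β₀ j)) * eta (X i) d j) ⬝ᵥ R⁻¹ *ᵥ
              (fun j => √(deriv g (eta (X i) β₀ j)) * eta (X i) d j)) := by
          gcongr with i _
          · exact hW i
          · exact hRq _
        _ = _ := by
          simp only [dotProduct, mulVec, Finset.mul_sum]
          rw [Finset.sum_comm]
          refine Finset.sum_congr rfl fun j _ => ?_
          rw [Finset.sum_comm]
          exact Finset.sum_congr rfl fun k _ => Finset.sum_congr rfl fun i _ => by ring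
    have := (abs_le.mp (happrox d)).2
    nlinarith
  · intro u
    have hmain : |∑ j, ∑ k, R⁻¹ j k * ∑ i, W i * (eta (X i) u j *
        (√(deriv g (eta (X i) β₀ j)) * √(deriv g (eta (X i) β₀ k)) * eta (X i) d k))| ≤
        (m : ℝ) ^ 2 * (C₂ * (|C| * C₁ * (‖u‖ * ‖d‖))) := by
      apply abs_sum_sum_mul_le hR
      intro j k
      have hq : ∀ (v : EuclideanSpace ℝ (Fin p)) l,
          ∑ i, W i * (√(deriv g (eta (X i) β₀ l)) * eta (X i) v l) ^ 2 ≤ |C| * C₁ * ‖v‖ ^ 2 := by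
        intro v l
        calc _ ≤ ∑ i, W i * (|C| * ∑ j, eta (X i) v j ^ 2) := by
              gcongr with i _
              · exact hW i
              · rw [mul_pow]
                exact mul_le_mul (haC i l) (Finset.single_le_sum
                  (f := fun j => eta (X i) v j ^ 2) (fun j _ => sq_nonneg _) (Finset.mem_univ l))
                  (sq_nonneg _) (abs_nonneg _)
          _ = |C| * ∑ i, W i * ∑ j, eta (X i) v j ^ 2 := by
              rw [Finset.mul_sum]; exact Finset.sum_congr rfl fun i _ => by ring
          _ ≤ _ := by rw [mul_assoc]; gcongr; exact (hgram v).2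
      refine le_trans (Finset.abs_sum_le_sum_abs _ _) (le_trans (le_of_eq ?_)
        (sum_mul_abs_mul_abs_le hW (by positivity) (norm_nonneg u) (norm_nonneg d) (hq u j) (hq d k)))
      refine Finset.sum_congr rfl fun i _ => ?_
      rw [← abs_mul, abs_mul, abs_of_nonneg (hW i)]
      congr 2; ring
    have h1 := happrox u
    have h2 := abs_add_le (u.ofLp ⬝ᵥ (score g X Y π δ R β₁ - score g X Y π δ R β₂) +
        ∑ j, ∑ k, R⁻¹ j k * ∑ i, W i * (eta (X i) u j * (√(deriv g (eta (X i) β₀ j)) *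
          √(deriv g (eta (X i) β₀ k)) * eta (X i) d k))) (-(∑ j, ∑ k, R⁻¹ j k * ∑ i, W i *
          (eta (X i) u j * (√(deriv g (eta (X i) β₀ j)) *
          √(deriv g (eta (X i) β₀ k)) * eta (X i) d k))))
    rw [add_neg_cancel_right, abs_neg] at h2
    linarith

end

/-! ### Calculus of `O_p` and of events of probability tending to one. -/

section Calculus

variable {Ω : ℕ → Type*} [∀ n, MeasurableSpace (Ω n)] {P : ∀ n, Measure (Ω n)}

theorem withProbTendstoOne_iff {E : ∀ n, Ω n → Prop} :
    WithProbTendstoOne P E ↔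
      ∀ ε : ℝ, 0 < ε → ∀ᶠ n in atTop, P n {ω | ¬ E n ω} ≤ ENNReal.ofReal ε := by
  rw [WithProbTendstoOne, ENNReal.tendsto_nhds_zero]
  constructor
  · intro h ε hε
    exact h _ (ENNReal.ofReal_pos.mpr hε)
  · intro h ε hε
    by_cases htop : ε = ⊤
    · exact Eventually.of_forall fun n => by rw [htop]; exact le_top
    · have := h ε.toReal (ENNReal.toReal_pos hε.ne' htop)
      rwa [ENNReal.ofReal_toReal htop] at this

theorem WithProbTendstoOne.mono {E F : ∀ n, Ω n → Prop} (hE : WithProbTendstoOne P E)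
    (h : ∀ᶠ n in atTop, ∀ᵐ ω ∂P n, E n ω → F n ω) : WithProbTendstoOne P F := by
  rw [withProbTendstoOne_iff] at *
  intro ε hε
  filter_upwards [hE ε hε, h] with n h1 h2
  refine le_trans (measure_mono_ae ?_) h1
  filter_upwards [h2] with ω hω hF hE
  exact hF (hω hE)

theorem withProbTendstoOne_of_ae {E : ∀ n, Ω n → Prop}
    (h : ∀ᶠ n in atTop, ∀ᵐ ω ∂P n, E n ω) : WithProbTendstoOne P E := by
  rw [withProbTendstoOne_iff]
  intro ε _
  filter_upwards [h] with n hn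
  rw [ae_iff] at hn
  rw [hn]; exact zero_le

theorem WithProbTendstoOne.and {E F : ∀ n, Ω n → Prop} (hE : WithProbTendstoOne P E)
    (hF : WithProbTendstoOne P F) : WithProbTendstoOne P (fun n ω => E n ω ∧ F n ω) := by
  rw [withProbTendstoOne_iff] at *
  intro ε hε
  filter_upwards [hE (ε / 2) (by positivity), hF (ε / 2) (by positivity)] with n h1 h2
  calc P n {ω | ¬ (E n ω ∧ F n ω)} ≤ P n ({ω | ¬ E n ω} ∪ {ω | ¬ F n ω}) :=
        measure_mono fun ω hω => by
          by_cases h : E n ω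
          · exact Or.inr fun hf => hω ⟨h, hf⟩
          · exact Or.inl h
    _ ≤ _ := measure_union_le _ _
    _ ≤ ENNReal.ofReal (ε / 2) + ENNReal.ofReal (ε / 2) := add_le_add h1 h2
    _ = ENNReal.ofReal ε := by rw [← ENNReal.ofReal_add (by positivity) (by positivity)]; simp

theorem withProbTendstoOne_forall {ι : Type*} [Finite ι] {E : ι → ∀ n, Ω n → Prop}
    (hE : ∀ j, WithProbTendstoOne P (E j)) : WithProbTendstoOne P (fun n ω => ∀ j, E j n ω) := by
  have := Fintype.ofFinite ι
  have h : ∀ s : Finset ι, WithProbTendstoOne P (fun n ω => ∀ j ∈ s, E j n ω) := by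
    classical
    intro s
    induction s using Finset.induction_on with
    | empty => exact withProbTendstoOne_of_ae (by simp)
    | insert a s ha ih =>
      refine ((hE a).and ih).mono (Eventually.of_forall fun n => Eventually.of_forall fun ω h j hj => ?_)
      rcases Finset.mem_insert.mp hj with rfl | hj
      · exact h.1
      · exact h.2 j hj
  exact (h Finset.univ).mono (Eventually.of_forall fun n => Eventually.of_forall fun ω h j =>
    h j (Finset.mem_univ j))

theorem IsBigOP.eventually_le {Z : ∀ n, Ω n → ℝ} {a : ℕ → ℝ} (hZ : IsBigOP P Z a)
    (ha : Tendsto a atTop (𝓝 0)) {η : ℝ} (hη : 0 < η) :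
    WithProbTendstoOne P (fun n ω => |Z n ω| ≤ η) := by
  rw [withProbTendstoOne_iff]
  intro ε hε
  obtain ⟨M, hM, h⟩ := hZ ε hε
  have h2 : ∀ᶠ n in atTop, M * a n < η := by
    have := (ha.const_mul M).eventually_lt_const (by simpa using hη)
    exact this
  filter_upwards [h, h2] with n h1 h2
  refine le_trans (measure_mono fun ω hω => ?_) h1
  exact h2.trans (not_le.mp hω)

theorem IsBigOP.of_le {Z Z' : ∀ n, Ω n → ℝ} {a : ℕ → ℝ} {C : ℝ} (hC : 0 < C)
    (hZ : IsBigOP P Z a) (h : WithProbTendstoOne P (fun n ω => |Z' n ω| ≤ C * |Z n ω|)) :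
    IsBigOP P Z' a := by
  rw [withProbTendstoOne_iff] at h
  intro ε hε
  obtain ⟨M, hM, h1⟩ := hZ (ε / 2) (by positivity)
  refine ⟨C * M, by positivity, ?_⟩
  filter_upwards [h1, h (ε / 2) (by positivity)] with n h1 h2
  calc P n {ω | C * M * a n < |Z' n ω|}
      ≤ P n ({ω | M * a n < |Z n ω|} ∪ {ω | ¬ |Z' n ω| ≤ C * |Z n ω|}) :=
        measure_mono fun ω hω => by
          by_cases h : |Z' n ω| ≤ C * |Z n ω|
          · refine Or.inl ?_
            have h3 : C * M * a n < C * |Z n ω| := lt_of_lt_of_le hω h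
            rw [mul_assoc] at h3
            exact lt_of_mul_lt_mul_left h3 hC.le
          · exact Or.inr h
    _ ≤ _ := measure_union_le _ _
    _ ≤ ENNReal.ofReal (ε / 2) + ENNReal.ofReal (ε / 2) := add_le_add h1 h2
    _ = ENNReal.ofReal ε := by rw [← ENNReal.ofReal_add (by positivity) (by positivity)]; simp

theorem IsBigOP.add {Z Z' : ∀ n, Ω n → ℝ} {a : ℕ → ℝ} (hZ : IsBigOP P Z a)
    (hZ' : IsBigOP P Z' a) : IsBigOP P (fun n ω => Z n ω + Z' n ω) a := by
  intro ε hε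
  obtain ⟨M, hM, h1⟩ := hZ (ε / 2) (by positivity)
  obtain ⟨M', hM', h2⟩ := hZ' (ε / 2) (by positivity)
  refine ⟨M + M', by positivity, ?_⟩
  filter_upwards [h1, h2] with n h1 h2
  calc P n {ω | (M + M') * a n < |Z n ω + Z' n ω|}
      ≤ P n ({ω | M * a n < |Z n ω|} ∪ {ω | M' * a n < |Z' n ω|}) :=
        measure_mono fun ω hω => by
          by_contra h
          simp only [Set.mem_union, Set.mem_ofPred_eq, not_or, not_lt] at h hω
          have := abs_add_le (Z n ω) (Z' n ω)
          linarith
    _ ≤ _ := measure_union_le _ _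
    _ ≤ ENNReal.ofReal (ε / 2) + ENNReal.ofReal (ε / 2) := add_le_add h1 h2
    _ = ENNReal.ofReal ε := by rw [← ENNReal.ofReal_add (by positivity) (by positivity)]; simp

theorem IsBigOP.sum {ι : Type*} (s : Finset ι) {Z : ι → ∀ n, Ω n → ℝ} {a : ℕ → ℝ}
    (ha : ∀ᶠ n in atTop, 0 ≤ a n) (hZ : ∀ j ∈ s, IsBigOP P (Z j) a) :
    IsBigOP P (fun n ω => ∑ j ∈ s, Z j n ω) a := by
  classical
  induction s using Finset.induction_on with
  | empty =>
    intro ε hε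
    refine ⟨1, one_pos, ?_⟩
    filter_upwards [ha] with n hn
    simp [hn.not_gt]
  | insert j s hj ih =>
    simp only [Finset.sum_insert hj]
    exact (hZ j (by simp)).add (ih fun k hk => hZ k (by simp [hk]))

theorem IsBigOP.of_const_mul {Z : ∀ n, Ω n → ℝ} {a : ℕ → ℝ} {C : ℝ} (hC : 0 ≤ C)
    (ha : ∀ᶠ n in atTop, 0 ≤ a n) (hZ : IsBigOP P Z (fun n => C * a n)) : IsBigOP P Z a := by
  intro ε hε
  obtain ⟨M, hM, h1⟩ := hZ ε hε
  -- The `+ 1` keeps the witness positive when `C = 0`.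
  refine ⟨M * C + 1, by positivity, ?_⟩
  filter_upwards [h1, ha] with n h1 ha
  refine le_trans (measure_mono fun ω hω => ?_) h1
  simp only [Set.mem_ofPred_eq] at hω ⊢
  linarith

theorem IsBigOP.sqrt {Z : ∀ n, Ω n → ℝ} {a : ℕ → ℝ} (hZ : IsBigOP P Z a) :
    IsBigOP P (fun n ω => √(Z n ω)) (fun n => √(a n)) := by
  intro ε hε
  obtain ⟨M, hM, h1⟩ := hZ ε hε
  refine ⟨√M, by positivity, ?_⟩
  filter_upwards [h1] with n h1
  refine le_trans (measure_mono fun ω hω => ?_) h1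
  by_contra h
  simp only [Set.mem_ofPred_eq, not_lt] at h hω
  rw [← Real.sqrt_mul hM.le, abs_of_nonneg (Real.sqrt_nonneg _)] at hω
  exact absurd hω (not_lt.mpr (Real.sqrt_le_sqrt ((le_abs_self _).trans h)))

end Calculus

/-! ### Poisson sampling: conditioning on the data and second moments. -/

/-- Markov's inequality, with no positivity requirement on the bound. -/
theorem measure_lt_le_of_lintegral_le {Ω : Type*} [MeasurableSpace Ω] {μ : Measure Ω}
    {f : Ω → ENNReal} (hf : AEMeasurable f μ) {b ε : ℝ} (hb : 0 ≤ b) (hε : 0 < ε)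
    (h : ∫⁻ ω, f ω ∂μ ≤ ENNReal.ofReal b) :
    μ {ω | ENNReal.ofReal (b / ε) < f ω} ≤ ENNReal.ofReal ε := by
  rcases hb.eq_or_lt with rfl | hb
  · have h0 : ∫⁻ ω, f ω ∂μ = 0 := by simpa using h
    rw [lintegral_eq_zero_iff' hf] at h0
    have : μ {ω | ENNReal.ofReal (0 / ε) < f ω} = 0 := by
      refine measure_mono_null (fun ω hω => ?_) (ae_iff.mp h0)
      simp only [zero_div, ENNReal.ofReal_zero, Set.mem_ofPred_eq] at hω
      exact hω.ne'
    rw [this]; exact zero_le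
  · have h1 : ENNReal.ofReal (b / ε) ≠ 0 := (ENNReal.ofReal_pos.mpr (by positivity)).ne'
    calc μ {ω | ENNReal.ofReal (b / ε) < f ω} ≤ μ {ω | ENNReal.ofReal (b / ε) ≤ f ω} :=
          measure_mono fun ω hω => by
            simp only [Set.mem_ofPred_eq] at hω ⊢; exact hω.le
      _ ≤ (∫⁻ ω, f ω ∂μ) / ENNReal.ofReal (b / ε) :=
          meas_ge_le_lintegral_div hf h1 ENNReal.ofReal_ne_top
      _ ≤ ENNReal.ofReal b / ENNReal.ofReal (b / ε) := by gcongr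
      _ = ENNReal.ofReal ε := by
          rw [← ENNReal.ofReal_div_of_pos (by positivity)]
          congr 1; field_simp

/-- A conditional probability given `m` acts as a density on nonnegative `m`-measurable
functions. -/
theorem lintegral_indicator_eq_of_condExp {Ω : Type*} {m mΩ : MeasurableSpace Ω} {μ : Measure Ω}
    [IsProbabilityMeasure μ] (hm : m ≤ mΩ) {A : Set Ω} (hA : MeasurableSet A) {w : Ω → ℝ}
    (hw0 : 0 ≤ᵐ[μ] w) (hwm : Measurable w) (hw : μ[A.indicator (fun _ => (1 : ℝ)) | m] =ᵐ[μ] w)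
    {f : Ω → ENNReal} (hf : Measurable[m] f) :
    ∫⁻ ω, A.indicator f ω ∂μ = ∫⁻ ω, ENNReal.ofReal (w ω) * f ω ∂μ := by
  have hwint : Integrable w μ := integrable_condExp.congr hw
  -- The restriction of `μ` to `A` and the measure with density `w` agree on `m`-measurable sets, by
  -- the defining property of the conditional expectation; hence they integrate `m`-measurable
  -- functions alike.
  have key : (μ.restrict A).trim hm =
      (μ.withDensity fun ω => ENNReal.ofReal (w ω)).trim hm := by
    refine @Measure.ext _ m _ _ fun s hs => ?_
    rw [trim_measurableSet_eq hm hs, trim_measurableSet_eq hm hs,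
      Measure.restrict_apply (hm s hs), withDensity_apply _ (hm s hs),
      ← ofReal_integral_eq_lintegral_ofReal hwint.integrableOn (ae_restrict_of_ae hw0)]
    have h1 : ∫ ω in s, w ω ∂μ = ∫ ω in s, A.indicator (fun _ => (1 : ℝ)) ω ∂μ := by
      rw [← setIntegral_condExp hm ((integrable_const (1 : ℝ)).indicator hA) hs]
      exact setIntegral_congr_ae (hm s hs) (hw.mono fun ω h _ => h.symm)
    rw [h1, integral_indicator hA, Measure.restrict_restrict hA, setIntegral_const, smul_eq_mul,
      mul_one, ofReal_measureReal, Set.inter_comm]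
  rw [lintegral_indicator hA, ← lintegral_trim hm hf, key, lintegral_trim hm hf,
    lintegral_withDensity_eq_lintegral_mul _ hwm.ennreal_ofReal (hf.mono hm le_rfl)]
  rfl

section Bernoulli

variable {n : ℕ}

/-- Probability of the sampling pattern `e` under Poisson sampling. -/
def patternProb (π : Fin n → ℝ) (e : Fin n → Bool) : ℝ :=
  ∏ i, if e i then π i else 1 - π i

theorem patternProb_nonneg {π : Fin n → ℝ} (h : ∀ i, 0 < π i ∧ π i ≤ 1) (e : Fin n → Bool) :
    0 ≤ patternProb π e := by
  refine Finset.prod_nonneg fun i _ => ?_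
  have := h i
  split_ifs <;> linarith

theorem sum_pattern_prod (h : Fin n → Bool → ℝ) :
    ∑ e : Fin n → Bool, ∏ i, h i (e i) = ∏ i, (h i true + h i false) := by
  have := Finset.prod_univ_sum (fun _ : Fin n => (Finset.univ : Finset Bool)) h
  simp only [Fintype.piFinset_univ, Fintype.sum_bool] at this
  exact this.symm

/-- The variables `δ_i/π_i - 1` are independent, centred, and of variance `1/π_i - 1`. The
expectation over patterns is a finite sum of products, so it factors over the coordinates. -/
theorem sum_patternProb_mul_mul {π : Fin n → ℝ} (hπ : ∀ i, π i ≠ 0) (i j : Fin n) :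
    ∑ e : Fin n → Bool, patternProb π e *
      (((if e i then 1 / π i else 0) - 1) * ((if e j then 1 / π j else 0) - 1)) =
      if i = j then 1 / π i - 1 else 0 := by
  have h1 : ∀ e : Fin n → Bool, patternProb π e *
      (((if e i then 1 / π i else 0) - 1) * ((if e j then 1 / π j else 0) - 1)) =
      ∏ k, ((if e k then π k else 1 - π k) *
        ((if k = i then (if e k then 1 / π k else 0) - 1 else 1) *
          (if k = j then (if e k then 1 / π k else 0) - 1 else 1))) := by
    intro e
    rw [Finset.prod_mul_distrib, Finset.prod_mul_distrib, Finset.prod_ite_eq',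
      Finset.prod_ite_eq']
    simp [patternProb]
  simp only [h1]
  rw [sum_pattern_prod fun k b => ((if b then π k else 1 - π k) *
        ((if k = i then (if b then 1 / π k else 0) - 1 else 1) *
          (if k = j then (if b then 1 / π k else 0) - 1 else 1)))]
  by_cases hij : i = j
  · subst hij
    rw [if_pos rfl, Finset.prod_eq_single i]
    · have := hπ i
      simp; field_simp; ring
    · intro k _ hk
      simp [hk]
    · simp
  · rw [if_neg hij]
    -- The factor at `i` is the mean of `δ_i/π_i - 1`, which vanishes.
    apply Finset.prod_eq_zero (Finset.mem_univ i)
    have := hπ i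
    simp [hij]; field_simp; ring

theorem sum_patternProb_mul_sq {π : Fin n → ℝ} (hπ : ∀ i, π i ≠ 0) (x : Fin n → ℝ) :
    ∑ e : Fin n → Bool, patternProb π e *
      (∑ i, (weight π e i - 1 / n) * x i) ^ 2 = ∑ i, (1 / n) ^ 2 * (1 / π i - 1) * x i ^ 2 := by
  have h1 : ∀ e : Fin n → Bool, patternProb π e * (∑ i, (weight π e i - 1 / n) * x i) ^ 2 =
      ∑ i, ∑ j, (1 / n) ^ 2 * (x i * x j) * (patternProb π e *
        (((if e i then 1 / π i else 0) - 1) * ((if e j then 1 / π j else 0) - 1))) := by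
    intro e
    rw [sq, Finset.sum_mul_sum, Finset.mul_sum]
    refine Finset.sum_congr rfl fun i _ => ?_
    rw [Finset.mul_sum]
    refine Finset.sum_congr rfl fun j _ => ?_
    simp only [weight]; ring
  simp only [h1]
  rw [Finset.sum_comm]
  refine Finset.sum_congr rfl fun i _ => ?_
  rw [Finset.sum_comm]
  simp only [← Finset.mul_sum, sum_patternProb_mul_mul hπ]
  simp; ring

end Bernoulli

/-! ### Weighted sums over the subsample in the model. -/

namespace Arr

variable {m : ℕ} {Ω : ℕ → Type*}

/-- The sigma-algebra generated by the covariates and responses of individual `i`. -/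
@[reducible]
def sigmaXY (D : Arr m Ω) (n : ℕ) (i : Fin n) : MeasurableSpace (Ω n) :=
  MeasurableSpace.comap
    (fun ω => ((fun j k => D.X n ω i j k : Fin m → Fin (D.p n) → ℝ), D.Y n ω i)) inferInstance

theorem sigmaX_le_sigmaXY (D : Arr m Ω) (n : ℕ) (i : Fin n) : D.sigmaX n i ≤ D.sigmaXY n i := by
  have h := comap_measurable (m := inferInstance)
    (fun ω => ((fun j k => D.X n ω i j k : Fin m → Fin (D.p n) → ℝ), D.Y n ω i))
  exact (measurable_fst.comp h).comap_le

theorem sigmaXY_le_sigmaData (D : Arr m Ω) (n : ℕ) (i : Fin n) :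
    D.sigmaXY n i ≤ D.sigmaData n := by
  have h := comap_measurable (m := inferInstance)
    (fun ω => ((fun i j k => D.X n ω i j k : Fin n → Fin m → Fin (D.p n) → ℝ), D.Y n ω, D.π n ω))
  exact (((measurable_pi_apply i).comp (measurable_fst.comp h)).prodMk
    ((measurable_pi_apply i).comp (measurable_fst.comp (measurable_snd.comp h)))).comap_le

theorem measurable_X (D : Arr m Ω) (n : ℕ) (i : Fin n) (j : Fin m) (k : Fin (D.p n)) :
    Measurable[D.sigmaX n i] fun ω => D.X n ω i j k := by
  have h := comap_measurable (m := inferInstance)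
    (fun ω => (fun j k => D.X n ω i j k : Fin m → Fin (D.p n) → ℝ))
  exact (measurable_pi_apply k).comp ((measurable_pi_apply j).comp h)

theorem measurable_Y (D : Arr m Ω) (n : ℕ) (i : Fin n) (j : Fin m) :
    Measurable[D.sigmaXY n i] fun ω => D.Y n ω i j := by
  have h := comap_measurable (m := inferInstance)
    (fun ω => ((fun j k => D.X n ω i j k : Fin m → Fin (D.p n) → ℝ), D.Y n ω i))
  exact (measurable_pi_apply j).comp (measurable_snd.comp h)

theorem measurable_π (D : Arr m Ω) (n : ℕ) (i : Fin n) :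
    Measurable[D.sigmaData n] fun ω => D.π n ω i := by
  have h := comap_measurable (m := inferInstance)
    (fun ω => ((fun i j k => D.X n ω i j k : Fin n → Fin m → Fin (D.p n) → ℝ), D.Y n ω, D.π n ω))
  exact (measurable_pi_apply i).comp (measurable_snd.comp (measurable_snd.comp h))

theorem measurable_eta (D : Arr m Ω) (n : ℕ) (i : Fin n) (β : EuclideanSpace ℝ (Fin (D.p n)))
    (j : Fin m) : Measurable[D.sigmaX n i] fun ω => eta (D.X n ω i) β j := by
  simp only [eta, mulVec, dotProduct]
  exact Finset.measurable_sum _ fun k _ => (D.measurable_X n i j k).mul_const _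

variable [∀ n, MeasurableSpace (Ω n)] {D : Arr m Ω} {P : ∀ n, Measure (Ω n)}

theorem IsModel.sigmaData_le (hD : D.IsModel P) (n : ℕ) :
    D.sigmaData n ≤ (inferInstance : MeasurableSpace (Ω n)) := by
  refine Measurable.comap_le (Measurable.prodMk ?_ (Measurable.prodMk ?_ ?_))
  · exact measurable_pi_lambda _ fun i => measurable_pi_lambda _ fun j =>
      measurable_pi_lambda _ fun k => hD.meas_X n i j k
  · exact measurable_pi_lambda _ fun i => measurable_pi_lambda _ fun j => hD.meas_Y n i j
  · exact measurable_pi_lambda _ fun i => hD.meas_π n i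

theorem IsModel.sigmaX_le (hD : D.IsModel P) (n : ℕ) (i : Fin n) :
    D.sigmaX n i ≤ (inferInstance : MeasurableSpace (Ω n)) :=
  (D.sigmaX_le_sigmaXY n i).trans ((D.sigmaXY_le_sigmaData n i).trans (hD.sigmaData_le n))

variable [∀ n, IsProbabilityMeasure (P n)]

theorem IsModel.r_pos (hD : D.IsModel P) {n : ℕ} (hn : 0 < n) : 0 < D.r n := by
  obtain ⟨ω, h1, h2⟩ := ((hD.π_mem n).and (hD.π_sum n)).exists
  rw [← h2]
  exact Finset.sum_pos (fun i _ => (h1 i).1) ⟨⟨0, hn⟩, Finset.mem_univ _⟩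

theorem IsModel.r_le (hD : D.IsModel P) (n : ℕ) : D.r n ≤ n := by
  obtain ⟨ω, h1, h2⟩ := ((hD.π_mem n).and (hD.π_sum n)).exists
  rw [← h2]
  calc ∑ i, D.π n ω i ≤ ∑ i : Fin n, (1 : ℝ) := Finset.sum_le_sum fun i _ => (h1 i).2
    _ = n := by simp

/-- There are finitely many sampling patterns. On each one the integrand is a function of the data,
so the indicator of the pattern may be replaced by its conditional probability. -/
theorem IsModel.lintegral_poisson (hD : D.IsModel P) (n : ℕ)
    {F : (Fin n → Bool) → Ω n → ENNReal} (hF : ∀ e, Measurable[D.sigmaData n] (F e)) :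
    ∫⁻ ω, F (D.δ n ω) ω ∂P n =
      ∫⁻ ω, ∑ e, ENNReal.ofReal (patternProb (D.π n ω) e) * F e ω ∂P n := by
  have hle := hD.sigmaData_le n
  have hset : ∀ e : Fin n → Bool, MeasurableSet {ω | D.δ n ω = e} := fun e => by
    have : Measurable (D.δ n) := measurable_pi_lambda _ fun i => hD.meas_δ n i
    exact this (measurableSet_singleton e)
  have hpm : ∀ e, Measurable fun ω => patternProb (D.π n ω) e := fun e => by
    refine Finset.measurable_prod _ fun i _ => ?_
    split_ifs
    · exact hD.meas_π n i
    · exact (hD.meas_π n i).const_sub 1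
  have h1 : ∀ ω, F (D.δ n ω) ω = ∑ e, Set.indicator {ω | D.δ n ω = e} (F e) ω := by
    intro ω
    rw [Finset.sum_eq_single (D.δ n ω)]
    · simp
    · intro e _ he
      have hne : ω ∉ {ω | D.δ n ω = e} := fun h => he (Eq.symm h)
      exact Set.indicator_of_notMem hne _
    · simp
  simp only [h1]
  rw [lintegral_finsetSum _ fun e _ => ((hF e).mono hle le_rfl).indicator (hset e),
    lintegral_finsetSum (f := fun e ω => ENNReal.ofReal (patternProb (D.π n ω) e) * F e ω) _
      fun e _ => (hpm e).ennreal_ofReal.mul ((hF e).mono hle le_rfl)]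
  refine Finset.sum_congr rfl fun e _ => ?_
  exact lintegral_indicator_eq_of_condExp hle (hset e)
    ((hD.π_mem n).mono fun ω h => patternProb_nonneg h e) (hpm e) (hD.poisson n e) (hF e)

/-- Given the data, the variance is `n⁻² ∑ (1/π_i - 1) ξ_i²`, at most `(K/n) ∑ ξ_i²` on `G`. The
event `G` has to be determined by the data, so that its indicator passes through the conditioning.
-/
theorem IsModel.lintegral_sampling_le (hD : D.IsModel P) {n : ℕ} (hn : 0 < n) {α : Type*}
    [Fintype α] {ξ : Fin n → α → Ω n → ℝ} (hξ : ∀ i a, Measurable[D.sigmaData n] (ξ i a))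
    {G : Set (Ω n)} (hG : MeasurableSet[D.sigmaData n] G) {K B : ℝ} (hK : 0 ≤ K)
    (hGK : ∀ ω ∈ G, ∀ i, 1 / ((n : ℝ) * D.π n ω i) ≤ K)
    (hbound : ∀ i, ∫⁻ ω, ENNReal.ofReal (∑ a, ξ i a ω ^ 2) ∂P n ≤ ENNReal.ofReal B) :
    ∫⁻ ω, G.indicator (fun ω => ENNReal.ofReal
      (∑ a, (∑ i, (weight (D.π n ω) (D.δ n ω) i - 1 / n) * ξ i a ω) ^ 2)) ω ∂P n ≤
      ENNReal.ofReal (K * B) := by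
  have hle := hD.sigmaData_le n
  have hn' : (0 : ℝ) < n := by exact_mod_cast hn
  set F : (Fin n → Bool) → Ω n → ENNReal := fun e => G.indicator fun ω => ENNReal.ofReal
      (∑ a, (∑ i, (weight (D.π n ω) e i - 1 / n) * ξ i a ω) ^ 2) with hFdef
  have hF : ∀ e, Measurable[D.sigmaData n] (F e) := by
    intro e
    refine Measurable.indicator (Measurable.ennreal_ofReal (Finset.measurable_sum _ fun a _ =>
      (Finset.measurable_sum _ fun i _ => Measurable.mul ?_ (hξ i a)).pow_const 2)) hG
    refine Measurable.sub_const (Measurable.const_mul ?_ _) _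
    split_ifs
    · exact (D.measurable_π n i).const_div 1
    · exact measurable_const
  calc _ = ∫⁻ ω, F (D.δ n ω) ω ∂P n := rfl
    _ = _ := hD.lintegral_poisson n hF
    _ ≤ ∫⁻ ω, ENNReal.ofReal (K / n) * ∑ i, ENNReal.ofReal (∑ a, ξ i a ω ^ 2) ∂P n := by
      refine lintegral_mono_ae ?_
      filter_upwards [hD.π_mem n] with ω hω
      by_cases hωG : ω ∈ G
      · have h1 : ∀ e, ENNReal.ofReal (patternProb (D.π n ω) e) * F e ω =
            ENNReal.ofReal (patternProb (D.π n ω) e *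
              ∑ a, (∑ i, (weight (D.π n ω) e i - 1 / n) * ξ i a ω) ^ 2) := by
          intro e
          rw [ENNReal.ofReal_mul (patternProb_nonneg hω e), hFdef]
          simp only [Set.indicator_of_mem hωG]
        simp only [h1]
        rw [← ENNReal.ofReal_sum_of_nonneg fun e _ => mul_nonneg (patternProb_nonneg hω e)
            (Finset.sum_nonneg fun a _ => sq_nonneg _),
          ← ENNReal.ofReal_sum_of_nonneg fun i _ => Finset.sum_nonneg fun a _ => sq_nonneg _,
          ← ENNReal.ofReal_mul (by positivity)]
        apply ENNReal.ofReal_le_ofReal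
        calc _ = ∑ a, ∑ i, (1 / (n : ℝ)) ^ 2 * (1 / D.π n ω i - 1) * ξ i a ω ^ 2 := by
              simp only [Finset.mul_sum]
              rw [Finset.sum_comm]
              exact Finset.sum_congr rfl fun a _ =>
                sum_patternProb_mul_sq (fun i => (hω i).1.ne') fun i => ξ i a ω
          _ ≤ ∑ a, ∑ i, K / n * ξ i a ω ^ 2 := by
              refine Finset.sum_le_sum fun a _ => Finset.sum_le_sum fun i _ => ?_
              refine mul_le_mul_of_nonneg_right ?_ (sq_nonneg _)
              have h2 := hGK ω hωG i
              have h3 := (hω i).1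
              calc (1 / (n : ℝ)) ^ 2 * (1 / D.π n ω i - 1) ≤ (1 / (n : ℝ)) ^ 2 * (1 / D.π n ω i) := by
                    gcongr; linarith
                _ = 1 / ((n : ℝ) * D.π n ω i) / n := by field_simp
                _ ≤ K / n := by gcongr
          _ = _ := by
              rw [Finset.sum_comm]
              simp only [Finset.mul_sum]
      · have : ∀ e, F e ω = 0 := fun e => Set.indicator_of_notMem hωG _
        simp [this]
    _ = ENNReal.ofReal (K / n) * ∑ i, ∫⁻ ω, ENNReal.ofReal (∑ a, ξ i a ω ^ 2) ∂P n := by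
      have hm : ∀ i, Measurable fun ω => ENNReal.ofReal (∑ a, ξ i a ω ^ 2) := fun i =>
        (Finset.measurable_sum _ fun a _ =>
          ((hξ i a).mono hle le_rfl).pow_const 2).ennreal_ofReal
      rw [lintegral_const_mul _ (Finset.measurable_sum _ fun i _ => hm i),
        lintegral_finsetSum _ fun i _ => hm i]
    _ ≤ ENNReal.ofReal (K / n) * ∑ i : Fin n, ENNReal.ofReal B := by
      gcongr with i _
      exact hbound i
    _ = ENNReal.ofReal (K * B) := by
      rw [Finset.sum_const, Finset.card_univ, Fintype.card_fin, nsmul_eq_mul,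
        ← ENNReal.ofReal_natCast, ← ENNReal.ofReal_mul hn'.le, ← ENNReal.ofReal_mul (by positivity)]
      congr 1; field_simp

/-- (C7) bounds the weights only in probability, so no unconditional second moment is available. The
sum is truncated to the event where the weights are at most `M/r`: Markov's inequality applies
there, and (C7) bounds the complement. -/
theorem IsModel.sampling_fluctuation_isBigOP (hD : D.IsModel P) (h7 : D.C7 P) {α : ℕ → Type*}
    [∀ n, Fintype (α n)] {ξ : ∀ n, Fin n → α n → Ω n → ℝ}
    (hξ : ∀ n i a, Measurable[D.sigmaData n] (ξ n i a)) {B : ℕ → ℝ} (hB : ∀ n, 0 ≤ B n)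
    (hbound : ∀ᶠ n in atTop, ∀ i,
      ∫⁻ ω, ENNReal.ofReal (∑ a, ξ n i a ω ^ 2) ∂P n ≤ ENNReal.ofReal (B n)) :
    IsBigOP P (fun n ω => ∑ a, (∑ i, (weight (D.π n ω) (D.δ n ω) i - 1 / n) * ξ n i a ω) ^ 2)
      (fun n => B n / D.r n) := by
  intro ε hε
  obtain ⟨M, hM, h7⟩ := h7 (ε / 2) (by positivity)
  refine ⟨M / (ε / 2), by positivity, ?_⟩
  filter_upwards [h7, hbound, eventually_gt_atTop 0] with n h7 hb hn
  have hr := hD.r_pos hn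
  have hle := hD.sigmaData_le n
  set G : Set (Ω n) := {ω | ∀ i, 1 / ((n : ℝ) * D.π n ω i) ≤ M * (1 / D.r n)} with hGdef
  have hG : MeasurableSet[D.sigmaData n] G := by
    have : G = ⋂ i, {ω | 1 / ((n : ℝ) * D.π n ω i) ≤ M * (1 / D.r n)} := by
      ext ω; simp [hGdef]
    rw [this]
    refine MeasurableSet.iInter fun i => ?_
    exact @measurableSet_le _ _ _ _ _ (D.sigmaData n) _ _ _ _ _
      (((D.measurable_π n i).const_mul _).const_div 1) measurable_const
  have hint := hD.lintegral_sampling_le hn (hξ n) hG (K := M * (1 / D.r n)) (by positivity)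
    (fun ω hω => hω) hb
  set Z : Ω n → ℝ := fun ω =>
    ∑ a, (∑ i, (weight (D.π n ω) (D.δ n ω) i - 1 / n) * ξ n i a ω) ^ 2 with hZ
  have hZm : Measurable Z := by
    refine Finset.measurable_sum _ fun a _ => (Finset.measurable_sum _ fun i _ =>
      Measurable.mul ?_ ((hξ n i a).mono hle le_rfl)).pow_const 2
    refine Measurable.sub_const (Measurable.const_mul ?_ _) _
    refine Measurable.ite (hD.meas_δ n i (measurableSet_singleton true))
      ((hD.meas_π n i).const_div 1) measurable_const
  have hmark := measure_lt_le_of_lintegral_le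
    ((hZm.ennreal_ofReal.indicator (hle _ hG)).aemeasurable) (mul_nonneg (by positivity) (hB n))
    (by positivity : 0 < ε / 2) hint
  have hZ0 : ∀ ω, 0 ≤ Z ω := fun ω => Finset.sum_nonneg fun a _ => sq_nonneg _
  calc P n {ω | M / (ε / 2) * (B n / D.r n) < |Z ω|}
      ≤ P n ({ω | M * (1 / D.r n) < |⨆ i, 1 / ((n : ℝ) * D.π n ω i)|} ∪
        {ω | ENNReal.ofReal (M * (1 / D.r n) * B n / (ε / 2)) <
          G.indicator (fun ω => ENNReal.ofReal (Z ω)) ω}) := by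
        refine measure_mono fun ω hω => ?_
        by_cases hωG : ω ∈ G
        · refine Or.inr ?_
          simp only [Set.mem_ofPred_eq, Set.indicator_of_mem hωG] at hω ⊢
          rw [abs_of_nonneg (hZ0 ω)] at hω
          have hbn := hB n
          rw [ENNReal.ofReal_lt_ofReal_iff_of_nonneg (by positivity)]
          refine lt_of_eq_of_lt ?_ hω
          field_simp
        · refine Or.inl ?_
          simp only [hGdef, Set.mem_ofPred_eq, not_forall, not_le] at hωG ⊢
          obtain ⟨i, hi⟩ := hωG
          exact hi.trans_le ((le_ciSup (f := fun i => 1 / ((n : ℝ) * D.π n ω i))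
            (Set.finite_range _).bddAbove i).trans (le_abs_self _))
    _ ≤ _ := measure_union_le _ _
    _ ≤ ENNReal.ofReal (ε / 2) + ENNReal.ofReal (ε / 2) := add_le_add h7 hmark
    _ = ENNReal.ofReal ε := by rw [← ENNReal.ofReal_add (by positivity) (by positivity)]; simp

/-- Centred terms of different individuals are independent, so variances add and the average has
second moment at most `B/n`. -/
theorem IsModel.lintegral_sum_sq_le (hD : D.IsModel P) {n : ℕ} (hn : 0 < n) {α : Type*}
    [Fintype α] {ξ : Fin n → α → Ω n → ℝ} (hξ : ∀ i a, Measurable[D.sigmaXY n i] (ξ i a))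
    (hL2 : ∀ i a, MemLp (ξ i a) 2 (P n)) (h0 : ∀ i a, ∫ ω, ξ i a ω ∂P n = 0) {B : ℝ} (hB : 0 ≤ B)
    (hbound : ∀ i, ∫⁻ ω, ENNReal.ofReal (∑ a, ξ i a ω ^ 2) ∂P n ≤ ENNReal.ofReal B) :
    ∫⁻ ω, ENNReal.ofReal (∑ a, (∑ i, 1 / (n : ℝ) * ξ i a ω) ^ 2) ∂P n ≤
      ENNReal.ofReal (B / n) := by
  have hn' : (0 : ℝ) < n := by exact_mod_cast hn
  have hle : ∀ i, D.sigmaXY n i ≤ (inferInstance : MeasurableSpace (Ω n)) := fun i =>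
    (D.sigmaXY_le_sigmaData n i).trans (hD.sigmaData_le n)
  have hsqint : ∀ i a, Integrable (fun ω => ξ i a ω ^ 2) (P n) := fun i a => (hL2 i a).integrable_sq
  have hS2 : ∀ a, MemLp (fun ω => ∑ i, ξ i a ω) 2 (P n) := fun a =>
    memLp_finsetSum _ fun i _ => hL2 i a
  have hvar : ∀ a, ∫ ω, (∑ i, ξ i a ω) ^ 2 ∂P n = ∑ i, ∫ ω, ξ i a ω ^ 2 ∂P n := by
    intro a
    have hind : ∀ i j, i ≠ j → IndepFun (ξ i a) (ξ j a) (P n) := by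
      intro i j hij
      have h1 := (hD.indep n).indepFun hij
      rw [IndepFun_iff_Indep] at h1 ⊢
      exact indep_of_indep_of_le_left (indep_of_indep_of_le_right h1 (hξ j a).comap_le)
        (hξ i a).comap_le
    have h1 := IndepFun.variance_sum (s := Finset.univ) (X := fun i => ξ i a) (μ := P n)
      (fun i _ => hL2 i a) (fun i _ j _ hij => hind i j hij)
    have hsum0 : ∫ ω, (∑ i, ξ i a) ω ∂P n = 0 := by
      simp only [Finset.sum_apply]
      rw [integral_finsetSum _ fun i _ => (hL2 i a).integrable one_le_two]
      exact Finset.sum_eq_zero fun i _ => h0 i a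
    rw [variance_of_integral_eq_zero ?_ hsum0] at h1
    · simp only [Finset.sum_apply] at h1
      rw [h1]
      exact Finset.sum_congr rfl fun i _ =>
        variance_of_integral_eq_zero (hL2 i a).aestronglyMeasurable.aemeasurable (h0 i a)
    · have := (hS2 a).aestronglyMeasurable.aemeasurable
      convert this using 1
      ext ω; simp
  have hb : ∀ i, ∑ a, ∫ ω, ξ i a ω ^ 2 ∂P n ≤ B := by
    intro i
    have h1 := hbound i
    rw [← ofReal_integral_eq_lintegral_ofReal (integrable_finsetSum _ fun a _ => hsqint i a)
      (Eventually.of_forall fun ω => Finset.sum_nonneg fun a _ => sq_nonneg _),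
      ENNReal.ofReal_le_ofReal_iff hB, integral_finsetSum _ fun a _ => hsqint i a] at h1
    exact h1
  have e1 : ∀ ω, ∑ a, (∑ i, 1 / (n : ℝ) * ξ i a ω) ^ 2 =
      ∑ a, (1 / (n : ℝ)) ^ 2 * (∑ i, ξ i a ω) ^ 2 := fun ω =>
    Finset.sum_congr rfl fun a _ => by rw [← Finset.mul_sum, mul_pow]
  simp only [e1]
  have hint : ∀ a, Integrable (fun ω => (1 / (n : ℝ)) ^ 2 * (∑ i, ξ i a ω) ^ 2) (P n) := fun a =>
    (hS2 a).integrable_sq.const_mul _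
  rw [← ofReal_integral_eq_lintegral_ofReal (integrable_finsetSum _ fun a _ => hint a)
    (Eventually.of_forall fun ω => Finset.sum_nonneg fun a _ => by positivity),
    integral_finsetSum _ fun a _ => hint a]
  apply ENNReal.ofReal_le_ofReal
  simp only [integral_const_mul, hvar]
  calc ∑ a, (1 / (n : ℝ)) ^ 2 * ∑ i, ∫ ω, ξ i a ω ^ 2 ∂P n
      = (1 / (n : ℝ)) ^ 2 * ∑ i, ∑ a, ∫ ω, ξ i a ω ^ 2 ∂P n := by
        rw [← Finset.mul_sum, Finset.sum_comm]
    _ ≤ (1 / (n : ℝ)) ^ 2 * ∑ i : Fin n, B := by gcongr with i _; exact hb i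
    _ = B / n := by simp; field_simp

/-- Each weight is `(w_i - 1/n) + 1/n`. The first part is sampling noise of order `B/r`; the second
is an average over the full data, of order `B/n`, and `r ≤ n` because each `π_i ≤ 1`. -/
theorem IsModel.weighted_sum_isBigOP (hD : D.IsModel P) (h7 : D.C7 P) {α : ℕ → Type*}
    [∀ n, Fintype (α n)] {ξ : ∀ n, Fin n → α n → Ω n → ℝ}
    (hξ : ∀ n i a, Measurable[D.sigmaXY n i] (ξ n i a)) {B : ℕ → ℝ} (hB : ∀ n, 0 ≤ B n)
    (hL2 : ∀ᶠ n in atTop, ∀ i a, MemLp (ξ n i a) 2 (P n) ∧ ∫ ω, ξ n i a ω ∂P n = 0)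
    (hbound : ∀ᶠ n in atTop, ∀ i,
      ∫⁻ ω, ENNReal.ofReal (∑ a, ξ n i a ω ^ 2) ∂P n ≤ ENNReal.ofReal (B n)) :
    IsBigOP P (fun n ω => ∑ a, (∑ i, weight (D.π n ω) (D.δ n ω) i * ξ n i a ω) ^ 2)
      (fun n => B n / D.r n) := by
  have h1 := hD.sampling_fluctuation_isBigOP h7
    (fun n i a => (hξ n i a).mono (D.sigmaXY_le_sigmaData n i) le_rfl) hB hbound
  have h2 : IsBigOP P (fun n ω => ∑ a, (∑ i, 1 / (n : ℝ) * ξ n i a ω) ^ 2)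
      (fun n => B n / D.r n) := by
    intro ε hε
    refine ⟨1 / ε, by positivity, ?_⟩
    filter_upwards [hL2, hbound, eventually_gt_atTop 0] with n hL2 hb hn
    have hr := hD.r_pos hn
    have hBn := hB n
    have hint := hD.lintegral_sum_sq_le hn (hξ n) (fun i a => (hL2 i a).1) (fun i a => (hL2 i a).2)
      hBn hb
    have hint2 := hint.trans (ENNReal.ofReal_le_ofReal
      (div_le_div_of_nonneg_left hBn hr (hD.r_le n)))
    have hmeas : Measurable fun ω => ENNReal.ofReal (∑ a, (∑ i, 1 / (n : ℝ) * ξ n i a ω) ^ 2) :=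
      (Finset.measurable_sum _ fun a _ => (Finset.measurable_sum _ fun i _ =>
        ((hξ n i a).mono ((D.sigmaXY_le_sigmaData n i).trans (hD.sigmaData_le n))
          le_rfl).const_mul _).pow_const 2).ennreal_ofReal
    refine le_trans (measure_mono fun ω hω => ?_) (measure_lt_le_of_lintegral_le
      hmeas.aemeasurable (by positivity) hε hint2)
    simp only [Set.mem_ofPred_eq] at hω ⊢
    rw [abs_of_nonneg (Finset.sum_nonneg fun a _ => sq_nonneg _)] at hω
    rw [ENNReal.ofReal_lt_ofReal_iff_of_nonneg (by positivity)]
    refine lt_of_eq_of_lt ?_ hω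
    field_simp
  refine (h1.add h2).of_le (C := 2) two_pos (withProbTendstoOne_of_ae
    (Eventually.of_forall fun n => Eventually.of_forall fun ω => ?_))
  rw [abs_of_nonneg (Finset.sum_nonneg fun a _ => sq_nonneg _), abs_of_nonneg (add_nonneg
    (Finset.sum_nonneg fun a _ => sq_nonneg _) (Finset.sum_nonneg fun a _ => sq_nonneg _)),
    ← Finset.sum_add_distrib, Finset.mul_sum]
  refine Finset.sum_le_sum fun a _ => ?_
  have : ∑ i, weight (D.π n ω) (D.δ n ω) i * ξ n i a ω =
      ∑ i, (weight (D.π n ω) (D.δ n ω) i - 1 / n) * ξ n i a ω + ∑ i, 1 / (n : ℝ) * ξ n i a ω := by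
    rw [← Finset.sum_add_distrib]
    exact Finset.sum_congr rfl fun i _ => by ring
  rw [this]
  exact add_sq_le

/-- Weighted sums of `ψ(X_i) ζ_i` with `E(ζ_i | X_i) = 0` over the Poisson subsample. -/
theorem IsModel.weighted_sum_mul_isBigOP (hD : D.IsModel P) (h7 : D.C7 P) {α : ℕ → Type*}
    [∀ n, Fintype (α n)] {ψ : ∀ n, Fin n → α n → Ω n → ℝ} {ζ : ∀ n, Fin n → Ω n → ℝ}
    (hψ : ∀ n i a, Measurable[D.sigmaX n i] (ψ n i a))
    (hζ : ∀ n i, Measurable[D.sigmaXY n i] (ζ n i)) {V : ℝ} (hV : 0 ≤ V) {B : ℕ → ℝ}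
    (hB : ∀ n, 0 ≤ B n)
    (hL2 : ∀ᶠ n in atTop, ∀ i, MemLp (ζ n i) 2 (P n) ∧ (P n)[ζ n i | D.sigmaX n i] =ᵐ[P n] 0 ∧
      ∫ ω, ζ n i ω ^ 2 ∂P n ≤ V)
    (hbound : ∀ᶠ n in atTop, ∀ᵐ ω ∂P n, ∀ i, ∑ a, ψ n i a ω ^ 2 ≤ B n) :
    IsBigOP P (fun n ω => ∑ a, (∑ i, weight (D.π n ω) (D.δ n ω) i * (ψ n i a ω * ζ n i ω)) ^ 2)
      (fun n => V * B n / D.r n) := by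
  have hψb : ∀ n i a ω, ∑ a, ψ n i a ω ^ 2 ≤ B n → ‖ψ n i a ω‖ ≤ √(B n) := by
    intro n i a ω h
    rw [Real.norm_eq_abs]
    exact Real.abs_le_sqrt ((Finset.single_le_sum (f := fun a => ψ n i a ω ^ 2)
      (fun a _ => sq_nonneg _) (Finset.mem_univ a)).trans h)
  refine hD.weighted_sum_isBigOP h7 (ξ := fun n i a ω => ψ n i a ω * ζ n i ω)
    (fun n i a => ((hψ n i a).mono (D.sigmaX_le_sigmaXY n i) le_rfl).mul (hζ n i))
    (B := fun n => V * B n) (fun n => mul_nonneg hV (hB n)) ?_ ?_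
  · filter_upwards [hL2, hbound] with n hL2 hb i a
    have hle := hD.sigmaX_le n i
    obtain ⟨h1, h2, -⟩ := hL2 i
    have hbd : ∀ᵐ ω ∂P n, ‖ψ n i a ω‖ ≤ √(B n) := hb.mono fun ω h => hψb n i a ω (h i)
    have hψm := (hψ n i a).mono hle le_rfl
    have hψs : StronglyMeasurable[D.sigmaX n i] (ψ n i a) := (hψ n i a).stronglyMeasurable
    refine ⟨h1.of_le_mul (c := √(B n)) (hψm.aestronglyMeasurable.mul h1.aestronglyMeasurable) ?_, ?_⟩
    · filter_upwards [hbd] with ω hω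
      rw [norm_mul]
      exact mul_le_mul_of_nonneg_right hω (norm_nonneg _)
    have h3 := condExp_stronglyMeasurable_mul_of_bound hle hψs (h1.integrable one_le_two) _ hbd
    rw [← integral_condExp hle]
    have h4 : (P n)[fun ω => ψ n i a ω * ζ n i ω | D.sigmaX n i] =ᵐ[P n] 0 := by
      refine EventuallyEq.trans h3 ?_
      filter_upwards [h2] with ω hω
      simp [hω]
    rw [integral_congr_ae h4]; simp
  · filter_upwards [hL2, hbound] with n hL2 hb i
    obtain ⟨h1, -, h3⟩ := hL2 i
    calc ∫⁻ ω, ENNReal.ofReal (∑ a, (ψ n i a ω * ζ n i ω) ^ 2) ∂P n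
        ≤ ∫⁻ ω, ENNReal.ofReal (B n * ζ n i ω ^ 2) ∂P n := by
          refine lintegral_mono_ae ?_
          filter_upwards [hb] with ω hω
          apply ENNReal.ofReal_le_ofReal
          simp only [mul_pow]
          rw [← Finset.sum_mul]
          exact mul_le_mul_of_nonneg_right (hω i) (sq_nonneg _)
      _ = ENNReal.ofReal (∫ ω, B n * ζ n i ω ^ 2 ∂P n) :=
          (ofReal_integral_eq_lintegral_ofReal (h1.integrable_sq.const_mul _)
            (Eventually.of_forall fun ω => mul_nonneg (hB n) (sq_nonneg _))).symm
      _ ≤ _ := by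
          apply ENNReal.ofReal_le_ofReal
          rw [integral_const_mul, mul_comm]
          exact mul_le_mul_of_nonneg_right h3 (hB n)

end Arr

/-! ### Deterministic bounds for the working matrix, the Gram form and the score. -/

theorem EigBounds.mono_right {k : ℕ} {M : Matrix (Fin k) (Fin k) ℝ} {a b b' : ℝ}
    (h : EigBounds M a b) (hb : b ≤ b') : EigBounds M a b' := by
  obtain ⟨hM, hd⟩ := h
  exact ⟨hM, fun i => ⟨(hd i).1, (hd i).2.trans hb⟩⟩

theorem frobNorm_nonneg {k : ℕ} (M : Matrix (Fin k) (Fin k) ℝ) : 0 ≤ frobNorm M :=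
  Real.sqrt_nonneg _

theorem abs_entry_le_frobNorm {k : ℕ} (M : Matrix (Fin k) (Fin k) ℝ) (j l : Fin k) :
    |M j l| ≤ frobNorm M := by
  apply Real.abs_le_sqrt
  exact (Finset.single_le_sum (f := fun l => M j l ^ 2) (fun _ _ => sq_nonneg _)
    (Finset.mem_univ l)).trans (Finset.single_le_sum (f := fun j => ∑ l, M j l ^ 2)
    (fun _ _ => Finset.sum_nonneg fun _ _ => sq_nonneg _) (Finset.mem_univ j))

theorem abs_quadForm_le_frobNorm {k : ℕ} (M : Matrix (Fin k) (Fin k) ℝ) (z : Fin k → ℝ) :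
    |z ⬝ᵥ M *ᵥ z| ≤ frobNorm M * ∑ j, z j ^ 2 := by
  have hsq : frobNorm M ^ 2 = ∑ j, ∑ l, M j l ^ 2 :=
    Real.sq_sqrt (Finset.sum_nonneg fun _ _ => Finset.sum_nonneg fun _ _ => sq_nonneg _)
  have h := abs_bilin_le (p := k) (T := fun a : Fin k × Fin k => M a.1 a.2) (frobNorm_nonneg M)
    (by rw [hsq, Fintype.sum_prod_type]) (WithLp.toLp 2 z) (WithLp.toLp 2 z)
  rw [← sq, EuclideanSpace.real_norm_sq_eq] at h
  convert h using 2
  simp only [dotProduct, mulVec, Fintype.sum_prod_type, Finset.mul_sum]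
  exact Finset.sum_congr rfl fun i _ => Finset.sum_congr rfl fun j _ => by ring

/-- The inverse of the working correlation matrix inherits bounds from its limit. -/
theorem inv_bounds_of_frobNorm_le {k : ℕ} {R S : Matrix (Fin k) (Fin k) ℝ} {a b τ : ℝ} (ha : 0 < a)
    (h : EigBounds S a b) (hτ : frobNorm (R⁻¹ - S⁻¹) ≤ τ) :
    (∀ j l, |R⁻¹ j l| ≤ a⁻¹ + τ) ∧
      ∀ z : Fin k → ℝ, (b⁻¹ - τ) * ∑ j, z j ^ 2 ≤ z ⬝ᵥ R⁻¹ *ᵥ z := by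
  have hR : R⁻¹ = S⁻¹ + (R⁻¹ - S⁻¹) := by abel
  constructor
  · intro j l
    rw [hR, Matrix.add_apply]
    exact (abs_add_le _ _).trans (add_le_add (abs_entry_inv_le ha h j l)
      ((abs_entry_le_frobNorm _ j l).trans hτ))
  · intro z
    rw [hR, add_mulVec, dotProduct_add]
    have h1 := (h.inv_quadForm ha z).1
    have h2 := (abs_le.mp (abs_quadForm_le_frobNorm (R⁻¹ - S⁻¹) z)).1
    have h3 : frobNorm (R⁻¹ - S⁻¹) * ∑ j, z j ^ 2 ≤ τ * ∑ j, z j ^ 2 :=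
      mul_le_mul_of_nonneg_right hτ (Finset.sum_nonneg fun _ _ => sq_nonneg _)
    linarith

theorem dotProduct_gram {m p n : ℕ} (X : Fin n → Matrix (Fin m) (Fin p) ℝ)
    (v : EuclideanSpace ℝ (Fin p)) :
    v.ofLp ⬝ᵥ ((1 / (n : ℝ)) • ∑ i, (X i)ᵀ * X i) *ᵥ v.ofLp =
      ∑ i, 1 / (n : ℝ) * ∑ j, eta (X i) v j ^ 2 := by
  rw [smul_mulVec, dotProduct_smul, sum_mulVec, dotProduct_sum, smul_eq_mul, Finset.mul_sum]
  refine Finset.sum_congr rfl fun i _ => ?_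
  rw [← mulVec_mulVec, dotProduct_mulVec, vecMul_transpose]
  simp only [dotProduct, eta, sq]

/-- Bounds on the weighted Gram form from bounds on the unweighted one. -/
theorem weighted_gram_bounds {m p n : ℕ} {X : Fin n → Matrix (Fin m) (Fin p) ℝ} {W : Fin n → ℝ}
    {b₁ b₂ τ : ℝ} (hτ : 0 ≤ τ) (h : EigBounds ((1 / (n : ℝ)) • ∑ i, (X i)ᵀ * X i) b₁ b₂)
    (hT : ∑ a : Fin p × Fin p, (∑ i, (W i - 1 / n) * ∑ j, X i j a.1 * X i j a.2) ^ 2 ≤ τ ^ 2)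
    (v : EuclideanSpace ℝ (Fin p)) :
    (b₁ - τ) * ‖v‖ ^ 2 ≤ ∑ i, W i * ∑ j, eta (X i) v j ^ 2 ∧
      ∑ i, W i * ∑ j, eta (X i) v j ^ 2 ≤ (b₂ + τ) * ‖v‖ ^ 2 := by
  have h1 := h.quadForm v.ofLp
  rw [dotProduct_gram, ← EuclideanSpace.real_norm_sq_eq] at h1
  have h2 := abs_le.mp (abs_bilin_le hτ hT v v)
  have h3 : ∑ a : Fin p × Fin p, (∑ i, (W i - 1 / n) * ∑ j, X i j a.1 * X i j a.2) *
      (v a.1 * v a.2) = ∑ i, (W i - 1 / n) * ∑ j, eta (X i) v j ^ 2 := by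
    calc _ = ∑ j, ∑ a : Fin p × Fin p, (∑ i, (W i - 1 / n) * (X i j a.1 * X i j a.2)) *
          (v a.1 * v a.2) := by
          rw [Finset.sum_comm]
          refine Finset.sum_congr rfl fun a _ => ?_
          rw [← Finset.sum_mul, Finset.sum_comm]
          simp only [Finset.mul_sum]
      _ = ∑ j, ∑ i, (W i - 1 / n) * (eta (X i) v j * eta (X i) v j) := by
          simp only [← sum_mul_eta_mul_eta]
      _ = _ := by
          rw [Finset.sum_comm]
          simp only [Finset.mul_sum, sq]
  rw [h3] at h2
  have h4 : ∑ i, W i * ∑ j, eta (X i) v j ^ 2 = ∑ i, 1 / (n : ℝ) * ∑ j, eta (X i) v j ^ 2 +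
      ∑ i, (W i - 1 / n) * ∑ j, eta (X i) v j ^ 2 := by
    rw [← Finset.sum_add_distrib]
    exact Finset.sum_congr rfl fun i _ => by ring
  rw [h4]
  constructor <;> linarith [h1.1, h1.2, h2.1, h2.2]

/-- The norm of the estimating function in terms of its entrywise sums. -/
theorem norm_score_le {m p n : ℕ} (g : ℝ → ℝ)
    (X : Fin n → Matrix (Fin m) (Fin p) ℝ) (Y : Fin n → Fin m → ℝ) (π : Fin n → ℝ)
    (δ : Fin n → Bool) (R : Matrix (Fin m) (Fin m) ℝ) (β : EuclideanSpace ℝ (Fin p)) {C : ℝ}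
    (hR : ∀ j k, |R⁻¹ j k| ≤ C) :
    ‖(WithLp.toLp 2 (score g X Y π δ R β) : EuclideanSpace ℝ (Fin p))‖ ≤
      C * ∑ j, ∑ k, √(∑ l, (∑ i, weight π δ i *
        (X i j l * (√(deriv g (eta (X i) β j)) * (√(deriv g (eta (X i) β k)))⁻¹) *
          (Y i k - g (eta (X i) β k)))) ^ 2) := by
  -- The score is paired with itself, and one factor `‖s‖` is cancelled at the end.
  set s : EuclideanSpace ℝ (Fin p) := WithLp.toLp 2 (score g X Y π δ R β) with hs
  have h1 : ‖s‖ ^ 2 = ∑ j, ∑ k, R⁻¹ j k * ∑ i, weight π δ i *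
      (eta (X i) s j * scoreEntry g (Y i k) (eta (X i) β j) (eta (X i) β k)) := by
    rw [← dotProduct_score, EuclideanSpace.real_norm_sq_eq]
    simp only [dotProduct, sq, hs]
  set Q : Fin m → Fin m → ℝ := fun j k => √(∑ l, (∑ i, weight π δ i *
        (X i j l * (√(deriv g (eta (X i) β j)) * (√(deriv g (eta (X i) β k)))⁻¹) *
          (Y i k - g (eta (X i) β k)))) ^ 2) with hQ
  have h2 : ∀ j k, |∑ i, weight π δ i *
      (eta (X i) s j * scoreEntry g (Y i k) (eta (X i) β j) (eta (X i) β k))| ≤ Q j k * ‖s‖ := by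
    intro j k
    have e : ∑ i, weight π δ i *
        (eta (X i) s j * scoreEntry g (Y i k) (eta (X i) β j) (eta (X i) β k)) =
        ∑ l, (∑ i, weight π δ i *
        (X i j l * (√(deriv g (eta (X i) β j)) * (√(deriv g (eta (X i) β k)))⁻¹) *
          (Y i k - g (eta (X i) β k)))) * s l := by
      simp only [eta, mulVec, dotProduct, scoreEntry, Finset.sum_mul, Finset.mul_sum]
      rw [Finset.sum_comm]
      exact Finset.sum_congr rfl fun l _ => Finset.sum_congr rfl fun i _ => by ring
    rw [e]
    have h3 := Finset.sum_mul_sq_le_sq_mul_sq Finset.univ (fun l => ∑ i, weight π δ i *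
        (X i j l * (√(deriv g (eta (X i) β j)) * (√(deriv g (eta (X i) β k)))⁻¹) *
          (Y i k - g (eta (X i) β k)))) (fun l => s l)
    rw [← EuclideanSpace.real_norm_sq_eq] at h3
    refine abs_le_of_sq_le_sq ?_ (mul_nonneg (Real.sqrt_nonneg _) (norm_nonneg _))
    rw [mul_pow, hQ, Real.sq_sqrt (Finset.sum_nonneg fun _ _ => sq_nonneg _)]
    exact h3
  have h3 : ‖s‖ ^ 2 ≤ (C * ∑ j, ∑ k, Q j k) * ‖s‖ := by
    rw [h1, Finset.mul_sum, Finset.sum_mul]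
    refine Finset.sum_le_sum fun j _ => ?_
    rw [Finset.mul_sum, Finset.sum_mul]
    refine Finset.sum_le_sum fun k _ => ?_
    refine (le_abs_self _).trans ((abs_mul_le (hR j k) (h2 j k)).trans (le_of_eq (by ring)))
  rcases (norm_nonneg s).eq_or_lt with h0 | h0
  · rw [← h0]
    have hC : ∀ j : Fin m, 0 ≤ C := fun j => (abs_nonneg _).trans (hR j j)
    rw [Finset.mul_sum]
    refine Finset.sum_nonneg fun j _ => mul_nonneg (hC j)
      (Finset.sum_nonneg fun k _ => Real.sqrt_nonneg _)
  · rw [sq] at h3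
    exact le_of_mul_le_mul_right h3 h0

/-! ### Moments of the residuals and stochastic bounds near the true parameter. -/

namespace Arr

variable {m : ℕ} {Ω : ℕ → Type*}

/-- The residual `Y_ik - μ_ik(β₀)`. -/
def err (D : Arr m Ω) (n : ℕ) (i : Fin n) (k : Fin m) (ω : Ω n) : ℝ :=
  D.Y n ω i k - D.g (eta (D.X n ω i) (D.β₀ n) k)

theorem measurable_comp_eta (D : Arr m Ω) (n : ℕ) (i : Fin n) (k : Fin m) {f : ℝ → ℝ}
    (hf : Measurable f) : Measurable[D.sigmaX n i] fun ω => f (eta (D.X n ω i) (D.β₀ n) k) :=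
  hf.comp (D.measurable_eta n i (D.β₀ n) k)

variable [∀ n, MeasurableSpace (Ω n)] {D : Arr m Ω} {P : ∀ n, Measure (Ω n)}

/-- `|Y_ik - μ_ik(β₀)|`, centred by its conditional expectation given the covariates. -/
def absErrCentered (D : Arr m Ω) (P : ∀ n, Measure (Ω n)) (n : ℕ) (i : Fin n) (k : Fin m)
    (ω : Ω n) : ℝ :=
  |D.err n i k ω| - ((P n)[fun ω => |D.err n i k ω| | D.sigmaX n i]) ω

theorem IsModel.measurable_err (hD : D.IsModel P) (n : ℕ) (i : Fin n) (k : Fin m) :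
    Measurable[D.sigmaXY n i] (D.err n i k) :=
  (D.measurable_Y n i k).sub ((D.measurable_comp_eta n i k hD.meas_g).mono
    (D.sigmaX_le_sigmaXY n i) le_rfl)

theorem IsModel.measurable_absErrCentered (hD : D.IsModel P) (n : ℕ) (i : Fin n) (k : Fin m) :
    Measurable[D.sigmaXY n i] (D.absErrCentered P n i k) := by
  refine Measurable.sub ?_ (stronglyMeasurable_condExp.measurable.mono
    (D.sigmaX_le_sigmaXY n i) le_rfl)
  exact measurable_abs.comp (hD.measurable_err n i k)

theorem IsModel.memLp_err (hD : D.IsModel P) (n : ℕ) (i : Fin n) (k : Fin m) :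
    MemLp (D.err n i k) 2 (P n) := hD.memLp_resid n i k

theorem IsModel.condExp_err_sq (hD : D.IsModel P) {n : ℕ} {c C M : ℝ} (hc : 0 < c)
    (hreg : ∀ᵐ ω ∂P n, ∀ i j, RegularAt D.g c C M (eta (D.X n ω i) (D.β₀ n) j)) (i : Fin n)
    (k : Fin m) : ∀ᵐ ω ∂P n, ((P n)[fun ω => D.err n i k ω ^ 2 | D.sigmaX n i]) ω ≤ D.φ * |C| := by
  have h1 := hD.cov n i k k
  have h2 : (fun ω => (D.Y n ω i k - mu D.g (D.X n ω i) (D.β₀ n) k) *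
      (D.Y n ω i k - mu D.g (D.X n ω i) (D.β₀ n) k)) = fun ω => D.err n i k ω ^ 2 := by
    ext ω; rw [sq]; rfl
  rw [h2] at h1
  filter_upwards [h1, hreg] with ω h1 hreg
  rw [h1]
  have h3 := hreg i k
  simp only [Matrix.smul_apply, sqrtA, mul_diagonal, diagonal_mul, hD.R₀_diag, smul_eq_mul, mul_one]
  rw [Real.mul_self_sqrt (hc.trans_le h3.2.1).le]
  exact mul_le_mul_of_nonneg_left (h3.2.2.1.trans (le_abs_self _)) hD.φ_pos.le

theorem C1.exists_sum_sq_le (h1 : D.C1 P) : ∃ K : ℝ, 0 ≤ K ∧ ∀ᶠ n in atTop, ∀ᵐ ω ∂P n, ∀ i j,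
    ‖(WithLp.toLp 2 (D.X n ω i j) : EuclideanSpace ℝ (Fin (D.p n)))‖ ≤ K * √(D.p n) ∧
    ∑ l, D.X n ω i j l ^ 2 ≤ K ^ 2 * D.p n := by
  obtain ⟨K, hK⟩ := h1
  refine ⟨|K|, abs_nonneg K, ?_⟩
  filter_upwards [hK] with n hK
  filter_upwards [hK] with ω hK i j
  have h2 : ‖(WithLp.toLp 2 (D.X n ω i j) : EuclideanSpace ℝ (Fin (D.p n)))‖ ≤ |K| * √(D.p n) :=
    (hK i j).trans (mul_le_mul_of_nonneg_right (le_abs_self K) (Real.sqrt_nonneg _))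
  refine ⟨h2, ?_⟩
  have h3 := pow_le_pow_left₀ (norm_nonneg _) h2 2
  rw [EuclideanSpace.real_norm_sq_eq, mul_pow, Real.sq_sqrt (Nat.cast_nonneg _)] at h3
  exact h3

theorem sum_mul_sq_prod {p : ℕ} (x y : Fin p → ℝ) :
    ∑ a : Fin p × Fin p, (x a.1 * y a.2) ^ 2 = (∑ l, x l ^ 2) * ∑ l, y l ^ 2 := by
  rw [Finset.sum_mul_sum, Fintype.sum_prod_type]
  simp only [mul_pow]

theorem C6.exists_regular (h2 : D.C2) (h6 : D.C6 P) : ∃ c C M : ℝ, 0 < c ∧ ∀ᶠ n in atTop,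
    (∀ᵐ ω ∂P n, ∀ i j, ∀ β ∈ D.B n, RegularAt D.g c C M (eta (D.X n ω i) β j)) ∧
    ∀ᵐ ω ∂P n, ∀ i j, RegularAt D.g c C M (eta (D.X n ω i) (D.β₀ n) j) := by
  obtain ⟨c, C, M, hc, -, h⟩ := h6
  refine ⟨c, C, M, hc, ?_⟩
  filter_upwards [h] with n h
  exact ⟨h, h.mono fun ω hω i j => hω i j _ (h2.2.1 n)⟩

variable [∀ n, IsProbabilityMeasure (P n)]

theorem IsModel.condExp_err (hD : D.IsModel P) (n : ℕ) (i : Fin n) (k : Fin m) :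
    (P n)[D.err n i k | D.sigmaX n i] =ᵐ[P n] 0 := by
  have hle := hD.sigmaX_le n i
  have hY := hD.int_Y n i k
  have hmu : Integrable (fun ω => D.g (eta (D.X n ω i) (D.β₀ n) k)) (P n) := by
    have := hY.sub ((hD.memLp_err n i k).integrable one_le_two)
    refine this.congr (Eventually.of_forall fun ω => ?_)
    simp [err]
  have h1 : (P n)[D.err n i k | D.sigmaX n i] =ᵐ[P n] _ := condExp_sub hY hmu (D.sigmaX n i)
  have h2 : (P n)[fun ω => D.g (eta (D.X n ω i) (D.β₀ n) k) | D.sigmaX n i] =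
      fun ω => D.g (eta (D.X n ω i) (D.β₀ n) k) :=
    condExp_of_stronglyMeasurable hle
      (D.measurable_comp_eta n i k hD.meas_g).stronglyMeasurable hmu
  filter_upwards [h1, hD.mean n i k] with ω h1 h3
  rw [h1, Pi.sub_apply, h2, h3]
  simp [mu]

theorem IsModel.integral_err_sq_le (hD : D.IsModel P) {n : ℕ} {c C M : ℝ} (hc : 0 < c)
    (hreg : ∀ᵐ ω ∂P n, ∀ i j, RegularAt D.g c C M (eta (D.X n ω i) (D.β₀ n) j)) (i : Fin n)
    (k : Fin m) : ∫ ω, D.err n i k ω ^ 2 ∂P n ≤ D.φ * |C| := by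
  rw [← integral_condExp (hD.sigmaX_le n i)]
  calc _ ≤ ∫ ω, D.φ * |C| ∂P n := integral_mono_ae integrable_condExp (integrable_const _)
        (hD.condExp_err_sq hc hreg i k)
    _ = _ := by simp

/-- `|e| ≤ 1 + e²`, and the conditional second moment of the residual is `φ g' ≤ φ|C|`. -/
theorem IsModel.condExp_abs_err_le (hD : D.IsModel P) {n : ℕ} {c C M : ℝ} (hc : 0 < c)
    (hreg : ∀ᵐ ω ∂P n, ∀ i j, RegularAt D.g c C M (eta (D.X n ω i) (D.β₀ n) j)) (i : Fin n)
    (k : Fin m) : ∀ᵐ ω ∂P n, 0 ≤ ((P n)[fun ω => |D.err n i k ω| | D.sigmaX n i]) ω ∧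
      ((P n)[fun ω => |D.err n i k ω| | D.sigmaX n i]) ω ≤ 1 + D.φ * |C| := by
  have hL := hD.memLp_err n i k
  have habs : Integrable (fun ω => |D.err n i k ω|) (P n) := (hL.integrable one_le_two).abs
  have hsq : Integrable (fun ω => D.err n i k ω ^ 2) (P n) := hL.integrable_sq
  have h0 : 0 ≤ᵐ[P n] (P n)[fun ω => |D.err n i k ω| | D.sigmaX n i] :=
    condExp_nonneg (Eventually.of_forall fun ω => abs_nonneg _)
  have h1 : (P n)[fun ω => |D.err n i k ω| | D.sigmaX n i] ≤ᵐ[P n]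
      (P n)[(fun _ => (1 : ℝ)) + fun ω => D.err n i k ω ^ 2 | D.sigmaX n i] := by
    refine condExp_mono habs ((integrable_const 1).add hsq) (Eventually.of_forall fun ω => ?_)
    simp only [Pi.add_apply]
    nlinarith [sq_abs (D.err n i k ω), sq_nonneg (|D.err n i k ω| - 1), abs_nonneg (D.err n i k ω)]
  have h2 := condExp_add (integrable_const (1 : ℝ)) hsq (D.sigmaX n i)
  have h3 : (P n)[fun _ => (1 : ℝ) | D.sigmaX n i] = fun _ => 1 :=
    condExp_const (hD.sigmaX_le n i) 1
  filter_upwards [h0, h1, h2, hD.condExp_err_sq hc hreg i k] with ω h0 h1 h2 h4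
  refine ⟨h0, h1.trans ?_⟩
  rw [h2, Pi.add_apply, h3]
  linarith

/-- The Taylor remainder involves `|e|`, which is not centred. Subtracting its conditional mean puts
it in the scope of the bounds for conditionally centred sums; the constant comes from `(|e| - f)² ≤
2e² + 2f²`. -/
theorem IsModel.absErrCentered_moments (hD : D.IsModel P) {n : ℕ} {c C M : ℝ} (hc : 0 < c)
    (hreg : ∀ᵐ ω ∂P n, ∀ i j, RegularAt D.g c C M (eta (D.X n ω i) (D.β₀ n) j)) (i : Fin n)
    (k : Fin m) : MemLp (D.absErrCentered P n i k) 2 (P n) ∧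
      (P n)[D.absErrCentered P n i k | D.sigmaX n i] =ᵐ[P n] 0 ∧
      ∫ ω, D.absErrCentered P n i k ω ^ 2 ∂P n ≤
        2 * (D.φ * |C|) + 2 * (1 + D.φ * |C|) ^ 2 := by
  have hL := hD.memLp_err n i k
  have hle := hD.sigmaX_le n i
  have hbd := hD.condExp_abs_err_le hc hreg i k
  set f := (P n)[fun ω => |D.err n i k ω| | D.sigmaX n i] with hf
  have hfL : MemLp f 2 (P n) := by
    refine MemLp.of_bound (stronglyMeasurable_condExp.mono hle).aestronglyMeasurable
      (1 + D.φ * |C|) ?_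
    filter_upwards [hbd] with ω h
    rw [Real.norm_of_nonneg h.1]; exact h.2
  have hA : MemLp (fun ω => |D.err n i k ω|) 2 (P n) := hL.abs
  have hsub : MemLp (D.absErrCentered P n i k) 2 (P n) := hA.sub hfL
  refine ⟨hsub, ?_, ?_⟩
  · have h1 : (P n)[D.absErrCentered P n i k | D.sigmaX n i] =ᵐ[P n] _ :=
      condExp_sub (hA.integrable one_le_two) integrable_condExp (D.sigmaX n i)
    have h2 : (P n)[f | D.sigmaX n i] = f :=
      condExp_of_stronglyMeasurable hle stronglyMeasurable_condExp integrable_condExp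
    filter_upwards [h1] with ω h1
    rw [h1, Pi.sub_apply, ← hf, h2]
    simp
  · calc ∫ ω, D.absErrCentered P n i k ω ^ 2 ∂P n
        ≤ ∫ ω, (2 * D.err n i k ω ^ 2 + 2 * (1 + D.φ * |C|) ^ 2) ∂P n := by
          refine integral_mono_ae hsub.integrable_sq
            ((hL.integrable_sq.const_mul 2).add (integrable_const _)) ?_
          filter_upwards [hbd] with ω h
          have e : D.absErrCentered P n i k ω = |D.err n i k ω| - f ω := rfl
          rw [e]
          have h5 : f ω ^ 2 ≤ (1 + D.φ * |C|) ^ 2 := pow_le_pow_left₀ h.1 h.2 2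
          nlinarith [sq_abs (D.err n i k ω), sq_nonneg (|D.err n i k ω| + f ω)]
      _ = 2 * ∫ ω, D.err n i k ω ^ 2 ∂P n + 2 * (1 + D.φ * |C|) ^ 2 := by
          rw [integral_add (hL.integrable_sq.const_mul 2) (integrable_const _), integral_const_mul]
          simp
      _ ≤ _ := by
          have := hD.integral_err_sq_le hc hreg i k
          linarith

/-- Centred weighted sums of the matrices `x_ij x_ikᵀ` are negligible. -/
theorem IsModel.matrix_sum_small (hD : D.IsModel P) (h1 : D.C1 P) (h7 : D.C7 P)
    (hp : Tendsto (fun n => (D.p n : ℝ) ^ 2 / D.r n) atTop (𝓝 0)) (j k : Fin m)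
    {q ζ : ∀ n, Fin n → Ω n → ℝ} (hq : ∀ n i, Measurable[D.sigmaX n i] (q n i))
    (hζ : ∀ n i, Measurable[D.sigmaXY n i] (ζ n i)) {Q V : ℝ} (hV : 0 ≤ V)
    (hL2 : ∀ᶠ n in atTop, ∀ i, MemLp (ζ n i) 2 (P n) ∧ (P n)[ζ n i | D.sigmaX n i] =ᵐ[P n] 0 ∧
      ∫ ω, ζ n i ω ^ 2 ∂P n ≤ V)
    (hQ : ∀ᶠ n in atTop, ∀ᵐ ω ∂P n, ∀ i, |q n i ω| ≤ Q) {η : ℝ} (hη : 0 < η) :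
    WithProbTendstoOne P fun n ω => ∑ a : Fin (D.p n) × Fin (D.p n),
      (∑ i, weight (D.π n ω) (D.δ n ω) i * (q n i ω * ζ n i ω) *
        (D.X n ω i j a.1 * D.X n ω i k a.2)) ^ 2 ≤ η ^ 2 := by
  obtain ⟨K, hK0, hK⟩ := h1.exists_sum_sq_le
  have key := hD.weighted_sum_mul_isBigOP h7 (α := fun n => Fin (D.p n) × Fin (D.p n))
    (ψ := fun n i a ω => q n i ω * (D.X n ω i j a.1 * D.X n ω i k a.2)) (ζ := ζ)
    (fun n i a => (hq n i).mul ((D.measurable_X n i j a.1).mul (D.measurable_X n i k a.2))) hζ hV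
    -- The squared Frobenius norm of `x_ij x_ikᵀ` is `‖x_ij‖²‖x_ik‖² ≤ K⁴p²`. This is where the
    -- condition `p²/r → 0` enters.
    (B := fun n => Q ^ 2 * K ^ 4 * (D.p n : ℝ) ^ 2) (fun n => by positivity) hL2 (by
      filter_upwards [hK, hQ] with n hK hQ
      filter_upwards [hK, hQ] with ω hK hQ i
      have e : ∑ a : Fin (D.p n) × Fin (D.p n),
          (q n i ω * (D.X n ω i j a.1 * D.X n ω i k a.2)) ^ 2 =
          q n i ω ^ 2 * ((∑ l, D.X n ω i j l ^ 2) * ∑ l, D.X n ω i k l ^ 2) := by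
        rw [← sum_mul_sq_prod, Finset.mul_sum]
        simp only [mul_pow]
      rw [e]
      have h3 : q n i ω ^ 2 ≤ Q ^ 2 := by
        rw [← sq_abs]; exact pow_le_pow_left₀ (abs_nonneg _) (hQ i) 2
      calc _ ≤ Q ^ 2 * ((K ^ 2 * D.p n) * (K ^ 2 * D.p n)) :=
            mul_le_mul h3 (mul_le_mul (hK i j).2 (hK i k).2
              (Finset.sum_nonneg fun _ _ => sq_nonneg _) (by positivity))
              (mul_nonneg (Finset.sum_nonneg fun _ _ => sq_nonneg _)
                (Finset.sum_nonneg fun _ _ => sq_nonneg _)) (sq_nonneg _)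
        _ = _ := by ring)
  have hlim : Tendsto (fun n => V * (Q ^ 2 * K ^ 4 * (D.p n : ℝ) ^ 2) / D.r n) atTop (𝓝 0) := by
    have := hp.const_mul (V * (Q ^ 2 * K ^ 4))
    rw [mul_zero] at this
    refine this.congr fun n => by ring
  refine (key.eventually_le hlim (η := η ^ 2) (by positivity)).mono
    (Eventually.of_forall fun n => Eventually.of_forall fun ω h => ?_)
  refine le_trans (le_of_eq ?_) ((le_abs_self _).trans h)
  refine Finset.sum_congr rfl fun a _ => ?_
  congr 1
  exact Finset.sum_congr rfl fun i _ => by ring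

/-- The subsampled Gram matrix concentrates about the full one. -/
theorem IsModel.gram_fluctuation_small (hD : D.IsModel P) (h1 : D.C1 P) (h7 : D.C7 P)
    (hp : Tendsto (fun n => (D.p n : ℝ) ^ 2 / D.r n) atTop (𝓝 0)) {η : ℝ} (hη : 0 < η) :
    WithProbTendstoOne P fun n ω => ∑ a : Fin (D.p n) × Fin (D.p n),
      (∑ i, (weight (D.π n ω) (D.δ n ω) i - 1 / n) *
        ∑ j, D.X n ω i j a.1 * D.X n ω i j a.2) ^ 2 ≤ η ^ 2 := by
  obtain ⟨K, hK0, hK⟩ := h1.exists_sum_sq_le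
  have key := hD.sampling_fluctuation_isBigOP h7 (α := fun n => Fin (D.p n) × Fin (D.p n))
    (ξ := fun n i a ω => ∑ j, D.X n ω i j a.1 * D.X n ω i j a.2)
    (fun n i a => (Finset.measurable_sum _ fun j _ =>
      (D.measurable_X n i j a.1).mul (D.measurable_X n i j a.2)).mono
      ((D.sigmaX_le_sigmaXY n i).trans (D.sigmaXY_le_sigmaData n i)) le_rfl)
    (B := fun n => (m : ℝ) ^ 2 * K ^ 4 * (D.p n : ℝ) ^ 2) (fun n => by positivity) (by
      filter_upwards [hK] with n hK i
      calc _ ≤ ∫⁻ ω, ENNReal.ofReal ((m : ℝ) ^ 2 * K ^ 4 * (D.p n : ℝ) ^ 2) ∂P n := by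
            refine lintegral_mono_ae ?_
            filter_upwards [hK] with ω hK
            apply ENNReal.ofReal_le_ofReal
            calc ∑ a : Fin (D.p n) × Fin (D.p n), (∑ j, D.X n ω i j a.1 * D.X n ω i j a.2) ^ 2
                ≤ ∑ a : Fin (D.p n) × Fin (D.p n), (m : ℝ) *
                    ∑ j, (D.X n ω i j a.1 * D.X n ω i j a.2) ^ 2 := by
                  refine Finset.sum_le_sum fun a _ => ?_
                  have := sq_sum_le_card_mul_sum_sq (s := Finset.univ)
                    (f := fun j => D.X n ω i j a.1 * D.X n ω i j a.2)
                  simpa using this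
              _ = (m : ℝ) * ∑ j, (∑ l, D.X n ω i j l ^ 2) * ∑ l, D.X n ω i j l ^ 2 := by
                  rw [← Finset.mul_sum, Finset.sum_comm]
                  simp only [sum_mul_sq_prod]
              _ ≤ (m : ℝ) * ∑ j : Fin m, (K ^ 2 * D.p n) * (K ^ 2 * D.p n) := by
                  refine mul_le_mul_of_nonneg_left (Finset.sum_le_sum fun j _ =>
                    mul_le_mul (hK i j).2 (hK i j).2
                      (Finset.sum_nonneg fun _ _ => sq_nonneg _) (by positivity)) (Nat.cast_nonneg m)
              _ = _ := by simp; ring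
        _ = _ := by simp)
  have hlim : Tendsto (fun n => (m : ℝ) ^ 2 * K ^ 4 * (D.p n : ℝ) ^ 2 / D.r n) atTop (𝓝 0) := by
    have := hp.const_mul ((m : ℝ) ^ 2 * K ^ 4)
    rw [mul_zero] at this
    refine this.congr fun n => by ring
  exact (key.eventually_le hlim (η := η ^ 2) (by positivity)).mono
    (Eventually.of_forall fun n => Eventually.of_forall fun ω h => (le_abs_self _).trans h)

theorem IsModel.eventually_rate_sq_le (hD : D.IsModel P) :
    ∀ᶠ n in atTop, 0 ≤ (D.p n : ℝ) / D.r n ∧ (D.p n : ℝ) / D.r n ≤ (D.p n : ℝ) ^ 2 / D.r n := by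
  filter_upwards [eventually_gt_atTop 0] with n hn
  have hr := hD.r_pos hn
  refine ⟨by positivity, ?_⟩
  gcongr
  have : D.p n ≤ D.p n ^ 2 := Nat.le_self_pow two_ne_zero _
  exact_mod_cast this

theorem IsModel.rate_tendsto (hD : D.IsModel P)
    (hp : Tendsto (fun n => (D.p n : ℝ) ^ 2 / D.r n) atTop (𝓝 0)) :
    Tendsto D.rate atTop (𝓝 0) := by
  have h1 : Tendsto (fun n => (D.p n : ℝ) / D.r n) atTop (𝓝 0) :=
    squeeze_zero' (hD.eventually_rate_sq_le.mono fun n h => h.1)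
      (hD.eventually_rate_sq_le.mono fun n h => h.2) hp
  have := h1.sqrt
  rwa [Real.sqrt_zero] at this

/-- The estimated working correlation matrix is eventually well conditioned. -/
theorem IsModel.Rtilde_bounds (hD : D.IsModel P) (h4 : D.C4 P)
    (hp : Tendsto (fun n => (D.p n : ℝ) ^ 2 / D.r n) atTop (𝓝 0)) :
    ∃ κ₂ C₂ : ℝ, 0 < κ₂ ∧ 0 < C₂ ∧ WithProbTendstoOne P fun n ω =>
      (∀ j k, |(D.Rtilde n ω)⁻¹ j k| ≤ C₂) ∧
      ∀ z : Fin m → ℝ, κ₂ * ∑ j, z j ^ 2 ≤ z ⬝ᵥ (D.Rtilde n ω)⁻¹ *ᵥ z := by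
  obtain ⟨-, ⟨a, b, ha, hab⟩, hR⟩ := h4
  -- The upper eigenvalue bound need not be positive when `m = 0`.
  set b' := max b 1
  have hb' : 0 < b' := lt_max_of_lt_right one_pos
  have hτ : 0 < b'⁻¹ / 2 := by positivity
  refine ⟨b'⁻¹ / 2, a⁻¹ + b'⁻¹ / 2, hτ, by positivity, ?_⟩
  refine (hR.eventually_le (hD.rate_tendsto hp) hτ).mono ?_
  filter_upwards [hab] with n hab
  refine Eventually.of_forall fun ω h => ?_
  have := inv_bounds_of_frobNorm_le ha (hab.mono_right (le_max_left b 1)) ((le_abs_self _).trans h)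
  refine ⟨this.1, fun z => ?_⟩
  have h3 := this.2 z
  have e : b'⁻¹ - b'⁻¹ / 2 = b'⁻¹ / 2 := by ring
  rwa [e] at h3

/-- With probability tending to one, the estimating function is strongly monotone and Lipschitz on
balls of radius `o(1 / √p)` about the true parameter, with fixed constants. -/
theorem IsModel.score_monotone (hD : D.IsModel P) (h1 : D.C1 P) (h2 : D.C2) (h3 : D.C3 P)
    (h4 : D.C4 P) (h6 : D.C6 P) (h7 : D.C7 P)
    (hp : Tendsto (fun n => (D.p n : ℝ) ^ 2 / D.r n) atTop (𝓝 0)) :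
    ∃ κ L : ℝ, 0 < κ ∧ κ ≤ L ∧ ∀ ρ : ℕ → ℝ, (∀ n, 0 ≤ ρ n) →
      Tendsto (fun n => √(D.p n) * ρ n) atTop (𝓝 0) →
      (∀ᶠ n in atTop, Metric.closedBall (D.β₀ n) (ρ n) ⊆ D.B n) →
      WithProbTendstoOne P fun n ω => ∀ β₁ ∈ Metric.closedBall (D.β₀ n) (ρ n),
        ∀ β₂ ∈ Metric.closedBall (D.β₀ n) (ρ n),
        (β₁ - β₂).ofLp ⬝ᵥ (D.S n ω β₁ - D.S n ω β₂) ≤ -κ * ‖β₁ - β₂‖ ^ 2 ∧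
        ∀ u : EuclideanSpace ℝ (Fin (D.p n)),
          |u.ofLp ⬝ᵥ (D.S n ω β₁ - D.S n ω β₂)| ≤ L * (‖u‖ * ‖β₁ - β₂‖) := by
  obtain ⟨c, C, M, hc, hreg⟩ := h6.exists_regular h2
  obtain ⟨K, hK0, hK⟩ := h1.exists_sum_sq_le
  obtain ⟨⟨b₁, b₂, hb₁, hb₂, hgram⟩, -⟩ := h3
  obtain ⟨κ₂, C₂, hκ₂, hC₂, hR⟩ := hD.Rtilde_bounds h4 hp
  set V := 2 * (D.φ * |C|) + 2 * (1 + D.φ * |C|) ^ 2 with hV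
  have hφC : 0 ≤ D.φ * |C| := mul_nonneg hD.φ_pos.le (abs_nonneg _)
  have hV0 : 0 ≤ V := by positivity
  set C₁ := b₂ + b₁ / 2
  have hC₁ : 0 ≤ C₁ := by positivity
  -- `1 + |e|` is `1 + E(|e| | X) ≤ 2 + φ|C|` plus the centred part. The former multiplies the Gram
  -- bound `C₁`; the latter contributes at most `1` in Frobenius norm.
  set C₃ := (2 + D.φ * |C|) * C₁ + 1
  have hC₃ : 0 ≤ C₃ := by positivity
  obtain ⟨k, hk1, hkb⟩ := exists_derivBounds (c := c) (C := C) (M := M) hc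
  have hk0 : 0 ≤ k := by linarith
  obtain ⟨η, κ, L, hη, hκ, hκL, hmain⟩ := exists_monotonicity_constants m C M C₁ C₂ C₃ hc
    (half_pos hb₁) hκ₂ hC₁ hC₂.le hC₃
  refine ⟨κ, L, hκ, hκL, fun ρ hρ0 hρ hρB => ?_⟩
  have md : Measurable (deriv D.g) := measurable_deriv _
  have ms : Measurable fun s => √(deriv D.g s) := md.sqrt
  have md2 : Measurable (iteratedDeriv 2 D.g) := by
    rw [iteratedDeriv_succ]; exact measurable_deriv _
  have mdS : Measurable (dSqrt D.g) := md2.div (ms.const_mul 2)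
  have mdI : Measurable (dInvSqrt D.g) := mdS.neg.div (ms.pow_const 2)
  have herr : ∀ k, ∀ᶠ n in atTop, ∀ i, MemLp (D.err n i k) 2 (P n) ∧
      (P n)[D.err n i k | D.sigmaX n i] =ᵐ[P n] 0 ∧ ∫ ω, D.err n i k ω ^ 2 ∂P n ≤ V := by
    intro k
    filter_upwards [hreg] with n hreg i
    refine ⟨hD.memLp_err n i k, hD.condExp_err n i k,
      (hD.integral_err_sq_le hc hreg.2 i k).trans ?_⟩
    rw [hV]; nlinarith
  have habs : ∀ k, ∀ᶠ n in atTop, ∀ i, MemLp (D.absErrCentered P n i k) 2 (P n) ∧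
      (P n)[D.absErrCentered P n i k | D.sigmaX n i] =ᵐ[P n] 0 ∧
      ∫ ω, D.absErrCentered P n i k ω ^ 2 ∂P n ≤ V := by
    intro k
    filter_upwards [hreg] with n hreg i
    exact hD.absErrCentered_moments hc hreg.2 i k
  -- The two noise families come from differentiating `A^{1/2}` and `A^{-1/2}`; their coefficients
  -- depend on the covariates alone, so conditional centring of the residual suffices.
  have hN1 := withProbTendstoOne_forall fun j : Fin m => withProbTendstoOne_forall fun k' : Fin m =>
    hD.matrix_sum_small h1 h7 hp j j
      (q := fun n i ω => dSqrt D.g (eta (D.X n ω i) (D.β₀ n) j) *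
        (√(deriv D.g (eta (D.X n ω i) (D.β₀ n) k')))⁻¹) (ζ := fun n i => D.err n i k')
      (fun n i => (D.measurable_comp_eta n i j mdS).mul
        (D.measurable_comp_eta n i k' ms.inv))
      (fun n i => hD.measurable_err n i k') (Q := k * k) hV0 (herr k')
      (hreg.mono fun n h => h.2.mono fun ω h i =>
        abs_mul_le (hkb _ _ (h i j)).2.2.2.1 (hkb _ _ (h i k')).2.2.1) hη
  have hN2 := withProbTendstoOne_forall fun j : Fin m => withProbTendstoOne_forall fun k' : Fin m =>
    hD.matrix_sum_small h1 h7 hp j k'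
      (q := fun n i ω => √(deriv D.g (eta (D.X n ω i) (D.β₀ n) j)) *
        dInvSqrt D.g (eta (D.X n ω i) (D.β₀ n) k')) (ζ := fun n i => D.err n i k')
      (fun n i => (D.measurable_comp_eta n i j ms).mul
        (D.measurable_comp_eta n i k' mdI))
      (fun n i => hD.measurable_err n i k') (Q := k * k) hV0 (herr k')
      (hreg.mono fun n h => h.2.mono fun ω h i =>
        abs_mul_le (hkb _ _ (h i j)).2.1 (hkb _ _ (h i k')).2.2.2.2.1) hη
  have hN3 := withProbTendstoOne_forall fun l : Fin m => withProbTendstoOne_forall fun k' : Fin m =>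
    hD.matrix_sum_small h1 h7 hp l l (q := fun n i ω => 1)
      (ζ := fun n i => D.absErrCentered P n i k') (fun n i => measurable_const)
      (fun n i => hD.measurable_absErrCentered n i k') (Q := 1) hV0 (habs k')
      (Eventually.of_forall fun n => Eventually.of_forall fun ω i => by simp) one_pos
  have hG := hD.gram_fluctuation_small h1 h7 hp (half_pos hb₁)
  -- Within the ball a predictor moves by at most `‖x_ij‖ρ ≤ K√p ρ`, which falls below the tolerance
  -- `η` because `√p ρ → 0`.
  have hω : ∀ᶠ n in atTop, K * (√(D.p n) * ρ n) < η :=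
    (hρ.const_mul K).eventually_lt_const (by simpa using hη)
  have hf : ∀ᶠ n in atTop, ∀ᵐ ω ∂P n, ∀ i k',
      ((P n)[fun ω => |D.err n i k' ω| | D.sigmaX n i]) ω ≤ 1 + D.φ * |C| := by
    filter_upwards [hreg] with n hreg
    rw [ae_all_iff]; intro i; rw [ae_all_iff]; intro k'
    exact (hD.condExp_abs_err_le hc hreg.2 i k').mono fun ω h => h.2
  refine ((((hN1.and hN2).and hN3).and hG).and hR).mono ?_
  filter_upwards [hω, hf, hreg, hK, hgram, hρB] with n hω hf hreg hK hgram hρB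
  filter_upwards [hf, hreg.1, hK, hgram, hD.π_mem n] with ω hf hreg hK hgram hπ hgood
  obtain ⟨⟨⟨⟨hN1, hN2⟩, hN3⟩, hG⟩, hR1, hR2⟩ := hgood
  have hW := weight_nonneg (fun i => (hπ i).1) (D.δ n ω)
  have hgb := weighted_gram_bounds (half_pos hb₁).le hgram hG
  refine hmain n (D.p n) D.g (D.X n ω) (D.Y n ω) (D.π n ω) (D.δ n ω) (D.Rtilde n ω) (D.β₀ n) (ρ n)
    (K * (√(D.p n) * ρ n)) (mul_nonneg hK0 (mul_nonneg (Real.sqrt_nonneg _) (hρ0 n))) hω.le (hρ0 n)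
    (fun i => (hπ i).1) (fun i j β hβ => hreg i j β (hρB hβ)) ?_ hR1 hR2 ?_ ?_ ?_ ?_
  · intro i j β hβ
    rw [← eta_sub]
    refine (abs_eta_le _ _ _).trans ?_
    rw [← mul_assoc]
    exact mul_le_mul (hK i j).1 (by rwa [Metric.mem_closedBall, dist_eq_norm] at hβ)
      (norm_nonneg _) (mul_nonneg hK0 (Real.sqrt_nonneg _))
  · intro v
    have := hgb v
    have e : b₁ - b₁ / 2 = b₁ / 2 := by ring
    rwa [e] at this
  · intro v l k'
    have e3 := (abs_le.mp (abs_sum_mul_eta_mul_eta_le one_pos.le (hN3 l k') v v)).2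
    have e4 := (hgb v).2
    have e5 : ∑ i, weight (D.π n ω) (D.δ n ω) i * eta (D.X n ω i) v l ^ 2 ≤
        ∑ i, weight (D.π n ω) (D.δ n ω) i * ∑ j, eta (D.X n ω i) v j ^ 2 := by
      refine Finset.sum_le_sum fun i _ => mul_le_mul_of_nonneg_left ?_ (hW i)
      exact Finset.single_le_sum (f := fun j => eta (D.X n ω i) v j ^ 2)
        (fun _ _ => sq_nonneg _) (Finset.mem_univ l)
    have e6 : ∑ i, weight (D.π n ω) (D.δ n ω) i * (1 + |D.Y n ω i k' -
          D.g (eta (D.X n ω i) (D.β₀ n) k')|) * eta (D.X n ω i) v l ^ 2 ≤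
        (2 + D.φ * |C|) * ∑ i, weight (D.π n ω) (D.δ n ω) i * eta (D.X n ω i) v l ^ 2 +
        ∑ i, weight (D.π n ω) (D.δ n ω) i * (1 * D.absErrCentered P n i k' ω) *
          (eta (D.X n ω i) v l * eta (D.X n ω i) v l) := by
      rw [Finset.mul_sum, ← Finset.sum_add_distrib]
      refine Finset.sum_le_sum fun i _ => ?_
      have h8 := hf i k'
      have h9 : |D.Y n ω i k' - D.g (eta (D.X n ω i) (D.β₀ n) k')| =
          D.absErrCentered P n i k' ω + ((P n)[fun ω => |D.err n i k' ω| | D.sigmaX n i]) ω := by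
        simp [absErrCentered, err]
      rw [h9]
      have h10 : 0 ≤ weight (D.π n ω) (D.δ n ω) i * eta (D.X n ω i) v l ^ 2 :=
        mul_nonneg (hW i) (sq_nonneg _)
      nlinarith [mul_le_mul_of_nonneg_left h8 h10]
    refine e6.trans ?_
    have e7 : (2 + D.φ * |C|) * ∑ i, weight (D.π n ω) (D.δ n ω) i * eta (D.X n ω i) v l ^ 2 ≤
        (2 + D.φ * |C|) * (C₁ * ‖v‖ ^ 2) :=
      mul_le_mul_of_nonneg_left (e5.trans e4) (by positivity)
    calc _ ≤ (2 + D.φ * |C|) * (C₁ * ‖v‖ ^ 2) + 1 * (‖v‖ * ‖v‖) := add_le_add e7 e3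
      _ = _ := by ring
  · intro u d j k'
    refine le_trans (le_of_eq ?_) (abs_sum_mul_eta_mul_eta_le hη.le (hN1 j k') u d)
    congr 1
    exact Finset.sum_congr rfl fun i _ => by simp only [err]; ring
  · intro u d j k'
    refine le_trans (le_of_eq ?_) (abs_sum_mul_eta_mul_eta_le hη.le (hN2 j k') u d)
    congr 1
    exact Finset.sum_congr rfl fun i _ => by simp only [err]; ring

end Arr

/-! ### Slowly growing radii, measurability of the iteration, and rates. -/

/-- Diagonal argument: `k n` is the largest index up to `n` whose property holds at `n`, and every
fixed index is eventually available. -/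
theorem exists_tendsto_atTop_eventually {Q : ℕ → ℕ → Prop} (h : ∀ k, ∀ᶠ n in atTop, Q k n) :
    ∃ k : ℕ → ℕ, Tendsto k atTop atTop ∧ ∀ᶠ n in atTop, Q (k n) n := by
  classical
  refine ⟨fun n => Nat.findGreatest (fun k => Q k n) n, ?_, ?_⟩
  · rw [tendsto_atTop]
    intro j
    filter_upwards [h j, eventually_ge_atTop j] with n h1 h2
    exact Nat.le_findGreatest h2 h1
  -- `Nat.findGreatest` returns `0` by default, so the property at index `0` is needed for the
  -- choice to be valid.
  · filter_upwards [h 0] with n h1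
    exact Nat.findGreatest_spec (P := fun k => Q k n) (Nat.zero_le n) h1

theorem measurable_det_entries {α : Type*} [MeasurableSpace α] {k : ℕ}
    {M : α → Matrix (Fin k) (Fin k) ℝ} (hM : ∀ i j, Measurable fun a => M a i j) :
    Measurable fun a => (M a).det := by
  simp only [det_apply']
  exact Finset.measurable_sum _ fun σ _ => (Finset.measurable_prod _ fun i _ => hM _ _).const_mul _

theorem measurable_inv_entry {α : Type*} [MeasurableSpace α] {k : ℕ}
    {M : α → Matrix (Fin k) (Fin k) ℝ} (hM : ∀ i j, Measurable fun a => M a i j) (i j : Fin k) :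
    Measurable fun a => (M a)⁻¹ i j := by
  simp only [inv_def, Matrix.smul_apply, smul_eq_mul, Ring.inverse_eq_inv', adjugate_apply]
  refine (measurable_det_entries hM).inv.mul (measurable_det_entries fun i' j' => ?_)
  simp only [updateRow_apply]
  split_ifs
  · exact measurable_const
  · exact hM i' j'

namespace Arr

variable {m : ℕ} {Ω : ℕ → Type*}

/-- The estimating function as a field on Euclidean space. -/
def field (D : Arr m Ω) (n : ℕ) (ω : Ω n) (β : EuclideanSpace ℝ (Fin (D.p n))) :
    EuclideanSpace ℝ (Fin (D.p n)) :=
  WithLp.toLp 2 (D.S n ω β)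

theorem inner_field_sub (D : Arr m Ω) (n : ℕ) (ω : Ω n) (u β₁ β₂ : EuclideanSpace ℝ (Fin (D.p n))) :
    inner ℝ u (D.field n ω β₁ - D.field n ω β₂) =
      u.ofLp ⬝ᵥ (D.S n ω β₁ - D.S n ω β₂) := by
  simp [field, PiLp.inner_apply, dotProduct, mul_comm]

/-- Strong monotonicity and Lipschitz continuity of the estimating function on a ball. -/
def FieldRegularOn (D : Arr m Ω) (κ L : ℝ) (n : ℕ) (ρ : ℝ) (ω : Ω n) : Prop :=
  ∀ β₁ ∈ Metric.closedBall (D.β₀ n) ρ, ∀ β₂ ∈ Metric.closedBall (D.β₀ n) ρ,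
    inner ℝ (β₁ - β₂) (D.field n ω β₁ - D.field n ω β₂) ≤ -κ * ‖β₁ - β₂‖ ^ 2 ∧
    ‖D.field n ω β₁ - D.field n ω β₂‖ ≤ L * ‖β₁ - β₂‖

/-- Monotonicity between `β` and `β₀` gives `κ‖β - β₀‖² ≤ ⟨β - β₀, S_r(β₀)⟩`; Cauchy–Schwarz then
bounds the error of any zero in the ball by the score at the truth. -/
theorem norm_sub_le_of_field_eq_zero {D : Arr m Ω} {κ L ρ : ℝ} (hκ : 0 < κ) {n : ℕ} {ω : Ω n}
    (h : D.FieldRegularOn κ L n ρ ω) {β : EuclideanSpace ℝ (Fin (D.p n))}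
    (hβ : β ∈ Metric.closedBall (D.β₀ n) ρ) (h0 : D.S n ω β = 0) :
    ‖β - D.β₀ n‖ ≤ κ⁻¹ * ‖D.field n ω (D.β₀ n)‖ := by
  have hρ : 0 ≤ ρ := Metric.nonempty_closedBall.mp ⟨β, hβ⟩
  have h1 := (h β hβ _ (Metric.mem_closedBall_self hρ)).1
  have hf : D.field n ω β = 0 := by rw [field, h0]; rfl
  rw [hf, zero_sub, inner_neg_right] at h1
  have h2 := real_inner_le_norm (β - D.β₀ n) (D.field n ω (D.β₀ n))
  rcases (norm_nonneg (β - D.β₀ n)).eq_or_lt with h3 | h3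
  · rw [← h3]; positivity
  · rw [inv_mul_eq_div, le_div_iff₀ hκ]
    refine le_of_mul_le_mul_left ?_ h3
    linarith

theorem sqrt_dim_mul_rate (D : Arr m Ω) (n : ℕ) :
    √(D.p n) * D.rate n = √((D.p n : ℝ) ^ 2 / D.r n) := by
  rw [rate, ← Real.sqrt_mul (Nat.cast_nonneg _)]
  congr 1; ring

/-- Radii growing slightly faster than the rate, along which the balls stay in the parameter set. -/
theorem C2.exists_radii {D : Arr m Ω} (h2 : D.C2)
    (hp : Tendsto (fun n => (D.p n : ℝ) ^ 2 / D.r n) atTop (𝓝 0)) :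
    ∃ k : ℕ → ℕ, Tendsto k atTop atTop ∧
      Tendsto (fun n => √(D.p n) * (((k n : ℝ) + 1) * D.rate n)) atTop (𝓝 0) ∧
      ∀ᶠ n in atTop, Metric.closedBall (D.β₀ n) (((k n : ℝ) + 1) * D.rate n) ⊆ D.B n := by
  have hsq : Tendsto (fun n => √((D.p n : ℝ) ^ 2 / D.r n)) atTop (𝓝 0) := by
    have := hp.sqrt
    rwa [Real.sqrt_zero] at this
  -- For fixed `k` both requirements hold eventually, by (C2) and `p²/r → 0`. The bound `1/(k + 1)`
  -- makes the diagonal choice tend to zero, and `k + 1` keeps the multiplier positive at `k = 0`.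
  obtain ⟨k, hk, h⟩ := exists_tendsto_atTop_eventually
    (Q := fun k n => Metric.closedBall (D.β₀ n) (((k : ℝ) + 1) * D.rate n) ⊆ D.B n ∧
      √(D.p n) * (((k : ℝ) + 1) * D.rate n) ≤ 1 / ((k : ℝ) + 1)) fun k => by
      have hk : (0 : ℝ) < (k : ℝ) + 1 := by positivity
      have h3 : ∀ᶠ n in atTop, ((k : ℝ) + 1) * √((D.p n : ℝ) ^ 2 / D.r n) < 1 / ((k : ℝ) + 1) :=
        (hsq.const_mul _).eventually_lt_const (by rw [mul_zero]; positivity)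
      filter_upwards [h2.2.2 _ hk, h3] with n h1 h3
      refine ⟨h1, le_trans (le_of_eq ?_) h3.le⟩
      rw [← sqrt_dim_mul_rate]; ring
  refine ⟨k, hk, ?_, h.mono fun n h => h.1⟩
  refine squeeze_zero' (Eventually.of_forall fun n => ?_) (h.mono fun n h => h.2)
    (tendsto_one_div_add_atTop_nhds_zero_nat.comp hk)
  have : 0 ≤ D.rate n := Real.sqrt_nonneg _
  positivity

variable [∀ n, MeasurableSpace (Ω n)] {D : Arr m Ω}
  {P : ∀ n, Measure (Ω n)}

theorem IsModel.measurable_field (hD : D.IsModel P) (n : ℕ)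
    {b : Ω n → EuclideanSpace ℝ (Fin (D.p n))} (hb : Measurable b) :
    Measurable fun ω => D.field n ω (b ω) := by
  refine (WithLp.measurable_toLp 2 _).comp (measurable_pi_lambda _ fun l => ?_)
  have h1 : ∀ ω, D.S n ω (b ω) l = ∑ j, ∑ k, (D.Rtilde n ω)⁻¹ j k * ∑ i,
      weight (D.π n ω) (D.δ n ω) i * (eta (D.X n ω i) (EuclideanSpace.single l 1) j *
        scoreEntry D.g (D.Y n ω i k) (eta (D.X n ω i) (b ω) j) (eta (D.X n ω i) (b ω) k)) := by
    intro ω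
    rw [← dotProduct_score]
    simp [S]
  have heta : ∀ (b : Ω n → EuclideanSpace ℝ (Fin (D.p n))), Measurable b → ∀ i j,
      Measurable fun ω => eta (D.X n ω i) (b ω) j := by
    intro b hb i j
    simp only [eta, mulVec, dotProduct]
    refine Finset.measurable_sum _ fun k _ => (hD.meas_X n i j k).mul ?_
    exact (measurable_pi_apply k).comp ((WithLp.measurable_ofLp 2 _).comp hb)
  have ms : Measurable fun s => √(deriv D.g s) := (measurable_deriv _).sqrt
  simp only [h1]
  refine Finset.measurable_sum _ fun j _ => Finset.measurable_sum _ fun k _ =>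
    (measurable_inv_entry (hD.meas_Rtilde n) j k).mul (Finset.measurable_sum _ fun i _ =>
      Measurable.mul ?_ ((heta _ measurable_const i j).mul ?_))
  · exact Measurable.const_mul (Measurable.ite (hD.meas_δ n i (measurableSet_singleton true))
      ((hD.meas_π n i).const_div 1) measurable_const) _
  · exact ((ms.comp (heta b hb i j)).mul (ms.comp (heta b hb i k)).inv).mul
      ((hD.meas_Y n i k).sub (hD.meas_g.comp (heta b hb i k)))

/-- The solution will be a limit of these iterates, so its measurability follows without any
selection argument. -/
theorem IsModel.measurable_iterate (hD : D.IsModel P) (n : ℕ) (t : ℝ) (j : ℕ) :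
    Measurable fun ω => (fun β => β + t • D.field n ω β)^[j] (D.β₀ n) := by
  induction j with
  | zero => exact measurable_const
  | succ j ih =>
    simp only [Function.iterate_succ_apply']
    exact ih.add ((hD.measurable_field n ih).const_smul t)

theorem local_solution_isBigOP {κ L : ℝ} (hκ : 0 < κ) {ρ : ℕ → ℝ}
    (hreg : WithProbTendstoOne P fun n ω => D.FieldRegularOn κ L n (ρ n) ω)
    (h0 : IsBigOP P (fun n ω => ‖D.field n ω (D.β₀ n)‖) D.rate)
    {βt : ∀ n, Ω n → EuclideanSpace ℝ (Fin (D.p n))}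
    (hβ : WithProbTendstoOne P
      fun n ω => βt n ω ∈ Metric.closedBall (D.β₀ n) (ρ n) ∧ D.S n ω (βt n ω) = 0) :
    IsBigOP P (fun n ω => ‖βt n ω - D.β₀ n‖) D.rate := by
  refine h0.of_le (inv_pos.mpr hκ) ((hreg.and hβ).mono (Eventually.of_forall fun n =>
    Eventually.of_forall fun ω h => ?_))
  rw [abs_of_nonneg (norm_nonneg _), abs_of_nonneg (norm_nonneg _)]
  exact norm_sub_le_of_field_eq_zero hκ h.1 h.2.1 h.2.2

variable [∀ n, IsProbabilityMeasure (P n)]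

/-- At the true parameter the estimating function is of order `√(p / r)`. -/
theorem IsModel.field_true_isBigOP (hD : D.IsModel P) (h1 : D.C1 P) (h2 : D.C2)
    (h4 : D.C4 P) (h6 : D.C6 P) (h7 : D.C7 P)
    (hp : Tendsto (fun n => (D.p n : ℝ) ^ 2 / D.r n) atTop (𝓝 0)) :
    IsBigOP P (fun n ω => ‖D.field n ω (D.β₀ n)‖) D.rate := by
  obtain ⟨c, C, M, hc, hreg⟩ := h6.exists_regular h2
  obtain ⟨K, hK0, hK⟩ := h1.exists_sum_sq_le
  obtain ⟨κ₂, C₂, hκ₂, hC₂, hR⟩ := hD.Rtilde_bounds h4 hp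
  obtain ⟨k, hk1, hkb⟩ := exists_derivBounds (c := c) (C := C) (M := M) hc
  have hV0 : 0 ≤ D.φ * |C| := mul_nonneg hD.φ_pos.le (abs_nonneg _)
  have ms : Measurable fun s => √(deriv D.g s) := (measurable_deriv _).sqrt
  have hrate : ∀ᶠ n in atTop, 0 ≤ D.rate n := Eventually.of_forall fun n => Real.sqrt_nonneg _
  have hent : ∀ j k', IsBigOP P (fun n ω => √(∑ l, (∑ i, weight (D.π n ω) (D.δ n ω) i *
      (D.X n ω i j l * (√(deriv D.g (eta (D.X n ω i) (D.β₀ n) j)) *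
        (√(deriv D.g (eta (D.X n ω i) (D.β₀ n) k')))⁻¹) * D.err n i k' ω)) ^ 2)) D.rate := by
    intro j k'
    have h := (hD.weighted_sum_mul_isBigOP h7 (α := fun n => Fin (D.p n))
      (ψ := fun n i l ω => D.X n ω i j l * (√(deriv D.g (eta (D.X n ω i) (D.β₀ n) j)) *
        (√(deriv D.g (eta (D.X n ω i) (D.β₀ n) k')))⁻¹)) (ζ := fun n i => D.err n i k')
      (fun n i l => (D.measurable_X n i j l).mul ((D.measurable_comp_eta n i j ms).mul
        (D.measurable_comp_eta n i k' ms.inv))) (fun n i => hD.measurable_err n i k') hV0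
      -- Only a vector of length `p` is summed here, so the bound is of order `p` and the norm of
      -- order `√(p/r)`.
      (B := fun n => K ^ 2 * D.p n * (k * k) ^ 2) (fun n => by positivity)
      (hreg.mono fun n h i => ⟨hD.memLp_err n i k', hD.condExp_err n i k',
        hD.integral_err_sq_le hc h.2 i k'⟩) (by
        filter_upwards [hK, hreg] with n hK hreg
        filter_upwards [hK, hreg.2] with ω hK hreg i
        simp only [mul_pow _ (√(deriv D.g _) * _)]
        rw [← Finset.sum_mul]
        refine mul_le_mul (hK i j).2 ?_ (sq_nonneg _) (by positivity)
        rw [← sq_abs]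
        exact pow_le_pow_left₀ (abs_nonneg _)
          (abs_mul_le (hkb _ _ (hreg i j)).2.1 (hkb _ _ (hreg i k')).2.2.1) 2)).sqrt
    refine IsBigOP.of_const_mul (C := √(D.φ * |C| * (K ^ 2 * (k * k) ^ 2))) (Real.sqrt_nonneg _)
      hrate ?_
    have e : (fun n => √(D.φ * |C| * (K ^ 2 * D.p n * (k * k) ^ 2) / D.r n)) =
        fun n => √(D.φ * |C| * (K ^ 2 * (k * k) ^ 2)) * D.rate n := by
      ext n
      rw [rate, ← Real.sqrt_mul (by positivity)]
      congr 1; ring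
    rwa [e] at h
  have hsum := IsBigOP.sum (Finset.univ : Finset (Fin m)) hrate fun j _ =>
    IsBigOP.sum (Finset.univ : Finset (Fin m)) hrate fun k' _ => hent j k'
  refine hsum.of_le hC₂ (hR.mono (Eventually.of_forall fun n => Eventually.of_forall
    fun ω h => ?_))
  rw [abs_of_nonneg (norm_nonneg _), abs_of_nonneg (Finset.sum_nonneg fun _ _ =>
    Finset.sum_nonneg fun _ _ => Real.sqrt_nonneg _)]
  exact norm_score_le D.g (D.X n ω) (D.Y n ω) (D.π n ω) (D.δ n ω) (D.Rtilde n ω) (D.β₀ n) h.1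

theorem IsModel.fieldRegularOn (hD : D.IsModel P) (h1 : D.C1 P) (h2 : D.C2) (h3 : D.C3 P)
    (h4 : D.C4 P) (h6 : D.C6 P) (h7 : D.C7 P)
    (hp : Tendsto (fun n => (D.p n : ℝ) ^ 2 / D.r n) atTop (𝓝 0)) :
    ∃ κ L : ℝ, 0 < κ ∧ κ ≤ L ∧ ∀ ρ : ℕ → ℝ, (∀ n, 0 ≤ ρ n) →
      Tendsto (fun n => √(D.p n) * ρ n) atTop (𝓝 0) →
      (∀ᶠ n in atTop, Metric.closedBall (D.β₀ n) (ρ n) ⊆ D.B n) →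
      WithProbTendstoOne P fun n ω => D.FieldRegularOn κ L n (ρ n) ω := by
  obtain ⟨κ, L, hκ, hκL, h⟩ := hD.score_monotone h1 h2 h3 h4 h6 h7 hp
  refine ⟨κ, L, hκ, hκL, fun ρ hρ0 hρ hρB => (h ρ hρ0 hρ hρB).mono (Eventually.of_forall
    fun n => Eventually.of_forall fun ω h β₁ hβ₁ β₂ hβ₂ => ?_)⟩
  obtain ⟨hm, hl⟩ := h β₁ hβ₁ β₂ hβ₂
  refine ⟨by rwa [inner_field_sub], ?_⟩
  set v := D.field n ω β₁ - D.field n ω β₂ with hv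
  -- Testing against the increment itself turns the bilinear bound into a norm bound.
  have h5 := hl v
  rw [← inner_field_sub, ← hv, real_inner_self_eq_norm_sq, abs_of_nonneg (sq_nonneg _)] at h5
  rcases (norm_nonneg v).eq_or_lt with h0 | h0
  · rw [← h0]; exact mul_nonneg (hκ.le.trans hκL) (norm_nonneg _)
  · refine le_of_mul_le_mul_left ?_ h0
    calc ‖v‖ * ‖v‖ = ‖v‖ ^ 2 := (sq _).symm
      _ ≤ _ := h5
      _ = _ := by ring

end Arr

end SubGEE

end

/-! ### Existence and rate. -/

theorem theorem1 {m : ℕ} {Ω : ℕ → Type*} [∀ n, MeasurableSpace (Ω n)]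
    (P : ∀ n, Measure (Ω n)) [∀ n, IsProbabilityMeasure (P n)]
    (D : SubGEE.Arr m Ω) (hD : D.IsModel P)
    (h1 : D.C1 P) (h2 : D.C2) (h3 : D.C3 P) (h4 : D.C4 P) (h5 : D.C5 P) (h6 : D.C6 P)
    (h7 : D.C7 P)
    (hp : Tendsto (fun n => (D.p n : ℝ) ^ 2 / D.r n) atTop (𝓝 0)) :
    (∃ βt : ∀ n, Ω n → EuclideanSpace ℝ (Fin (D.p n)),
      (∀ n, Measurable (βt n)) ∧
      SubGEE.WithProbTendstoOne P (fun n ω => βt n ω ∈ D.B n ∧ D.S n ω (βt n ω) = 0) ∧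
      SubGEE.IsBigOP P (fun n ω => ‖βt n ω - D.β₀ n‖) D.rate) ∧
    (∀ ρ : ℕ → ℝ, Tendsto (fun n => √(D.p n) * ρ n) atTop (𝓝 0) →
      (∀ᶠ n : ℕ in atTop, Metric.closedBall (D.β₀ n) (ρ n) ⊆ D.B n) →
      ∀ βt : ∀ n, Ω n → EuclideanSpace ℝ (Fin (D.p n)),
      SubGEE.WithProbTendstoOne P
        (fun n ω => βt n ω ∈ Metric.closedBall (D.β₀ n) (ρ n) ∧ D.S n ω (βt n ω) = 0) →
      SubGEE.IsBigOP P (fun n ω => ‖βt n ω - D.β₀ n‖) D.rate) := by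
  have h0 := hD.field_true_isBigOP h1 h2 h4 h6 h7 hp
  obtain ⟨κ, L, hκ, hκL, hreg⟩ := hD.fieldRegularOn h1 h2 h3 h4 h6 h7 hp
  constructor
  · obtain ⟨k, hk, hkρ, hkB⟩ := h2.exists_radii hp
    have hρ0 : ∀ n, 0 ≤ ((k n : ℝ) + 1) * D.rate n := fun n =>
      mul_nonneg (by positivity) (Real.sqrt_nonneg _)
    have hreg' := hreg _ hρ0 hkρ hkB
    -- Since `k_n → ∞`, a radius of `k_n + 1` times the rate eventually exceeds any fixed multiple
    -- of the rate; the contraction can then start at `β₀`.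
    have hsmall : SubGEE.WithProbTendstoOne P fun n ω =>
        2 * ‖D.field n ω (D.β₀ n)‖ ≤ κ * (((k n : ℝ) + 1) * D.rate n) := by
      rw [SubGEE.withProbTendstoOne_iff]
      intro ε hε
      obtain ⟨M, hM, h⟩ := h0 ε hε
      have hlarge : ∀ᶠ n in atTop, 2 * M / κ ≤ (k n : ℝ) :=
        (tendsto_natCast_atTop_atTop.comp hk).eventually_ge_atTop _
      filter_upwards [h, hlarge] with n h hlarge
      refine le_trans (measure_mono fun ω hω => ?_) h
      simp only [Set.mem_ofPred_eq, not_le, abs_of_nonneg (norm_nonneg _)] at hω ⊢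
      rw [div_le_iff₀ hκ] at hlarge
      have hr : 0 ≤ D.rate n := Real.sqrt_nonneg _
      nlinarith
    -- Off the good event the iterates may diverge and `limUnder` returns an arbitrary value; the
    -- map is measurable all the same.
    set βt : ∀ n, Ω n → EuclideanSpace ℝ (Fin (D.p n)) := fun n ω =>
      limUnder atTop fun j => (fun β => β + (κ / L ^ 2) • D.field n ω β)^[j] (D.β₀ n) with hβt
    have hsol : SubGEE.WithProbTendstoOne P fun n ω =>
        βt n ω ∈ Metric.closedBall (D.β₀ n) (((k n : ℝ) + 1) * D.rate n) ∧
          D.S n ω (βt n ω) = 0 := by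
      refine (hreg'.and hsmall).mono (Eventually.of_forall fun n => Eventually.of_forall
        fun ω h => ?_)
      obtain ⟨y, hy, hy0, hlim⟩ := SubGEE.exists_zero_of_strongly_monotone (D.field n ω) (D.β₀ n)
        hκ hκL (hρ0 n) (fun x hx y hy => (h.1 x hx y hy).1) (fun x hx y hy => (h.1 x hx y hy).2) h.2
      have hβy : βt n ω = y := hlim.limUnder_eq
      rw [hβy]
      refine ⟨hy, ?_⟩
      have := congrArg WithLp.ofLp hy0
      simpa [SubGEE.Arr.field] using this
    refine ⟨βt, fun n => ?_, ?_, SubGEE.Arr.local_solution_isBigOP hκ hreg' h0 hsol⟩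
    · exact (StronglyMeasurable.limUnder
        fun j => (hD.measurable_iterate n (κ / L ^ 2) j).stronglyMeasurable).measurable
    · refine hsol.mono (hkB.mono fun n hB => Eventually.of_forall fun ω h => ⟨hB h.1, h.2⟩)
  · intro ρ hρ hρB βt hβt
    -- The radii may be negative for some `n`. Replacing them by `max (ρ n) 0` only enlarges the
    -- balls, and a ball of radius zero is the point `β₀`, which lies in the parameter set.
    refine SubGEE.Arr.local_solution_isBigOP (ρ := fun n => max (ρ n) 0) hκ
      (hreg _ (fun n => le_max_right _ _) ?_ ?_) h0 (hβt.mono (Eventually.of_forall fun n =>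
        Eventually.of_forall fun ω h => ⟨Metric.closedBall_subset_closedBall (le_max_left _ _) h.1,
          h.2⟩))
    · have := hρ.max (tendsto_const_nhds (x := (0 : ℝ)))
      rw [max_self] at this
      refine this.congr fun n => ?_
      rw [mul_max_of_nonneg _ _ (Real.sqrt_nonneg _), mul_zero]
    · filter_upwards [hρB] with n hB
      rcases le_total (ρ n) 0 with h | h
      · rw [max_eq_right h, Metric.closedBall_zero]
        exact Set.singleton_subset_iff.mpr (h2.2.1 n)
      · rwa [max_eq_left h]
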